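/- For integers $m,n\ge 1$ and $0\le k\le \min\{m,n\}$ let $G_{m,n,k}$ be the graph obtained from the complete bipartite graph $K_{m,n}$ by removing a $k$-matching (a set of $k$ pairwise independent edges; up to isomorphism the choice does not matter). The nonorientable genus $\tilde\gamma(G)$ of a finite graph $G$ is the smallest integer $g>0$ such that $G$ can be embedded in the nonorientable surface $N_g$ (the sphere with $g$ crosscaps); embeddings are described combinatorially, by rotation systems with edge signatures. Theorem. If $m,n\ge 3$, $0\le k\le\min\{m,n\}$ and $(m,n,k)\notin\{(5,4,4),(4,5,4),(5,5,5)\}$, then $$\tilde\gamma(G_{m,n,k})=\max\left\{\left\lceil\frac{(m-2)(n-2)-k}{2}\right\rceil,\,1\right\}.$$ In particular, for every $n\ge 6$, $$\tilde\gamma(G_{n,n,n})=\left\lceil\frac{(n-2)(n-2)-n}{2}\right\rceil=\frac{n^2-5n+4}{2},\qquad \tilde\gamma(G_{n+1,n,n})=\left\lceil\frac{(n-1)(n-2)-n}{2}\right\rceil,$$ and if moreover $n$ is even, then $$\tilde\gamma(G_{n+1,n,n})=\frac{n^2-4n+2}{2}.$$ -/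

import Mathlib

/-! Combinatorial description of embeddings of finite graphs in closed surfaces
(rotation systems with signatures), and the nonorientable genus. -/

namespace GraphEmb

/-- An embedding scheme of a graph `G`: at every vertex a cyclic order of the darts (directed edges)
that leave it, and a sign for every edge.  Sign `-1` means that the edge is twisted: the local
orientations chosen at its two ends do not agree along the edge.  This is the same thing as a band
decomposition (ribbon neighbourhood) of `G`: a disc for every vertex, a band for every edge. -/
structure EmbeddingScheme {V : Type*} (G : SimpleGraph V) where
  /-- the rotation: `rot d` is the dart that follows `d` in the local orientation at `d.fst` -/
  rot : Equiv.Perm G.Dart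
  /-- the rotation does not change the initial vertex -/
  rot_fst : ∀ d : G.Dart, (rot d).fst = d.fst
  /-- the darts leaving one vertex form a single cycle -/
  rot_cycle : ∀ d d' : G.Dart, d.fst = d'.fst → rot.SameCycle d d'
  /-- the signature -/
  sign : G.Dart → ℤˣ
  /-- the sign depends on the edge only -/
  sign_symm : ∀ d : G.Dart, sign d.symm = sign d

namespace EmbeddingScheme

variable {V : Type*} {G : SimpleGraph V}

/-- A flag `(d, s)` is the initial end of the dart `d` together with one of the two sides of `d`
there: `s = 1` is the side towards the next dart `rot d`, and `s = -1` the side towards the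
previous dart.  Two flags are in the same face boundary if they are linked by moves of two kinds:
across the corner between `d` and `rot d`, and along a side of an edge from one end to the other
(where the two local orientations see the same side with opposite signs if the edge is untwisted,
and with equal signs if it is twisted). -/
inductive FlagStep (P : EmbeddingScheme G) : G.Dart × ℤˣ → G.Dart × ℤˣ → Prop
  | corner (d : G.Dart) : FlagStep P (d, 1) (P.rot d, -1)
  | side (d : G.Dart) (s : ℤˣ) : FlagStep P (d, s) (d.symm, -(P.sign d * s))

/-- The faces that are incident with an edge: the boundary circles of the ribbon neighbourhood that
meet a band, that is, the facial walks without a chosen starting point or direction. -/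
def Face (P : EmbeddingScheme G) : Type _ := Quot P.FlagStep

/-- The number of faces.  The disc around an isolated vertex has one boundary circle too. -/
noncomputable def numFaces (P : EmbeddingScheme G) : ℕ :=
  Nat.card P.Face + Nat.card {v : V // ∀ w : V, ¬ G.Adj v w}

/-- The Euler genus of the closed surface obtained from the ribbon neighbourhood of a finite graph
by pasting a disc to every face boundary, `2 - (#V - #E + #F)` if the graph is connected
(and the sum of the Euler genera of the components of the surface in general). -/
noncomputable def eulerGenus (P : EmbeddingScheme G) : ℤ :=
  2 * (Nat.card G.ConnectedComponent : ℤ)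
    - ((Nat.card V : ℤ) - (Nat.card G.edgeSet : ℤ) + (P.numFaces : ℤ))

/-- The surface is orientable: the local orientations can be reversed at some of the
vertices (`f v = -1`) in such a way that no edge is twisted any more. -/
def Orientable (P : EmbeddingScheme G) : Prop :=
  ∃ f : V → ℤˣ, ∀ d : G.Dart, P.sign d = f d.fst * f d.snd

end EmbeddingScheme

/-- The finite graph `G` can be embedded in the nonorientable surface `N_k`, the sphere with `k ≥ 1`
crosscaps.  The embedding need not be cellular: the surface consists of a ribbon neighbourhood of
`G` with discs pasted to its face boundaries and with `h` further crosscaps attached inside the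
faces.  It has Euler genus `P.eulerGenus + h`, and it is nonorientable if and only if the scheme is
nonorientable or `h > 0`.  The 2-cell embeddings of a connected graph are those with `h = 0`. -/
def EmbedsInNonorientable {V : Type*} (G : SimpleGraph V) (k : ℕ) : Prop :=
  ∃ (P : EmbeddingScheme G) (h : ℕ),
    P.eulerGenus + (h : ℤ) = (k : ℤ) ∧ (¬ P.Orientable ∨ 0 < h)

/-- The nonorientable genus of a finite graph: the smallest `k > 0` such that `G` can be embedded
in `N_k`. -/
noncomputable def nonorientableGenus {V : Type*} (G : SimpleGraph V) : ℕ :=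
  sInf {k : ℕ | 0 < k ∧ EmbedsInNonorientable G k}

/-- `G_{m,n,k}`: the complete bipartite graph `K_{m,n}` with parts `a_0, …, a_{m-1}` and
`b_0, …, b_{n-1}`, from which the `k` independent edges `a_i b_i`, `i < k`, are removed
(for `k ≤ min m n`). -/
def bipartiteMinusMatching (m n k : ℕ) : SimpleGraph (Fin m ⊕ Fin n) :=
  (completeBipartiteGraph (Fin m) (Fin n)).deleteEdges
    {e | ∃ (i : Fin m) (j : Fin n), (i : ℕ) = (j : ℕ) ∧ (i : ℕ) < k ∧ e = s(Sum.inl i, Sum.inr j)}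

end GraphEmb

/-!
The bipartite graph `bipartiteMinusMatching m n k` has `m + n` vertices and `m * n - k` edges, and
all its vertices have degree at least two.  Hence the faces of an embedding have length at least
four (`EmbeddingScheme.four_mul_card_face_le`), and Euler's formula bounds the Euler genus from
below by half of `(m - 2) * (n - 2) - k` (`eulerGenus_eq`).  It remains to find embeddings in which
all faces are quadrilaterals if the number of edges is even, and all but one hexagon if it is odd.
They have to be nonorientable, unless they are planar, when a crosscap is attached.

Embeddings are constructed as bipartite maps (`BipartiteMap`): sets of flags with three involutions.
Alternating colourings of the flags at the vertices turn a bipartite map into an embedding scheme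
(`exists_scheme`), and the faces of a map are counted by the flags at which the two corner
reflections commute (`card_le_of_quad_off`).  Three operations change the graph of a map:

* A vertex of degree `L` or `L + 1`, where `L ≥ 3` is odd, is split in two copies that are joined to
  the neighbours of the old one, with one or two edges missing (`exists_split`).  The corners at the old
  vertex are distributed alternately to the two copies, most of the edges are doubled, and the slits
  between the two copies of a doubled edge are paired and continued as quadrilaterals.
* An edge is deleted, so that two quadrilaterals merge into a hexagon (`exists_deleteEdge`).
* An edge is added that crosses another edge in a crosscap (`exists_addCrossing`).

There are two sources of quadrangulations.  A cyclic sequence of matchings on an even number of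
vertices, in which the union of consecutive ones is a Hamiltonian cycle, yields a quadrangulation by
a complete bipartite graph (`BipartiteMap.rows`); after a suitable set of its vertices is split, the
missing edges form a matching (`hasQuad_of_rows`, `hasQuad_of_even`).  This covers the case that the
smaller part is even.  If it is odd, then vertices of the larger part that are adjacent to all of
the smaller one are split one after the other, starting from a complete bipartite graph.  This fails
only if `m = n = k`; then a cyclic order of the nonzero residues modulo `n` in which the terms next
to every second term `y` add up to `2 * y` yields a quadrangulation that is invariant under
translations (`BipartiteMap.cyclic`, `hasQuad_all_odd`).  The quadrangulations are collected in
`exists_hasQuad`, and the case of an odd number of edges is reduced to them in `exists_hasNearQuad`.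
The graph for `m = n = k = 3`, a hexagon, is the only one treated separately
(`nonorientableGenus_three`).
-/

namespace GraphEmb

/-! ### Bipartite maps -/

/-- A bipartite map: the flags of a graph with parts `α` and `β` that is embedded in a closed
surface.  A flag is one side of one end of an edge, where the two flags that lie along the same side
of an edge are identified, so that every edge has exactly two flags.  The three fixed-point-free
involutions are the reflection `t` across the edge, and the reflections `cA` and `cB` across the
corner at the end in `α` and at the end in `β`.  Faces are the orbits of `cA` and `cB`. -/
structure BipartiteMap (X α β : Type) where
  /-- reflection across an edge -/
  t : X → X
  /-- reflection across a corner at a vertex in `α` -/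
  cA : X → X
  /-- reflection across a corner at a vertex in `β` -/
  cB : X → X
  /-- the end in `α` -/
  a : X → α
  /-- the end in `β` -/
  b : X → β
  t_t : ∀ x, t (t x) = x
  cA_cA : ∀ x, cA (cA x) = x
  cB_cB : ∀ x, cB (cB x) = x
  t_ne : ∀ x, t x ≠ x
  cA_ne : ∀ x, cA x ≠ x
  cB_ne : ∀ x, cB x ≠ x
  a_t : ∀ x, a (t x) = a x
  a_cA : ∀ x, a (cA x) = a x
  b_t : ∀ x, b (t x) = b x
  b_cB : ∀ x, b (cB x) = b x
  /-- there are no multiple edges -/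
  edge : ∀ x y, a x = a y → b x = b y → y = x ∨ y = t x
  /-- the corners at a vertex in `α` form a single cycle -/
  connA : ∀ x y, a x = a y → Relation.EqvGen (fun u v => v = t u ∨ v = cA u) x y
  /-- the corners at a vertex in `β` form a single cycle -/
  connB : ∀ x y, b x = b y → Relation.EqvGen (fun u v => v = t u ∨ v = cB u) x y

/-- The orbits of a group generated by two fixed-point-free involutions can be coloured alternately:
the rotations in this dihedral group never map `x` to `p x`, since a conjugate of `p` or of `q`
would then have a fixed point. -/
theorem exists_alternating {X : Type} (p q : X → X) (hp : ∀ x, p (p x) = x)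
    (hq : ∀ x, q (q x) = x) (p_ne : ∀ x, p x ≠ x) (q_ne : ∀ x, q x ≠ x) :
    ∃ o : X → ℤˣ, (∀ x, o (p x) = -o x) ∧ ∀ x, o (q x) = -o x := by
  classical
  set P : Equiv.Perm X := Function.Involutive.toPerm p hp with hP
  set Q : Equiv.Perm X := Function.Involutive.toPerm q hq with hQ
  have Pa : ∀ x, P x = p x := fun x => rfl
  have Qa : ∀ x, Q x = q x := fun x => rfl
  have PP : P * P = 1 := by ext x; simp [Pa, hp]
  have QQ : Q * Q = 1 := by ext x; simp [Qa, hq]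
  have Pi : P⁻¹ = P := inv_eq_of_mul_eq_one_left PP
  have Qi : Q⁻¹ = Q := inv_eq_of_mul_eq_one_left QQ
  set R : Equiv.Perm X := P * Q with hR
  have hPR : ∀ k : ℤ, P * R ^ k = R ^ (-k) * P := by
    intro k
    have h1 : P * R * P⁻¹ = R⁻¹ := by
      rw [hR, mul_inv_rev, Pi, Qi, ← mul_assoc, PP, one_mul]
    have h2 := conj_zpow (i := k) (a := P) (b := R)
    rw [h1, inv_zpow', Pi] at h2
    rw [h2, mul_assoc, PP, mul_one]
  have key : ∀ x, ∀ k : ℤ, P x ≠ (R ^ k) x := by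
    intro x k h
    rcases Int.even_or_odd' k with ⟨l, rfl | rfl⟩
    · apply p_ne ((R ^ l) x)
      have h1 := congrArg (fun f : Equiv.Perm X => f x) (hPR l)
      simp only [Equiv.Perm.mul_apply] at h1
      rw [← Pa, h1, h, ← Equiv.Perm.mul_apply, ← zpow_add]
      congr 2; ring
    · apply q_ne ((R ^ l) x)
      have h1 := congrArg (fun f : Equiv.Perm X => f x) (hPR (l + 1))
      have h2 : Q = P * R := by rw [hR, ← mul_assoc, PP, one_mul]
      simp only [Equiv.Perm.mul_apply] at h1
      rw [← Qa, h2, Equiv.Perm.mul_apply, ← Equiv.Perm.mul_apply R, ← zpow_one_add, add_comm 1 l,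
        h1, h, ← Equiv.Perm.mul_apply, ← zpow_add]
      congr 2; ring
  let S : Setoid X := Relation.EqvGen.setoid (fun u v => v = p u ∨ v = q u)
  let rep : X → X := fun x => (Quotient.mk S x).out
  have rep_eq : ∀ x y, S x y → rep x = rep y := by
    intro x y h
    simp only [rep]
    rw [Quotient.sound h]
  have rep_rel : ∀ x, S (rep x) x := fun x => Quotient.exact (Quotient.out_eq (Quotient.mk S x))
  have hQx : ∀ x, q x = R⁻¹ (p x) := by
    intro x
    rw [hR, mul_inv_rev, Pi, Qi, Equiv.Perm.mul_apply, Pa, Qa, hp]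
  have hPQx : ∀ x, p (q x) = R x := fun x => rfl
  have sameCycle_inv_right : ∀ z x, R.SameCycle z (R⁻¹ x) ↔ R.SameCycle z x := fun z x => by
    rw [← Equiv.Perm.sameCycle_inv, Equiv.Perm.sameCycle_apply_right, Equiv.Perm.sameCycle_inv]
  -- the orbit of `x0` is the union of the cycles of `x0` and `p x0` under the rotation `R = p ∘ q`
  have step : ∀ x0 u v, S u v → ((R.SameCycle x0 u ∨ R.SameCycle x0 (p u)) ↔
      (R.SameCycle x0 v ∨ R.SameCycle x0 (p v))) := by
    intro x0 u v h
    induction h with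
    | rel u v h =>
      rcases h with rfl | rfl
      · rw [hp]; exact or_comm
      · rw [hPQx, hQx, Equiv.Perm.sameCycle_apply_right, sameCycle_inv_right]
        exact or_comm
    | refl => exact Iff.rfl
    | symm _ _ _ ih => exact ih.symm
    | trans _ _ _ _ _ ih1 ih2 => exact ih1.trans ih2
  have total : ∀ x, R.SameCycle (rep x) x ∨ R.SameCycle (rep x) (p x) := fun x =>
    (step (rep x) (rep x) x (rep_rel x)).1 (Or.inl (Equiv.Perm.SameCycle.refl _ _))
  have excl : ∀ x z, R.SameCycle z x → ¬ R.SameCycle z (p x) := by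
    intro x z h h'
    obtain ⟨k, hk⟩ := h.symm.trans h'
    exact key x k hk.symm
  have hneg : ∀ x, (if R.SameCycle (rep x) (p x) then (1 : ℤˣ) else -1) =
      -(if R.SameCycle (rep x) x then (1 : ℤˣ) else -1) := by
    intro x
    rcases total x with h | h
    · rw [if_pos h, if_neg (excl x _ h)]
    · have : ¬ R.SameCycle (rep x) x := fun h' => excl x _ h' h
      rw [if_pos h, if_neg this, neg_neg]
  refine ⟨fun x => if R.SameCycle (rep x) x then 1 else -1, fun x => ?_, fun x => ?_⟩
  · have h : rep (p x) = rep x := (rep_eq x (p x) (Relation.EqvGen.rel _ _ (Or.inl rfl))).symm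
    simp only [h]
    exact hneg x
  · have h : rep (q x) = rep x := (rep_eq x (q x) (Relation.EqvGen.rel _ _ (Or.inr rfl))).symm
    simp only [h]
    rw [hQx, sameCycle_inv_right]
    exact hneg x

namespace BipartiteMap

variable {X α β : Type}

/-- The same map with the two parts of the graph interchanged. -/
def swap (M : BipartiteMap X α β) : BipartiteMap X β α where
  t := M.t
  cA := M.cB
  cB := M.cA
  a := M.b
  b := M.a
  t_t := M.t_t
  cA_cA := M.cB_cB
  cB_cB := M.cA_cA
  t_ne := M.t_ne
  cA_ne := M.cB_ne
  cB_ne := M.cA_ne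
  a_t := M.b_t
  a_cA := M.b_cB
  b_t := M.a_t
  b_cB := M.a_cA
  edge := fun x y h h' => M.edge x y h' h
  connA := M.connB
  connB := M.connA

/-- The surface of the map is orientable: the flags can be coloured such that every reflection
changes the colour. -/
def Orientable (M : BipartiteMap X α β) : Prop :=
  ∃ o : X → ℤˣ, ∀ x, o (M.t x) = -o x ∧ o (M.cA x) = -o x ∧ o (M.cB x) = -o x

/-- All faces are quadrilaterals. -/
def IsQuad (M : BipartiteMap X α β) : Prop := ∀ x, M.cA (M.cB x) = M.cB (M.cA x)

theorem swap_orientable {M : BipartiteMap X α β} (h : M.swap.Orientable) : M.Orientable := by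
  obtain ⟨o, ho⟩ := h
  exact ⟨o, fun x => ⟨(ho x).1, (ho x).2.2, (ho x).2.1⟩⟩

theorem swap_isQuad {M : BipartiteMap X α β} (h : M.IsQuad) : M.swap.IsQuad := fun x => (h x).symm

/-- The graph of the map is the complete bipartite graph without the matching of the edges
`f l`, `g l`. -/
structure OmitsMatching {K : Type} (M : BipartiteMap X α β) (f : K → α) (g : K → β) : Prop where
  injA : Function.Injective f
  injB : Function.Injective g
  adj : ∀ i j, (∃ x, M.a x = i ∧ M.b x = j) ↔ ∀ l, ¬ (f l = i ∧ g l = j)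

theorem OmitsMatching.swap {K : Type} {M : BipartiteMap X α β} {f : K → α} {g : K → β}
    (h : M.OmitsMatching f g) : M.swap.OmitsMatching g f where
  injA := h.injB
  injB := h.injA
  adj := fun i j => by
    have := h.adj j i
    simp only [BipartiteMap.swap]
    simp only [and_comm] at this ⊢
    exact this

/-- Coordinates on the flags at a vertex `v` of `α`: `ψ p true` and `ψ p false` are the two flags of
the edge number `p < D` in the rotation at `v`, on the side of the next and of the previous edge. -/
structure Coords (M : BipartiteMap X α β) (v : α) (D : ℕ) where
  /-- the flag with given coordinates -/
  ψ : ℕ → Bool → X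
  /-- the number of the edge of a flag -/
  pos : X → ℕ
  /-- the side on which a flag lies -/
  dir : X → Bool
  a_ψ : ∀ p d, M.a (ψ p d) = v
  pos_ψ : ∀ p d, p < D → pos (ψ p d) = p
  dir_ψ : ∀ p d, p < D → dir (ψ p d) = d
  pos_lt : ∀ x, M.a x = v → pos x < D
  ψ_pos : ∀ x, M.a x = v → ψ (pos x) (dir x) = x
  t_ψ : ∀ p d, M.t (ψ p d) = ψ p (!d)
  cA_ψ : ∀ p, p < D → M.cA (ψ p true) = ψ (if p + 1 = D then 0 else p + 1) false

/-- Every vertex has coordinates that start with a given flag. -/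
theorem exists_coords [Finite X] (M : BipartiteMap X α β) (x₀ : X) :
    ∃ D : ℕ, 0 < D ∧ ∃ C : M.Coords (M.a x₀) D, C.ψ 0 true = x₀ := by
  classical
  -- the rotation is the periodic map `t ∘ cA`; an alternating colouring tells the two sides apart
  obtain ⟨o, ho, ho'⟩ := exists_alternating M.t M.cA M.t_t M.cA_cA M.t_ne M.cA_ne
  set r : X → X := fun x => M.t (M.cA x) with hr
  have r_inj : Function.Injective r := by
    intro x y h
    have := congrArg (fun z => M.cA (M.t z)) h
    simpa [hr, M.t_t, M.cA_cA] using this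
  have hper : x₀ ∈ Function.periodicPts r := r_inj.mem_periodicPts x₀
  set D := Function.minimalPeriod r x₀ with hD
  have D_pos : 0 < D := Function.minimalPeriod_pos_of_mem_periodicPts hper
  have hrD : r^[D] x₀ = x₀ := Function.iterate_minimalPeriod
  set ψ : ℕ → Bool → X := fun p d => if d then r^[p] x₀ else M.t (r^[p] x₀) with hψ
  have ψt : ∀ p, ψ p true = r^[p] x₀ := fun p => by simp [hψ]
  have ψf : ∀ p, ψ p false = M.t (r^[p] x₀) := fun p => by simp [hψ]
  have or : ∀ p, o (r^[p] x₀) = o x₀ := by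
    intro p
    induction p with
    | zero => rfl
    | succ p ih => rw [Function.iterate_succ_apply', hr, ho, ho', neg_neg]; exact ih
  have ar : ∀ p, M.a (r^[p] x₀) = M.a x₀ := by
    intro p
    induction p with
    | zero => rfl
    | succ p ih => rw [Function.iterate_succ_apply', hr, M.a_t, M.a_cA]; exact ih
  have a_ψ : ∀ p d, M.a (ψ p d) = M.a x₀ := by
    intro p d
    cases d
    · rw [ψf, M.a_t, ar]
    · rw [ψt, ar]
  have t_ψ : ∀ p d, M.t (ψ p d) = ψ p (!d) := by
    intro p d
    cases d
    · rw [ψf, M.t_t]; exact (ψt p).symm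
    · rw [ψt]; exact (ψf p).symm
  have cA_ψ' : ∀ p, M.cA (ψ p true) = ψ (p + 1) false := by
    intro p
    rw [ψt, ψf, Function.iterate_succ_apply', hr, M.t_t]
  have ψ0 : ∀ d, ψ D d = ψ 0 d := by intro d; simp [hψ, hrD]
  have ψmod : ∀ p d, ψ (p % D) d = ψ p d := by
    intro p d
    have : r^[p % D] x₀ = r^[p] x₀ := Function.iterate_mod_minimalPeriod_eq
    simp [hψ, this]
  have inj : ∀ p d p' d', p < D → p' < D → ψ p d = ψ p' d' → p = p' ∧ d = d' := by
    intro p d p' d' hp hp' h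
    have hd : d = d' := by
      have h1 := congrArg o h
      have hne : ∀ u : ℤˣ, -u ≠ u := neg_units_ne_self
      cases d <;> cases d' <;> simp only [ψf, ψt, ho, or] at h1 <;> first | rfl | skip
      · exact absurd h1 (hne _)
      · exact absurd h1.symm (hne _)
    subst hd
    refine ⟨?_, rfl⟩
    have h2 : r^[p] x₀ = r^[p'] x₀ := by
      cases d
      · simp only [ψf] at h
        have := congrArg M.t h
        simpa [M.t_t] using this
      · simpa only [ψt] using h
    exact (Function.iterate_eq_iterate_iff_of_lt_minimalPeriod hp hp').1 h2
  have surj : ∀ x, M.a x = M.a x₀ → ∃ p d, p < D ∧ ψ p d = x := by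
    have aux : ∀ u v, Relation.EqvGen (fun u v => v = M.t u ∨ v = M.cA u) u v →
        ((∃ p d, ψ p d = u) ↔ ∃ p d, ψ p d = v) := by
      have one : ∀ u, (∃ p d, ψ p d = u) → ∃ p d, ψ p d = M.cA u := by
        rintro u ⟨p, d, rfl⟩
        cases d
        · refine ⟨p + (D - 1), true, ?_⟩
          have h1 : M.cA (ψ (p + (D - 1)) true) = ψ p false := by
            rw [cA_ψ', ← ψmod, ← ψmod p, show p + (D - 1) + 1 = p + D by omega, Nat.add_mod_right]
          rw [← h1, M.cA_cA]
        · exact ⟨p + 1, false, (cA_ψ' p).symm⟩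
      intro u v h
      induction h with
      | rel u v h =>
        rcases h with rfl | rfl
        · constructor
          · rintro ⟨p, d, rfl⟩; exact ⟨p, !d, (t_ψ p d).symm⟩
          · rintro ⟨p, d, h⟩; exact ⟨p, !d, by rw [← t_ψ, h, M.t_t]⟩
        · exact ⟨one u, fun h => by simpa [M.cA_cA] using one _ h⟩
      | refl => exact Iff.rfl
      | symm _ _ _ ih => exact ih.symm
      | trans _ _ _ _ _ ih1 ih2 => exact ih1.trans ih2
    intro x hx
    obtain ⟨p, d, h⟩ := (aux x₀ x (M.connA x₀ x hx.symm)).1 ⟨0, true, rfl⟩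
    exact ⟨p % D, d, Nat.mod_lt _ D_pos, by rw [ψmod, h]⟩
  choose! pos dir hlt hpos using surj
  refine ⟨D, D_pos, ⟨ψ, pos, dir, a_ψ, ?_, ?_, hlt, hpos, t_ψ, ?_⟩, rfl⟩
  · intro p d hp
    exact (inj _ _ _ _ (hlt _ (a_ψ p d)) hp (hpos _ (a_ψ p d))).1
  · intro p d hp
    exact (inj _ _ _ _ (hlt _ (a_ψ p d)) hp (hpos _ (a_ψ p d))).2
  · intro p _
    rw [cA_ψ']
    split_ifs with h
    · rw [h, ψ0]
    · rfl

/-- A vertex that is adjacent to all of `β` has the degree `Nat.card β`. -/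
theorem Coords.eq_card [Finite β] {M : BipartiteMap X α β} {v : α} {D : ℕ} (C : M.Coords v D)
    (hv : ∀ j, ∃ x, M.a x = v ∧ M.b x = j) : D = Nat.card β := by
  have h : Function.Bijective (fun p : Fin D => M.b (C.ψ p true)) := by
    constructor
    · intro p q h
      have h1 := M.edge (C.ψ p true) (C.ψ q true) (by rw [C.a_ψ, C.a_ψ]) h
      rw [C.t_ψ] at h1
      have : C.pos (C.ψ q true) = p := by
        rcases h1 with h1 | h1 <;> rw [h1, C.pos_ψ _ _ p.2]
      rw [C.pos_ψ _ _ q.2] at this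
      exact Fin.ext this.symm
    · intro j
      obtain ⟨x, hx, rfl⟩ := hv j
      refine ⟨⟨C.pos x, C.pos_lt x hx⟩, ?_⟩
      have h1 := C.ψ_pos x hx
      change M.b (C.ψ (C.pos x) true) = M.b x
      cases h2 : C.dir x
      · rw [h2] at h1
        have := C.t_ψ (C.pos x) true
        rw [← M.b_t, this]
        exact congrArg M.b h1
      · rw [h2] at h1
        rw [h1]
  rw [← Nat.card_eq_of_bijective _ h, Nat.card_fin]

end BipartiteMap

/-! ### The embedding scheme of a bipartite map -/

namespace BipartiteMap

variable {X α β : Type} {G : SimpleGraph (α ⊕ β)}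

/-- `G` is the graph of the map `M`. -/
structure IsGraph (M : BipartiteMap X α β) (G : SimpleGraph (α ⊕ β)) : Prop where
  adj : ∀ i j, G.Adj (Sum.inl i) (Sum.inr j) ↔ ∃ x, M.a x = i ∧ M.b x = j
  not_adj_inl : ∀ i j, ¬ G.Adj (Sum.inl i) (Sum.inl j)
  not_adj_inr : ∀ i j, ¬ G.Adj (Sum.inr i) (Sum.inr j)

/-- The corner reflection at the end in `α` (`true`) or in `β` (`false`). -/
def corner (M : BipartiteMap X α β) : Bool → X → X
  | true => M.cA
  | false => M.cB

/-- The dart along the edge of a flag that starts in `α` (`true`) or in `β` (`false`). -/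
def dart {M : BipartiteMap X α β} (hG : M.IsGraph G) : Bool → X → G.Dart
  | true, x => ⟨(Sum.inl (M.a x), Sum.inr (M.b x)), (hG.adj _ _).2 ⟨x, rfl, rfl⟩⟩
  | false, x => ⟨(Sum.inr (M.b x), Sum.inl (M.a x)), ((hG.adj _ _).2 ⟨x, rfl, rfl⟩).symm⟩

theorem corner_corner (M : BipartiteMap X α β) (e : Bool) (x : X) :
    M.corner e (M.corner e x) = x := by
  cases e
  · exact M.cB_cB x
  · exact M.cA_cA x

theorem dart_symm {M : BipartiteMap X α β} (hG : M.IsGraph G) (e : Bool) (x : X) :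
    (dart hG e x).symm = dart hG (!e) x := by
  cases e <;> rfl

theorem dart_t {M : BipartiteMap X α β} (hG : M.IsGraph G) (e : Bool) (x : X) :
    dart hG e (M.t x) = dart hG e x := by
  cases e <;> simp [dart, M.a_t, M.b_t]

theorem dart_corner_fst {M : BipartiteMap X α β} (hG : M.IsGraph G) (e : Bool) (x : X) :
    (dart hG e (M.corner e x)).fst = (dart hG e x).fst := by
  cases e <;> simp [dart, corner, M.a_cA, M.b_cB]

theorem dart_inj {M : BipartiteMap X α β} (hG : M.IsGraph G) {e e' : Bool} {x y : X}
    (h : dart hG e x = dart hG e' y) : e = e' ∧ (y = x ∨ y = M.t x) := by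
  have h1 := congrArg (fun d : G.Dart => d.fst) h
  have h2 := congrArg (fun d : G.Dart => d.snd) h
  cases e <;> cases e' <;> simp [dart] at h1 h2
  · exact ⟨rfl, M.edge x y h2 h1⟩
  · exact ⟨rfl, M.edge x y h1 h2⟩

theorem exists_dart {M : BipartiteMap X α β} (hG : M.IsGraph G) (d : G.Dart) :
    ∃ e x, dart hG e x = d := by
  obtain ⟨⟨u, v⟩, h⟩ := d
  rcases u with i | j <;> rcases v with i' | j'
  · exact absurd h (hG.not_adj_inl i i')
  · obtain ⟨x, rfl, rfl⟩ := (hG.adj i j').1 h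
    exact ⟨true, x, rfl⟩
  · obtain ⟨x, rfl, rfl⟩ := (hG.adj i' j).1 (G.adj_symm h)
    exact ⟨false, x, rfl⟩
  · exact absurd h (hG.not_adj_inr j j')

/-- The number of faces of a map. -/
noncomputable def numFaces (M : BipartiteMap X α β) : ℕ :=
  Nat.card (Quot fun x y => y = M.cA x ∨ y = M.cB x)

/-- A bipartite map yields an embedding scheme with at least as many faces, which is orientable only
if the map is. The local orientations at the vertices are given by alternating colourings of the
flags, and an edge is twisted if these agree on its flags. -/
theorem exists_scheme [Finite X] (M : BipartiteMap X α β) (hG : M.IsGraph G) [Finite G.Dart] :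
    ∃ P : EmbeddingScheme G, M.numFaces ≤ Nat.card P.Face ∧ (P.Orientable → M.Orientable) := by
  classical
  have horient : ∃ o : Bool → X → ℤˣ, ∀ e x, o e (M.t x) = -o e x ∧
      o e (M.corner e x) = -o e x := by
    obtain ⟨o1, h1, h1'⟩ := exists_alternating M.t M.cA M.t_t M.cA_cA M.t_ne M.cA_ne
    obtain ⟨o2, h2, h2'⟩ := exists_alternating M.t M.cB M.t_t M.cB_cB M.t_ne M.cB_ne
    refine ⟨fun e => if e then o1 else o2, fun e x => ?_⟩
    cases e
    · exact ⟨h2 x, h2' x⟩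
    · exact ⟨h1 x, h1' x⟩
  obtain ⟨o, ho⟩ := horient
  have ho_t : ∀ e x, o e (M.t x) = -o e x := fun e x => (ho e x).1
  have ho_c : ∀ e x, o e (M.corner e x) = -o e x := fun e x => (ho e x).2
  have hne : ∀ u : ℤˣ, -u ≠ u := neg_units_ne_self
  have hcases : ∀ u v : ℤˣ, u = v ∨ u = -v := by
    intro u v
    rcases Int.units_eq_one_or u with rfl | rfl <;> rcases Int.units_eq_one_or v with rfl | rfl <;>
      simp
  -- the flag of the map that corresponds to a flag of the scheme
  have hex : ∀ (d : G.Dart) (s : ℤˣ), ∃ ex : Bool × X, dart hG ex.1 ex.2 = d ∧ o ex.1 ex.2 = s := by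
    intro d s
    obtain ⟨e, x, rfl⟩ := exists_dart hG d
    rcases hcases (o e x) s with h | h
    · exact ⟨(e, x), rfl, h⟩
    · exact ⟨(e, M.t x), dart_t hG e x, by rw [ho_t, h, neg_neg]⟩
  choose fl hfl1 hfl2 using hex
  have fl_eq : ∀ e x, fl (dart hG e x) (o e x) = (e, x) := by
    intro e x
    have h1 := hfl1 (dart hG e x) (o e x)
    have h2 := hfl2 (dart hG e x) (o e x)
    generalize fl (dart hG e x) (o e x) = ey at h1 h2
    obtain ⟨e', y⟩ := ey
    obtain ⟨rfl, h | h⟩ := dart_inj hG h1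
    · simp only at h; rw [h]
    · exfalso
      simp only at h h2
      rw [h, ho_t] at h2
      exact hne _ h2.symm
  have fl_eq' : ∀ e x s, o e x = s → fl (dart hG e x) s = (e, x) := by
    rintro e x s rfl; exact fl_eq e x
  have hrep : ∀ (d : G.Dart) (s : ℤˣ), ∃ e x, d = dart hG e x ∧ o e x = s := fun d s =>
    ⟨_, _, (hfl1 d s).symm, hfl2 d s⟩
  let turn : ℤˣ → G.Dart → G.Dart := fun s d =>
    dart hG (fl d s).1 (M.corner (fl d s).1 (fl d s).2)
  have turn_dart : ∀ e x s, o e x = s → turn s (dart hG e x) = dart hG e (M.corner e x) := by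
    intro e x s h
    simp only [turn, fl_eq' e x s h]
  have turn_turn : ∀ s d, turn (-s) (turn s d) = d := by
    intro s d
    obtain ⟨e, x, rfl, h⟩ := hrep d s
    rw [turn_dart e x s h, turn_dart e _ (-s) (by rw [ho_c, h]), corner_corner]
  let rot : Equiv.Perm G.Dart :=
    ⟨turn 1, turn (-1), fun d => turn_turn 1 d, fun d => by simpa using turn_turn (-1) d⟩
  have rot_dart : ∀ e x, o e x = 1 → rot (dart hG e x) = dart hG e (M.corner e x) :=
    fun e x h => turn_dart e x 1 h
  let sg : G.Dart → ℤˣ := fun d => -(o true (fl d 1).2 * o false (fl d 1).2)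
  have sg_dart : ∀ e x, sg (dart hG e x) = -(o true x * o false x) := by
    intro e x
    rcases hcases (o e x) 1 with h | h
    · simp only [sg, fl_eq' e x 1 h]
    · have h' : o e (M.t x) = 1 := by rw [ho_t, h, neg_neg]
      have := fl_eq' e (M.t x) 1 h'
      rw [dart_t] at this
      simp only [sg, this, ho_t, neg_mul_neg]
  have same : ∀ e u v, Relation.EqvGen (fun u v => v = M.t u ∨ v = M.corner e u) u v →
      rot.SameCycle (dart hG e u) (dart hG e v) := by
    intro e u v h
    induction h with
    | rel u v h =>
      rcases h with rfl | rfl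
      · rw [dart_t]
      · rcases hcases (o e u) 1 with h | h
        · rw [← rot_dart e u h, Equiv.Perm.sameCycle_apply_right]
        · have := rot_dart e (M.corner e u) (by rw [ho_c, h, neg_neg])
          rw [corner_corner] at this
          rw [← this, Equiv.Perm.sameCycle_apply_left]
    | refl => exact Equiv.Perm.SameCycle.refl _ _
    | symm _ _ _ ih => exact ih.symm
    | trans _ _ _ _ _ ih1 ih2 => exact ih1.trans ih2
  let P : EmbeddingScheme G :=
    { rot := rot
      rot_fst := by
        intro d
        obtain ⟨e, x, rfl, h⟩ := hrep d 1
        rw [rot_dart e x h, dart_corner_fst]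
      rot_cycle := by
        intro d d' h
        obtain ⟨e, x, rfl⟩ := exists_dart hG d
        obtain ⟨e', y, rfl⟩ := exists_dart hG d'
        cases e <;> cases e' <;> simp [dart] at h
        · exact same false x y (M.connB x y h)
        · exact same true x y (M.connA x y h)
      sign := sg
      sign_symm := by
        intro d
        obtain ⟨e, x, rfl⟩ := exists_dart hG d
        rw [dart_symm, sg_dart, sg_dart] }
  have side_eq : ∀ e x s, o e x = s → o (!e) x = -(sg (dart hG e x) * s) := by
    intro e x s h
    rw [sg_dart, ← h]
    cases e
    · simp only [Bool.not_false, neg_mul, neg_neg, mul_assoc, Int.units_mul_self, mul_one]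
    · rw [mul_comm (o true x)]
      simp only [Bool.not_true, neg_mul, neg_neg, mul_assoc, Int.units_mul_self, mul_one]
  refine ⟨P, ?_, ?_⟩
  · have : Finite P.Face := by unfold EmbeddingScheme.Face; infer_instance
    let φ : P.Face → Quot fun x y => y = M.cA x ∨ y = M.cB x :=
      Quot.lift (fun f => Quot.mk _ (fl f.1 f.2).2) (by
        intro f f' h
        rcases h with ⟨d⟩ | ⟨d, s⟩
        · obtain ⟨e, x, rfl, h⟩ := hrep d 1
          have h2 : P.rot (dart hG e x) = dart hG e (M.corner e x) := rot_dart e x h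
          simp only [h2, fl_eq' e x 1 h, fl_eq' e (M.corner e x) (-1) (by rw [ho_c, h])]
          apply Quot.sound
          cases e
          · exact Or.inr rfl
          · exact Or.inl rfl
        · obtain ⟨e, x, rfl, h⟩ := hrep d s
          have h2 := side_eq e x s h
          have h3 : P.sign = sg := rfl
          simp only [h3, dart_symm, fl_eq' e x s h, fl_eq' (!e) x _ h2])
    refine Nat.card_le_card_of_surjective φ ?_
    intro q
    obtain ⟨x, rfl⟩ := Quot.exists_rep q
    exact ⟨Quot.mk _ (dart hG true x, o true x), by simp only [φ, fl_eq]⟩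
  · rintro ⟨f, hf⟩
    refine ⟨fun x => o true x * f (Sum.inl (M.a x)), fun x => ⟨?_, ?_, ?_⟩⟩
    · simp only [ho_t, M.a_t, neg_mul]
    · have := ho_c true x
      simp only [corner] at this
      simp only [this, M.a_cA, neg_mul]
    · have key : ∀ y, o true y * f (Sum.inl (M.a y)) = -(o false y * f (Sum.inr (M.b y))) := by
        intro y
        have h1 : sg (dart hG true y) = f (Sum.inl (M.a y)) * f (Sum.inr (M.b y)) :=
          hf (dart hG true y)
        rw [sg_dart] at h1
        generalize o true y = p at *
        generalize o false y = q at *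
        generalize f (Sum.inl (M.a y)) = r at *
        generalize f (Sum.inr (M.b y)) = w at *
        revert p q r w
        decide
      have h2 := ho_c false x
      simp only [corner] at h2
      simp only [key, h2, M.b_cB, neg_mul, neg_neg]

/-- If all faces are quadrilaterals, with the possible exception of one hexagon, then there are as
many faces as the number of edges allows.  The exceptional flags are given as a set `H` of at most
six flags, of which only those matter at which the two corner reflections do not commute. -/
theorem card_le_of_quad_off [Finite X] (M : BipartiteMap X α β) (H : Finset X) (hH : H.card ≤ 6)
    (hq : ∀ x, x ∉ H → M.cA (M.cB x) = M.cB (M.cA x)) : Nat.card X ≤ 4 * M.numFaces + 2 := by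
  classical
  have := Fintype.ofFinite X
  set r : X → X → Prop := fun x y => y = M.cA x ∨ y = M.cB x with hr
  have : Finite (Quot r) := inferInstance
  have := Fintype.ofFinite (Quot r)
  -- the face of a flag at which the corner reflections commute has at most four flags
  have hcl : ∀ x, M.cA (M.cB x) = M.cB (M.cA x) → ∀ y, Quot.mk r y = Quot.mk r x →
      y ∈ ({x, M.cA x, M.cB x, M.cA (M.cB x)} : Finset X) := by
    intro x hx y hy
    have h1 := Quot.eqvGen_exact hy
    have aux : ∀ u v, Relation.EqvGen r u v →
        (u ∈ ({x, M.cA x, M.cB x, M.cA (M.cB x)} : Finset X) ↔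
          v ∈ ({x, M.cA x, M.cB x, M.cA (M.cB x)} : Finset X)) := by
      have one : ∀ u ∈ ({x, M.cA x, M.cB x, M.cA (M.cB x)} : Finset X),
          M.cA u ∈ ({x, M.cA x, M.cB x, M.cA (M.cB x)} : Finset X) ∧
          M.cB u ∈ ({x, M.cA x, M.cB x, M.cA (M.cB x)} : Finset X) := by
        intro u hu
        simp only [Finset.mem_insert, Finset.mem_singleton] at hu ⊢
        rcases hu with rfl | rfl | rfl | rfl
        · simp
        · simp [M.cA_cA, hx]
        · simp [M.cB_cB]
        · have h3 := congrArg M.cB hx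
          rw [M.cB_cB] at h3
          simp [M.cA_cA, h3]
      intro u v h
      induction h with
      | rel u v h =>
        rcases h with rfl | rfl
        · exact ⟨fun h => (one _ h).1, fun h => by simpa only [M.cA_cA] using (one _ h).1⟩
        · exact ⟨fun h => (one _ h).2, fun h => by simpa only [M.cB_cB] using (one _ h).2⟩
      | refl => exact Iff.rfl
      | symm _ _ _ ih => exact ih.symm
      | trans _ _ _ _ _ ih1 ih2 => exact ih1.trans ih2
    exact (aux y x h1).2 (by simp)
  set fib : Quot r → Finset X := fun q => Finset.univ.filter fun x => Quot.mk r x = q with hfib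
  have hsum : Fintype.card X = ∑ q : Quot r, (fib q).card := by
    rw [← Finset.card_univ]
    exact Finset.card_eq_sum_card_fiberwise (fun x _ => Finset.mem_coe.2 (Finset.mem_univ _))
  -- a face with more than four flags lies in `H`, and `H` has no room for two of them
  have hbig : ∀ q, 4 < (fib q).card → fib q ⊆ H := by
    intro q hcard x hx
    by_contra hxH
    have hxq : Quot.mk r x = q := (Finset.mem_filter.1 hx).2
    have hsub : fib q ⊆ ({x, M.cA x, M.cB x, M.cA (M.cB x)} : Finset X) := fun y hy =>
      hcl x (hq x hxH) y ((Finset.mem_filter.1 hy).2.trans hxq.symm)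
    have := (Finset.card_le_card hsub).trans Finset.card_le_four
    omega
  have hF : M.numFaces = Fintype.card (Quot r) := Nat.card_eq_fintype_card
  rw [Nat.card_eq_fintype_card, hF, hsum]
  by_cases h : ∃ q, 4 < (fib q).card
  · obtain ⟨q₀, h₀⟩ := h
    have hsmall : ∀ q ∈ Finset.univ.erase q₀, (fib q).card ≤ 4 := by
      intro q hq'
      by_contra hc
      have hdisj : Disjoint (fib q) (fib q₀) := by
        rw [Finset.disjoint_left]
        intro x hx hx'
        exact (Finset.mem_erase.1 hq').1
          ((Finset.mem_filter.1 hx).2.symm.trans (Finset.mem_filter.1 hx').2)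
      have h1 := Finset.card_le_card (Finset.union_subset (hbig q (by omega)) (hbig q₀ h₀))
      rw [Finset.card_union_of_disjoint hdisj] at h1
      omega
    rw [← Finset.sum_erase_add _ _ (Finset.mem_univ q₀)]
    have h1 := Finset.sum_le_card_nsmul _ _ 4 hsmall
    have h2 := Finset.card_le_card (hbig q₀ h₀)
    rw [Finset.card_erase_of_mem (Finset.mem_univ q₀), Finset.card_univ, smul_eq_mul] at h1
    have h3 : 0 < Fintype.card (Quot r) := Fintype.card_pos_iff.2 ⟨q₀⟩
    omega
  · push Not at h
    have h1 := Finset.sum_le_card_nsmul Finset.univ (fun q => (fib q).card) 4 (fun q _ => h q)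
    rw [Finset.card_univ, smul_eq_mul] at h1
    omega

end BipartiteMap

/-! ### Splitting vertices -/

namespace BipartiteMap

variable {X α β α' : Type}

/-- Vertices `a x` of `α` are split in two, one for each value of `σ`.  The corners at the old
vertex are distributed according to `σ`, the edges whose flags are in `dbl` are doubled, and the new
face between the two copies of a doubled edge is continued by the matching `μ`.  A flag `x` of a
doubled edge becomes two flags, `inl x` in the old face and `inr x` in a new one. -/
noncomputable def split (M : BipartiteMap X α β) (dbl : X → Prop) (σ : X → Bool)
    (μ : {x // dbl x} → {x // dbl x}) (a' : X → α')
    (dbl_t : ∀ x, dbl x → dbl (M.t x))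
    (σ_cA : ∀ x, σ (M.cA x) = σ x) (σ_t : ∀ x, dbl x → σ (M.t x) = !σ x)
    (σ_t' : ∀ x, ¬ dbl x → σ (M.t x) = σ x)
    (μ_μ : ∀ x, μ (μ x) = x) (μ_ne : ∀ x, μ x ≠ x) (a_μ : ∀ x, M.a (μ x).1 = M.a x.1)
    (σ_μ : ∀ x, σ (μ x).1 = σ x.1)
    (ha' : ∀ x y, a' x = a' y ↔ M.a x = M.a y ∧ σ x = σ y)
    (conn : ∀ t' cA' : X ⊕ {x // dbl x} → X ⊕ {x // dbl x},
      (∀ x h, t' (Sum.inl x) = Sum.inr ⟨x, h⟩) → (∀ x, ¬ dbl x → t' (Sum.inl x) = Sum.inl (M.t x)) →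
      (∀ x, cA' (Sum.inl x) = Sum.inl (M.cA x)) → (∀ x, cA' (Sum.inr x) = Sum.inr (μ x)) →
      ∀ x y, M.a x = M.a y → σ x = σ y →
        Relation.EqvGen (fun u v => v = t' u ∨ v = cA' u) (Sum.inl x) (Sum.inl y)) :
    BipartiteMap (X ⊕ {x // dbl x}) α' β := by
  classical
  exact
  { t := fun z => match z with
      | Sum.inl x => if h : dbl x then Sum.inr ⟨x, h⟩ else Sum.inl (M.t x)
      | Sum.inr x => Sum.inl x.1
    cA := fun z => match z with
      | Sum.inl x => Sum.inl (M.cA x)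
      | Sum.inr x => Sum.inr (μ x)
    cB := fun z => match z with
      | Sum.inl x => Sum.inl (M.cB x)
      | Sum.inr x => Sum.inr ⟨M.t x.1, dbl_t _ x.2⟩
    a := fun z => match z with
      | Sum.inl x => a' x
      | Sum.inr x => a' x.1
    b := fun z => match z with
      | Sum.inl x => M.b x
      | Sum.inr x => M.b x.1
    t_t := by
      rintro (x | ⟨x, hx⟩)
      · by_cases h : dbl x
        · simp [h]
        · have : ¬ dbl (M.t x) := fun h' => h (by simpa [M.t_t] using dbl_t _ h')
          simp [h, this, M.t_t]
      · simp [hx]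
    cA_cA := by
      rintro (x | x)
      · simp [M.cA_cA]
      · simp [μ_μ]
    cB_cB := by
      rintro (x | x)
      · simp [M.cB_cB]
      · simp [M.t_t]
    t_ne := by
      rintro (x | ⟨x, hx⟩)
      · by_cases h : dbl x
        · simp [h]
        · simp [h, M.t_ne]
      · simp
    cA_ne := by
      rintro (x | x)
      · simp [M.cA_ne]
      · simp [μ_ne]
    cB_ne := by
      rintro (x | ⟨x, hx⟩)
      · simp [M.cB_ne]
      · simp [M.t_ne]
    a_t := by
      rintro (x | ⟨x, hx⟩)
      · by_cases h : dbl x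
        · simp [h]
        · simp only [h, dite_false]
          exact (ha' _ _).2 ⟨M.a_t x, σ_t' x h⟩
      · rfl
    a_cA := by
      rintro (x | x)
      · exact (ha' _ _).2 ⟨M.a_cA x, σ_cA x⟩
      · exact (ha' _ _).2 ⟨a_μ x, σ_μ x⟩
    b_t := by
      rintro (x | ⟨x, hx⟩)
      · by_cases h : dbl x
        · simp [h]
        · simp [h, M.b_t]
      · rfl
    b_cB := by
      rintro (x | x)
      · exact M.b_cB x
      · exact M.b_t x.1
    edge := by
      have aux : ∀ x y, a' x = a' y → M.b x = M.b y → y = x ∨ (¬ dbl x ∧ y = M.t x) := by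
        intro x y h1 h2
        obtain ⟨h3, h4⟩ := (ha' _ _).1 h1
        rcases M.edge x y h3 h2 with h | h
        · exact Or.inl h
        · by_cases hd : dbl x
          · rw [h, σ_t x hd] at h4
            cases hs : σ x <;> simp [hs] at h4
          · exact Or.inr ⟨hd, h⟩
      rintro (x | ⟨x, hx⟩) (y | ⟨y, hy⟩) h1 h2
      · rcases aux x y h1 h2 with h | ⟨hd, h⟩
        · exact Or.inl (by rw [h])
        · exact Or.inr (by simp [hd, h])
      · rcases aux x y h1 h2 with h | ⟨hd, h⟩
        · subst h; exact Or.inr (by simp [hy])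
        · exact absurd (by simpa [h, M.t_t] using dbl_t _ hy) hd
      · rcases aux x y h1 h2 with h | ⟨hd, h⟩
        · subst h; exact Or.inr rfl
        · exact absurd hx hd
      · rcases aux x y h1 h2 with h | ⟨hd, h⟩
        · subst h; exact Or.inl rfl
        · exact absurd hx hd
    connA := by
      have aux := conn (fun z => match z with
        | Sum.inl x => if h : dbl x then Sum.inr ⟨x, h⟩ else Sum.inl (M.t x)
        | Sum.inr x => Sum.inl x.1) (fun z => match z with
        | Sum.inl x => Sum.inl (M.cA x)
        | Sum.inr x => Sum.inr (μ x)) (fun x h => by simp [h]) (fun x h => by simp [h])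
        (fun x => rfl) (fun x => rfl)
      rintro (x | x) (y | y) h
      · have h := (ha' _ _).1 h
        exact aux x y h.1 h.2
      · have h := (ha' _ _).1 h
        exact (aux x y.1 h.1 h.2).trans _ _ _ (.symm _ _ (.rel _ _ (Or.inl rfl)))
      · have h := (ha' _ _).1 h
        exact .trans _ _ _ (.rel _ _ (Or.inl rfl)) (aux x.1 y h.1 h.2)
      · have h := (ha' _ _).1 h
        exact .trans _ _ _ (.rel _ _ (Or.inl rfl)) ((aux x.1 y.1 h.1 h.2).trans _ _ _
          (.symm _ _ (.rel _ _ (Or.inl rfl))))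
    connB := by
      set r := (fun u v : X ⊕ {x // dbl x} => (v = match u with
        | Sum.inl x => if h : dbl x then Sum.inr ⟨x, h⟩ else Sum.inl (M.t x)
        | Sum.inr x => Sum.inl x.1) ∨ v = match u with
        | Sum.inl x => Sum.inl (M.cB x)
        | Sum.inr x => Sum.inr ⟨M.t x.1, dbl_t _ x.2⟩) with hr
      have aux : ∀ x y, Relation.EqvGen (fun u v => v = M.t u ∨ v = M.cB u) x y →
          Relation.EqvGen r (Sum.inl x) (Sum.inl y) := by
        intro x y h
        induction h with
        | rel u v h =>
          rcases h with rfl | rfl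
          · by_cases h : dbl u
            · have h1 : r (Sum.inl u) (Sum.inr ⟨u, h⟩) := Or.inl (by simp [h])
              have h2 : r (Sum.inr ⟨u, h⟩) (Sum.inr ⟨M.t u, dbl_t _ h⟩) := Or.inr rfl
              have h3 : r (Sum.inr ⟨M.t u, dbl_t _ h⟩) (Sum.inl (M.t u)) := Or.inl rfl
              exact ((Relation.EqvGen.rel _ _ h1).trans _ _ _ (.rel _ _ h2)).trans _ _ _
                (.rel _ _ h3)
            · exact .rel _ _ (Or.inl (by simp [h]))
          · exact .rel _ _ (Or.inr rfl)
        | refl => exact .refl _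
        | symm _ _ _ ih => exact ih.symm
        | trans _ _ _ _ _ ih1 ih2 => exact ih1.trans _ _ _ ih2
      rintro (x | x) (y | y) h
      · exact aux x y (M.connB _ _ h)
      · exact (aux x y.1 (M.connB _ _ h)).trans _ _ _ (.symm _ _ (.rel _ _ (Or.inl rfl)))
      · exact .trans _ _ _ (.rel _ _ (Or.inl rfl)) (aux x.1 y (M.connB _ _ h))
      · exact .trans _ _ _ (.rel _ _ (Or.inl rfl)) ((aux x.1 y.1 (M.connB _ _ h)).trans _ _ _
          (.symm _ _ (.rel _ _ (Or.inl rfl)))) }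

/-! The rotation of a vertex that is split is numbered such that the edges number `1` and `L` (which
need not exist) are not doubled.  The corners `c`, between the edges `c` and `c + 1`, alternate
between the two copies of the vertex, except at these two edges. -/

/-- The copy of the vertex that receives corner number `c`. -/
def cornerSide (L c : ℕ) : Bool := decide (c = 0) || (decide (c % 2 = 1) && decide (c < L))

/-- The copy of the vertex that receives the flag with coordinates `p`, `d`. -/
def flagSide (L D p : ℕ) (d : Bool) : Bool :=
  cornerSide L (if d then p else if p = 0 then D - 1 else p - 1)

/-- The partner of edge number `p` in the matching of the doubled edges.  Its union with either of
the matchings that are formed by the corners of one copy of the vertex is a single cycle. -/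
def partner (L p : ℕ) : ℕ :=
  if p + 3 = L then p + 2 else if p + 1 = L then p - 2 else if p % 2 = 0 then p + 3 else p - 3

/-- The side on which the flag of a doubled edge lies that goes to the first copy. -/
def firstDir (p : ℕ) : Bool := decide (p = 0) || decide (p % 2 = 1)

theorem flagSide_eq {L D p : ℕ} {d : Bool} (hL : Odd L) (h3 : 3 ≤ L) (hD : D = L ∨ D = L + 1)
    (hp : p < D) (h1 : p ≠ 1) (h2 : p ≠ L) : flagSide L D p d = (d == firstDir p) := by
  obtain ⟨l, rfl⟩ := hL
  have key : ∀ c, cornerSide (2 * l + 1) c = true ↔ c = 0 ∨ (c % 2 = 1 ∧ c < 2 * l + 1) := by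
    intro c; simp [cornerSide]
  have key' : firstDir p = true ↔ p = 0 ∨ p % 2 = 1 := by simp [firstDir]
  rw [Bool.eq_iff_iff]
  simp only [flagSide, key, beq_iff_eq]
  cases d
  · have h4 : (false = firstDir p) ↔ ¬ (p = 0 ∨ p % 2 = 1) := by
      rw [← key']; cases firstDir p <;> simp
    have h5 : ∀ c, c = (if p = 0 then D - 1 else p - 1) → (p = 0 ∧ c = D - 1) ∨
        (p ≠ 0 ∧ c + 1 = p) := by
      intro c hc; split_ifs at hc <;> omega
    rw [h4]
    simp only [Bool.false_eq_true, ↓reduceIte]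
    generalize (if p = 0 then D - 1 else p - 1) = c at h5 ⊢
    have := h5 c rfl
    omega
  · rw [show (true = firstDir p) ↔ p = 0 ∨ p % 2 = 1 from eq_comm.trans key']
    simp only [↓reduceIte]
    omega

theorem flagSide_single {L D p : ℕ} {d : Bool} (hL : Odd L) (h3 : 3 ≤ L)
    (hD : D = L ∨ D = L + 1) (h : p = 1 ∨ p = L) : flagSide L D p d = decide (p = 1) := by
  obtain ⟨l, rfl⟩ := hL
  have key : ∀ c, cornerSide (2 * l + 1) c = true ↔ c = 0 ∨ (c % 2 = 1 ∧ c < 2 * l + 1) := by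
    intro c; simp [cornerSide]
  rw [Bool.eq_iff_iff]
  simp only [flagSide, key, decide_eq_true_eq]
  cases d
  · have h5 : ∀ c, c = (if p = 0 then D - 1 else p - 1) → c + 1 = p := by
      intro c hc; split_ifs at hc <;> omega
    simp only [Bool.false_eq_true, ↓reduceIte]
    generalize (if p = 0 then D - 1 else p - 1) = c at h5 ⊢
    have := h5 c rfl
    omega
  · simp only [↓reduceIte]
    omega

theorem partner_spec {L p : ℕ} (hL : Odd L) (h3 : 3 ≤ L) (hp : p < L) (h1 : p ≠ 1) :
    partner L p < L ∧ partner L p ≠ 1 ∧ partner L p ≠ p ∧ partner L (partner L p) = p := by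
  obtain ⟨l, rfl⟩ := hL
  unfold partner
  split_ifs <;> omega

/-- The corners of the first copy and the matching of the doubled edges connect all the edges at the
first copy. -/
theorem linked_first {L : ℕ} (hL : Odd L) (R : ℕ → ℕ → Prop) (hR : Equivalence R)
    (hc : ∀ c, (c = 0 ∨ (c % 2 = 1 ∧ c < L)) → R c (c + 1))
    (hm : ∀ p, p < L → p ≠ 1 → R p (partner L p)) : ∀ p, p < L → R 0 p := by
  obtain ⟨l, rfl⟩ := hL
  intro p
  induction p using Nat.strong_induction_on with
  | _ p ih =>
    intro hp
    by_cases h0 : p = 0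
    · subst h0; exact hR.refl 0
    by_cases h1 : p = 1
    · subst h1; exact hc 0 (Or.inl rfl)
    rcases Nat.mod_two_eq_zero_or_one p with h | h
    · have := hc (p - 1) (Or.inr (by omega))
      rw [Nat.sub_add_cancel (by omega)] at this
      exact hR.trans (ih (p - 1) (by omega) (by omega)) this
    · have := hm p hp h1
      have h2 : partner (2 * l + 1) p = p - 3 := by unfold partner; split_ifs <;> omega
      rw [h2] at this
      exact hR.trans (ih (p - 3) (by omega) (by omega)) (hR.symm this)

/-- The corners of the second copy and the matching of the doubled edges connect all the edges with
number less than `L` at the second copy.  Its last corner joins edge `L - 1` to edge `0`, possibly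
by way of edge `L`. -/
theorem linked_second {L : ℕ} (hL : Odd L) (h3 : 3 ≤ L) (R : ℕ → ℕ → Prop) (hR : Equivalence R)
    (hc : ∀ c, c % 2 = 0 → c ≠ 0 → c + 1 < L → R c (c + 1)) (hc' : R (L - 1) 0)
    (hm : ∀ p, p < L → p ≠ 1 → R p (partner L p)) : ∀ p, p < L → p ≠ 1 → R 0 p := by
  obtain ⟨l, rfl⟩ := hL
  have even : ∀ q, q < l → R 0 (2 * l - 2 * q) := by
    intro q
    induction q with
    | zero => intro _; exact hR.symm hc'
    | succ q ih =>
      intro hq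
      have h1 := ih (by omega)
      rcases q with _ | q
      · have := hm (2 * l - 2) (by omega) (by omega)
        have h2 : partner (2 * l + 1) (2 * l - 2) = 2 * l := by
          unfold partner; split_ifs <;> omega
        rw [h2] at this
        exact hR.trans h1 (hR.symm this)
      · have h4 := hm (2 * l - 2 * (q + 1 + 1)) (by omega) (by omega)
        have h2 : partner (2 * l + 1) (2 * l - 2 * (q + 1 + 1)) = 2 * l - 2 * (q + 1) + 1 := by
          unfold partner; split_ifs <;> omega
        rw [h2] at h4
        have h5 := hc (2 * l - 2 * (q + 1)) (by omega) (by omega) (by omega)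
        exact hR.trans h1 (hR.trans h5 (hR.symm h4))
  intro p hp h1
  by_cases h0 : p = 0
  · subst h0; exact hR.refl 0
  rcases Nat.mod_two_eq_zero_or_one p with h | h
  · have := even (l - p / 2) (by omega)
    rwa [show 2 * l - 2 * (l - p / 2) = p by omega] at this
  · have := even (l - (p - 1) / 2) (by omega)
    rw [show 2 * l - 2 * (l - (p - 1) / 2) = p - 1 by omega] at this
    have h2 := hc (p - 1) (by omega) (by omega) (by omega)
    rw [Nat.sub_add_cancel (by omega)] at h2
    exact hR.trans this h2

/-- Vertices `v` of `α` whose rotations are numbered by coordinates are split in two copies.  The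
copy `inl v` is adjacent to all neighbours of `v` except number `1`, and the copy `inr v` to all
except number `L` (if there is one).  All new faces are quadrilaterals.  The splitting creates a
nonorientable surface if `L` is at least `5`: the partner of edge `L - 3` is then an edge of the
same parity, so that the matching reverses the local orientation.  The last clause finds an edge at
the new copies near which the missing edge from `inl v` to neighbour number `1` can be added, see
`exists_addCrossing`. -/
theorem exists_split [Finite X] (M : BipartiteMap X α β) {L D : ℕ} (hL : Odd L) (h3 : 3 ≤ L)
    (hD : D = L ∨ D = L + 1) (J : α → Prop) (C : ∀ v, J v → M.Coords v D) :
    ∃ (Y : Type) (_ : Finite Y) (M' : BipartiteMap Y (α ⊕ {v // J v}) β),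
      (M.IsQuad → M'.IsQuad) ∧ (M'.Orientable → M.Orientable) ∧
      (5 ≤ L → (∃ v, J v) → ¬ M'.Orientable) ∧
      (∀ v j, (∃ y, M'.a y = Sum.inl v ∧ M'.b y = j) ↔
        ∃ x, M.a x = v ∧ M.b x = j ∧ ∀ h : J v, (C v h).pos x ≠ 1) ∧
      (∀ v j, (∃ y, M'.a y = Sum.inr v ∧ M'.b y = j) ↔
        ∃ x, M.a x = v ∧ M.b x = j ∧ (C v.1 v.2).pos x ≠ L) ∧
      ∀ v (h : J v), ∃ u, M'.a (M'.cB u) = Sum.inl v ∧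
        M'.b (M'.cA (M'.t u)) = M.b ((C v h).ψ 1 true) := by
  classical
  let pos : X → ℕ := fun x => if h : J (M.a x) then (C _ h).pos x else 0
  let dir : X → Bool := fun x => if h : J (M.a x) then (C _ h).dir x else true
  have pos_eq : ∀ v (h : J v) x, M.a x = v → pos x = (C v h).pos x := by
    rintro v h x rfl; simp only [pos, h, dite_true]
  have dir_eq : ∀ v (h : J v) x, M.a x = v → dir x = (C v h).dir x := by
    rintro v h x rfl; simp only [dir, h, dite_true]
  have pos_ψ : ∀ v (h : J v) p d, p < D → pos ((C v h).ψ p d) = p := fun v h p d hp => by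
    rw [pos_eq v h _ ((C v h).a_ψ p d), (C v h).pos_ψ p d hp]
  have dir_ψ : ∀ v (h : J v) p d, p < D → dir ((C v h).ψ p d) = d := fun v h p d hp => by
    rw [dir_eq v h _ ((C v h).a_ψ p d), (C v h).dir_ψ p d hp]
  have pos_lt : ∀ x, J (M.a x) → pos x < D := fun x h => by
    rw [pos_eq _ h x rfl]; exact (C _ h).pos_lt x rfl
  have exψ : ∀ v (h : J v) x, M.a x = v → ∃ p d, p < D ∧ (C v h).ψ p d = x := fun v h x hx =>
    ⟨_, _, (C v h).pos_lt x hx, (C v h).ψ_pos x hx⟩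
  have a_ψ : ∀ v (h : J v) p d, M.a ((C v h).ψ p d) = v := fun v h => (C v h).a_ψ
  have t_ψ : ∀ v (h : J v) p d, M.t ((C v h).ψ p d) = (C v h).ψ p (!d) := fun v h => (C v h).t_ψ
  have cA_ψ : ∀ v (h : J v) p, p < D →
    M.cA ((C v h).ψ p true) = (C v h).ψ (if p + 1 = D then 0 else p + 1) false :=
    fun v h => (C v h).cA_ψ
  have cA_ψ' : ∀ v (h : J v) p, p < D →
      M.cA ((C v h).ψ p false) = (C v h).ψ (if p = 0 then D - 1 else p - 1) true := by
    intro v h p hp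
    have h1 := cA_ψ v h (if p = 0 then D - 1 else p - 1) (by split_ifs <;> omega)
    have h2 : (if (if p = 0 then D - 1 else p - 1) + 1 = D then 0 else
        (if p = 0 then D - 1 else p - 1) + 1) = p := by split_ifs <;> omega
    rw [h2] at h1
    rw [← h1, M.cA_cA]
  -- the doubled edges, and the copy of the vertex that receives a flag
  let dbl : X → Prop := fun x => J (M.a x) ∧ pos x ≠ 1 ∧ pos x ≠ L
  let σ : X → Bool := fun x => decide (J (M.a x)) && flagSide L D (pos x) (dir x)
  have σ_ψ : ∀ v (h : J v) p d, p < D → σ ((C v h).ψ p d) = flagSide L D p d := by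
    intro v h p d hp
    simp only [σ, pos_ψ v h p d hp, dir_ψ v h p d hp, a_ψ, h, decide_true, Bool.true_and]
  have σ_not : ∀ x, ¬ J (M.a x) → σ x = false := fun x h => by simp [σ, h]
  have dbl_ψ : ∀ v (h : J v) p d, p < D → (dbl ((C v h).ψ p d) ↔ p ≠ 1 ∧ p ≠ L) := by
    intro v h p d hp
    simp only [dbl, pos_ψ v h p d hp, a_ψ, h, true_and]
  have lt_L : ∀ p, p < D → p ≠ L → p < L := by intro p hp h; omega
  -- the matching on flags, and its values in coordinates
  have hμ : ∀ x : {x // dbl x}, ∃ y : {x // dbl x}, ∀ v (h : J v) p d, p < D →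
      x.1 = (C v h).ψ p d → y.1 = (C v h).ψ (partner L p)
        (if d = firstDir p then firstDir (partner L p) else !firstDir (partner L p)) := by
    rintro ⟨x, hx⟩
    have hp := pos_lt x hx.1
    obtain ⟨h1, h2, -, -⟩ := partner_spec hL h3 (lt_L _ hp hx.2.2) hx.2.1
    refine ⟨⟨(C _ hx.1).ψ (partner L (pos x)) (if dir x = firstDir (pos x) then
      firstDir (partner L (pos x)) else !firstDir (partner L (pos x))), ?_⟩, ?_⟩
    · rw [dbl_ψ _ _ _ _ (by omega)]
      omega
    · intro v h p d hp e
      change x = _ at e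
      have hpos : pos x = p := by rw [e, pos_ψ v h p d hp]
      have hdir : dir x = d := by rw [e, dir_ψ v h p d hp]
      have hv : M.a x = v := by rw [e, a_ψ]
      subst hv
      simp only [hpos, hdir]
  choose μ hμ using hμ
  have coords_dbl : ∀ x : {x // dbl x}, ∃ v, ∃ h : J v, ∃ p d, p < D ∧ p < L ∧ p ≠ 1 ∧ p ≠ L ∧
      x.1 = (C v h).ψ p d := by
    rintro ⟨x, hx⟩
    obtain ⟨p, d, hp, h⟩ := exψ _ hx.1 x rfl
    refine ⟨_, hx.1, p, d, hp, ?_⟩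
    have h2 := hx
    rw [← h, dbl_ψ _ _ _ _ hp] at h2
    exact ⟨lt_L p hp h2.2, h2.1, h2.2, h.symm⟩
  let a' : X → α ⊕ {v // J v} := fun x =>
    if h : J (M.a x) ∧ σ x = true then Sum.inr ⟨M.a x, h.1⟩ else Sum.inl (M.a x)
  have a'_true : ∀ x (h : J (M.a x)), σ x = true → a' x = Sum.inr ⟨M.a x, h⟩ := fun x h h' => by
    simp only [a', h, h', and_self, dite_true]
  have a'_false : ∀ x, σ x = false → a' x = Sum.inl (M.a x) := fun x h => by
    simp [a', h]
  have J_of : ∀ x, σ x = true → J (M.a x) := fun x h => by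
    by_contra h'; rw [σ_not x h'] at h; cases h
  have ha' : ∀ x y, a' x = a' y ↔ M.a x = M.a y ∧ σ x = σ y := by
    intro x y
    cases hx : σ x <;> cases hy : σ y
    · simp [a'_false x hx, a'_false y hy]
    · simp [a'_false x hx, a'_true y (J_of y hy) hy]
    · simp [a'_true x (J_of x hx) hx, a'_false y hy]
    · simp [a'_true x (J_of x hx) hx, a'_true y (J_of y hy) hy]
  have conn : ∀ t' cA' : X ⊕ {x // dbl x} → X ⊕ {x // dbl x},
      (∀ x h, t' (Sum.inl x) = Sum.inr ⟨x, h⟩) → (∀ x, ¬ dbl x → t' (Sum.inl x) = Sum.inl (M.t x)) →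
      (∀ x, cA' (Sum.inl x) = Sum.inl (M.cA x)) → (∀ x, cA' (Sum.inr x) = Sum.inr (μ x)) →
      ∀ x y, M.a x = M.a y → σ x = σ y →
        Relation.EqvGen (fun u v => v = t' u ∨ v = cA' u) (Sum.inl x) (Sum.inl y) := by
    intro t' cA' h1 h2 h4 h5 x y hxy hσ
    set r := (fun u v => v = t' u ∨ v = cA' u) with hr
    by_cases hJ : J (M.a x)
    · generalize hv : M.a x = v at hJ
      rw [hv] at hxy
      let ψ := (C v hJ).ψ
      have link_cA : ∀ p, p + 1 < D →
          Relation.EqvGen r (Sum.inl (ψ p true)) (Sum.inl (ψ (p + 1) false)) := by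
        intro p hp
        have := cA_ψ v hJ p (by omega)
        rw [if_neg (by omega)] at this
        exact .rel _ _ (Or.inr (by rw [h4, this]))
      have link_last : Relation.EqvGen r (Sum.inl (ψ (D - 1) true)) (Sum.inl (ψ 0 false)) := by
        have := cA_ψ v hJ (D - 1) (by omega)
        rw [if_pos (by omega)] at this
        exact .rel _ _ (Or.inr (by rw [h4, this]))
      have link_single : ∀ p, p < D → p = 1 ∨ p = L → ∀ d,
          Relation.EqvGen r (Sum.inl (ψ p d)) (Sum.inl (ψ p true)) := by
        intro p hp hp' d
        cases d
        · refine .rel _ _ (Or.inl ?_)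
          rw [h2 _ (by rw [dbl_ψ _ _ _ _ hp]; omega), t_ψ]; rfl
        · exact .refl _
      have link_μ : ∀ p, p < L → p ≠ 1 → ∀ d, Relation.EqvGen r (Sum.inl (ψ p d))
          (Sum.inl (ψ (partner L p) (if d = firstDir p then firstDir (partner L p)
            else !firstDir (partner L p)))) := by
        intro p hp hp' d
        have hd : dbl (ψ p d) := (dbl_ψ v hJ p d (by omega)).2 ⟨hp', by omega⟩
        have e1 : r (Sum.inl (ψ p d)) (Sum.inr ⟨_, hd⟩) := Or.inl (h1 _ hd).symm
        have e2 : r (Sum.inr ⟨_, hd⟩) (Sum.inr (μ ⟨_, hd⟩)) := Or.inr (h5 _).symm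
        have e3 : r (Sum.inl (μ ⟨_, hd⟩).1) (Sum.inr (μ ⟨_, hd⟩)) := Or.inl (h1 _ _).symm
        rw [hμ ⟨_, hd⟩ v hJ p d (by omega) rfl] at e3
        exact ((Relation.EqvGen.rel _ _ e1).trans _ _ _ (.rel _ _ e2)).trans _ _ _
          (.symm _ _ (.rel _ _ e3))
      suffices H : ∀ x, M.a x = v → Relation.EqvGen r (Sum.inl (ψ 0 (σ x))) (Sum.inl x) by
        have e1 := H x hv
        rw [hσ] at e1
        exact (e1.symm).trans _ _ _ (H y hxy.symm)
      intro z hz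
      obtain ⟨p, d, hp, rfl⟩ := exψ v hJ z hz
      rw [σ_ψ _ _ _ _ hp]
      have hf1 : firstDir 1 = true := rfl
      have hf0 : firstDir 0 = true := rfl
      have hfo : ∀ c, c % 2 = 1 → firstDir c = true := fun c h => by simp [firstDir, h]
      have hfe : ∀ c, c % 2 = 0 → c ≠ 0 → firstDir c = false := fun c h h' => by
        simp [firstDir, h, h']
      have lf := linked_first hL
        (fun p q => Relation.EqvGen r (Sum.inl (ψ p (firstDir p))) (Sum.inl (ψ q (firstDir q))))
        ⟨fun _ => .refl _, fun h => h.symm, fun h h' => h.trans _ _ _ h'⟩ (by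
          rintro c (rfl | ⟨hc, hc'⟩)
          · exact (link_cA 0 (by omega)).trans _ _ _ (link_single 1 (by omega) (Or.inl rfl) false)
          · obtain ⟨l, rfl⟩ := hL
            have := link_cA c (by omega)
            rwa [hfo c hc, hfe (c + 1) (by omega) (by omega)]) (by
          intro p hp hp'
          have := link_μ p hp hp' (firstDir p)
          rwa [if_pos rfl] at this)
      have ls := linked_second hL h3
        (fun p q => Relation.EqvGen r (Sum.inl (ψ p (!firstDir p))) (Sum.inl (ψ q (!firstDir q))))
        ⟨fun _ => .refl _, fun h => h.symm, fun h h' => h.trans _ _ _ h'⟩ (by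
          intro c hc hc' hc''
          have := link_cA c (by omega)
          rw [hfe c hc hc', hfo (c + 1) (by omega)]
          exact this) (by
          obtain ⟨l, rfl⟩ := hL
          simp only [hf0, hfe (2 * l + 1 - 1) (by omega) (by omega), Bool.not_true, Bool.not_false]
          rcases hD with rfl | rfl
          · exact link_last
          · refine .trans _ _ _ (link_cA _ (by omega)) ?_
            rw [show 2 * l + 1 - 1 + 1 = 2 * l + 1 by omega]
            refine .trans _ _ _ (link_single _ (by omega) (Or.inr rfl) false) ?_
            exact link_last) (by
          intro p hp hp'
          have := link_μ p hp hp' (!firstDir p)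
          rwa [if_neg (by simp)] at this)
      by_cases hs : p = 1 ∨ p = L
      · rw [flagSide_single hL h3 hD hs]
        rcases hs with rfl | rfl
        · have := lf 1 (by omega)
          exact this.trans _ _ _ (.symm _ _ (link_single 1 hp (Or.inl rfl) d))
        · rw [decide_eq_false (by omega)]
          have e1 := link_single p hp (Or.inr rfl) d
          have hDp : D - 1 = p := by omega
          rw [hDp] at link_last
          exact (link_last.symm).trans _ _ _ e1.symm
      · push Not at hs
        have hd := flagSide_eq (d := d) hL h3 hD hp hs.1 hs.2
        rw [hd]
        by_cases hd' : d = firstDir p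
        · subst hd'
          rw [beq_self_eq_true]
          exact lf p (lt_L p hp hs.2)
        · have : d = !firstDir p := by
            revert hd'; cases d <;> cases firstDir p <;> simp
          subst this
          have := ls p (lt_L p hp hs.2) hs.1
          rw [show ((!firstDir p) == firstDir p) = false by cases firstDir p <;> rfl]
          exact this
    · have aux : ∀ u w, Relation.EqvGen (fun u v => v = M.t u ∨ v = M.cA u) u w →
          M.a u = M.a w ∧ (¬ J (M.a u) → Relation.EqvGen r (Sum.inl u) (Sum.inl w)) := by
        intro u w h
        induction h with
        | rel u w h =>
          rcases h with rfl | rfl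
          · exact ⟨(M.a_t u).symm, fun h => .rel _ _ (Or.inl (h2 u fun h' => h h'.1).symm)⟩
          · exact ⟨(M.a_cA u).symm, fun h => .rel _ _ (Or.inr (h4 u).symm)⟩
        | refl => exact ⟨rfl, fun _ => .refl _⟩
        | symm _ _ _ ih => exact ⟨ih.1.symm, fun h => (ih.2 (by rwa [ih.1])).symm⟩
        | trans _ _ _ _ _ ih1 ih2 =>
          exact ⟨ih1.1.trans ih2.1, fun h => (ih1.2 h).trans _ _ _ (ih2.2 (by rwa [← ih1.1]))⟩
      exact (aux x y (M.connA x y hxy)).2 hJ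
  have σ_t : ∀ x, dbl x → σ (M.t x) = !σ x := by
    intro x hx
    obtain ⟨v, h, p, d, hp, -, h1, h2, e⟩ := coords_dbl ⟨x, hx⟩
    simp only at e
    rw [e, t_ψ, σ_ψ _ _ _ _ hp, σ_ψ _ _ _ _ hp, flagSide_eq hL h3 hD hp h1 h2,
      flagSide_eq hL h3 hD hp h1 h2]
    cases d <;> cases firstDir p <;> rfl
  have dbl_t : ∀ x, dbl x → dbl (M.t x) := by
    intro x hx
    obtain ⟨v, h, p, d, hp, -, h1, h2, e⟩ := coords_dbl ⟨x, hx⟩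
    simp only at e
    rw [e, t_ψ, dbl_ψ _ _ _ _ hp]
    exact ⟨h1, h2⟩
  have μ_coords : ∀ x : {x // dbl x}, ∀ v (h : J v) p d, p < D → p < L → p ≠ 1 →
      x.1 = (C v h).ψ p d → (μ (μ x)).1 = x.1 ∧ μ x ≠ x ∧ M.a (μ x).1 = M.a x.1 ∧
      σ (μ x).1 = σ x.1 ∧ ∀ hx, M.t (μ x).1 = (μ ⟨M.t x.1, hx⟩).1 := by
    intro x v h p d hp hp' h1 e
    obtain ⟨q1, q2, q3, q4⟩ := partner_spec hL h3 hp' h1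
    have e1 := hμ x v h p d hp e
    have e2 := hμ (μ x) v h _ _ (by omega) e1
    refine ⟨?_, ?_, ?_, ?_, ?_⟩
    · rw [e2, e, q4]
      congr 1
      by_cases hd : d = firstDir p
      · simp [hd]
      · simp only [hd, if_false]
        rw [if_neg (by simp)]
        revert hd; cases d <;> cases firstDir p <;> simp
    · intro h5
      have := congrArg (fun y : {x // dbl x} => pos y.1) h5
      simp only [e1, e, pos_ψ v h _ _ hp, pos_ψ v h _ _ (show partner L p < D by omega)] at this
      exact q3 this
    · rw [e1, e, a_ψ, a_ψ]
    · rw [e1, e, σ_ψ _ _ _ _ (show partner L p < D by omega), σ_ψ _ _ _ _ hp,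
        flagSide_eq hL h3 hD (by omega) q2 (by omega), flagSide_eq hL h3 hD hp h1 (by omega)]
      by_cases hd : d = firstDir p
      · simp [hd]
      · rw [if_neg hd]
        revert hd; cases d <;> cases firstDir p <;> cases firstDir (partner L p) <;> simp
    · intro hx
      rw [hμ ⟨M.t x.1, hx⟩ v h p (!d) hp (by simp only [e, t_ψ]), e1, t_ψ]
      congr 1
      revert d; intro d _ _ _
      cases d <;> cases firstDir p <;> cases firstDir (partner L p) <;> rfl
  have μ_all : ∀ x : {x // dbl x}, (μ (μ x)).1 = x.1 ∧ μ x ≠ x ∧ M.a (μ x).1 = M.a x.1 ∧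
      σ (μ x).1 = σ x.1 ∧ ∀ hx, M.t (μ x).1 = (μ ⟨M.t x.1, hx⟩).1 := by
    intro x
    obtain ⟨v, h, p, d, hp, hp', h1, h2, e⟩ := coords_dbl x
    exact μ_coords x v h p d hp hp' h1 e
  have σ_cA : ∀ x, σ (M.cA x) = σ x := by
    intro x
    by_cases hJ : J (M.a x)
    · obtain ⟨p, d, hp, e⟩ := exψ _ hJ x rfl
      rw [← e]
      cases d
      · rw [cA_ψ' _ _ _ hp, σ_ψ _ _ _ _ (by split_ifs <;> omega), σ_ψ _ _ _ _ hp]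
        simp [flagSide]
      · rw [cA_ψ _ _ _ hp, σ_ψ _ _ _ _ (by split_ifs <;> omega), σ_ψ _ _ _ _ hp]
        simp only [flagSide, Bool.false_eq_true, ↓reduceIte]
        congr 1
        by_cases h : p + 1 = D
        · rw [if_pos h, if_pos rfl]; omega
        · rw [if_neg h, if_neg (by omega)]; omega
    · rw [σ_not x hJ, σ_not _ (by rwa [M.a_cA])]
  have σ_t' : ∀ x, ¬ dbl x → σ (M.t x) = σ x := by
    intro x hx
    by_cases hJ : J (M.a x)
    · obtain ⟨p, d, hp, e⟩ := exψ _ hJ x rfl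
      rw [← e, dbl_ψ _ _ _ _ hp] at hx
      rw [← e, t_ψ, σ_ψ _ _ _ _ hp, σ_ψ _ _ _ _ hp, flagSide_single hL h3 hD (by omega),
        flagSide_single hL h3 hD (by omega)]
    · rw [σ_not x hJ, σ_not _ (by rwa [M.a_t])]
  let M' : BipartiteMap (X ⊕ {x // dbl x}) (α ⊕ {v // J v}) β :=
    M.split dbl σ μ a' dbl_t σ_cA σ_t σ_t' (fun x => Subtype.ext (μ_all x).1)
      (fun x => (μ_all x).2.1) (fun x => (μ_all x).2.2.1) (fun x => (μ_all x).2.2.2.1) ha' conn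
  have t_dbl : ∀ x (h : dbl x), M'.t (Sum.inl x) = Sum.inr ⟨x, h⟩ := fun x h => by
    simp [M', split, h]
  have t_not : ∀ x, ¬ dbl x → M'.t (Sum.inl x) = Sum.inl (M.t x) := fun x h => by
    simp [M', split, h]
  have t_inr : ∀ x : {x // dbl x}, M'.t (Sum.inr x) = Sum.inl x.1 := fun x => rfl
  have cA_inl : ∀ x, M'.cA (Sum.inl x) = Sum.inl (M.cA x) := fun x => rfl
  have cA_inr : ∀ x, M'.cA (Sum.inr x) = Sum.inr (μ x) := fun x => rfl
  have cB_inl : ∀ x, M'.cB (Sum.inl x) = Sum.inl (M.cB x) := fun x => rfl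
  have cB_inr : ∀ x : {x // dbl x}, M'.cB (Sum.inr x) = Sum.inr ⟨M.t x.1, dbl_t _ x.2⟩ :=
    fun x => rfl
  have b_inl : ∀ x, M'.b (Sum.inl x) = M.b x := fun x => rfl
  have a_inl : ∀ x, M'.a (Sum.inl x) = a' x := fun x => rfl
  have orient : ∀ o : X ⊕ {x // dbl x} → ℤˣ, (∀ z, o (M'.t z) = -o z ∧ o (M'.cA z) = -o z ∧
      o (M'.cB z) = -o z) → ∀ x, o (Sum.inl (M.t x)) = -o (Sum.inl x) := by
    intro o ho x
    by_cases h : dbl x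
    · have e1 := (ho (Sum.inl x)).1
      have e2 := (ho (Sum.inr ⟨x, h⟩)).2.2
      have e3 := (ho (Sum.inr ⟨M.t x, dbl_t _ h⟩)).1
      rw [t_dbl x h] at e1
      rw [cB_inr] at e2
      rw [t_inr] at e3
      simp only at e2 e3
      rw [e3, e2, e1, neg_neg]
    · have := (ho (Sum.inl x)).1
      rwa [t_not x h] at this
  refine ⟨X ⊕ {x // dbl x}, inferInstance, M', ?_, ?_, ?_, ?_, ?_, ?_⟩
  · rintro hq (x | x)
    · rw [cB_inl, cA_inl, cA_inl, cB_inl, hq x]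
    · rw [cB_inr, cA_inr, cA_inr, cB_inr]
      congr 1
      exact Subtype.ext ((μ_all x).2.2.2.2 _).symm
  · rintro ⟨o, ho⟩
    exact ⟨fun x => o (Sum.inl x), fun x => ⟨orient o ho x, (ho (Sum.inl x)).2.1,
      (ho (Sum.inl x)).2.2⟩⟩
  · rintro h5 ⟨v, hv⟩ ⟨o, ho⟩
    have step : ∀ p, p + 1 < D →
        o (Sum.inl ((C v hv).ψ (p + 1) true)) = o (Sum.inl ((C v hv).ψ p true)) := by
      intro p hp
      have e1 := (ho (Sum.inl ((C v hv).ψ p true))).2.1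
      rw [cA_inl, cA_ψ v hv p (by omega), if_neg (by omega)] at e1
      have e2 := orient o ho ((C v hv).ψ (p + 1) false)
      rw [t_ψ, e1, neg_neg] at e2
      exact e2
    -- the flags `ψ p true` have equal colours, but the matching links two of them with numbers
    -- `L - 3` and `L - 1` by a path of odd length
    have e1 := step (L - 3) (by omega)
    have e2 := step (L - 3 + 1) (by omega)
    rw [e1, show L - 3 + 1 + 1 = L - 1 by omega] at e2
    have hd : dbl ((C v hv).ψ (L - 3) true) :=
      (dbl_ψ v hv (L - 3) true (by omega)).2 ⟨by omega, by omega⟩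
    have e3 := hμ ⟨_, hd⟩ v hv (L - 3) true (by omega) rfl
    have hp : partner L (L - 3) = L - 1 := by
      unfold partner; rw [if_pos (by omega)]; omega
    have hf : ∀ c, c % 2 = 0 → c ≠ 0 → firstDir c = false := fun c h h' => by
      simp [firstDir, h, h']
    obtain ⟨l, hl⟩ := hL
    rw [hp, hf _ (by omega) (by omega), hf _ (by omega) (by omega)] at e3
    simp only [Bool.true_eq_false, ↓reduceIte, Bool.not_false] at e3
    have e4 := (ho (Sum.inl ((C v hv).ψ (L - 3) true))).1
    rw [t_dbl _ hd] at e4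
    have e5 := (ho (Sum.inr ⟨_, hd⟩)).2.1
    rw [cA_inr] at e5
    have e6 := (ho (Sum.inr (μ ⟨_, hd⟩))).1
    rw [t_inr, e3, e5, e4, neg_neg, e2] at e6
    exact neg_units_ne_self _ e6.symm
  · intro v j
    constructor
    · have aux : ∀ x, a' x = Sum.inl v → ∃ y, M.a y = v ∧ M.b y = M.b x ∧
          ∀ h : J v, (C v h).pos y ≠ 1 := by
        intro x h1
        have hσ : σ x = false := by
          by_contra hc
          rw [Bool.not_eq_false] at hc
          rw [a'_true x (J_of x hc) hc] at h1
          cases h1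
        rw [a'_false x hσ] at h1
        have h1 := Sum.inl_injective h1
        refine ⟨x, h1, rfl, fun h h' => ?_⟩
        subst h1
        rw [← pos_eq _ h x rfl] at h'
        have : σ x = true := by
          simp only [σ, h, decide_true, Bool.true_and, h']
          rw [flagSide_single hL h3 hD (Or.inl rfl)]; rfl
        rw [this] at hσ
        cases hσ
      rintro ⟨x | x, h1, h2⟩
      · obtain ⟨y, e1, e2, e3⟩ := aux x h1
        exact ⟨y, e1, e2.trans h2, e3⟩
      · obtain ⟨y, e1, e2, e3⟩ := aux x.1 h1
        exact ⟨y, e1, e2.trans h2, e3⟩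
    · rintro ⟨x, h1, h2, h4⟩
      cases hσ : σ x
      · exact ⟨Sum.inl x, by rw [a_inl, a'_false x hσ, h1], h2⟩
      · have hJ := J_of x hσ
        have hJv : J v := h1 ▸ hJ
        have h5 := h4 hJv
        rw [← pos_eq v hJv x h1] at h5
        have hd : dbl x := by
          refine ⟨hJ, h5, fun h6 => ?_⟩
          simp only [σ, hJ, decide_true, Bool.true_and, h6] at hσ
          rw [flagSide_single hL h3 hD (Or.inr rfl), decide_eq_true_eq] at hσ
          omega
        refine ⟨Sum.inl (M.t x), ?_, ?_⟩
        · rw [a_inl, a'_false _ (by rw [σ_t x hd, hσ]; rfl), M.a_t, h1]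
        · rw [b_inl, M.b_t, h2]
  · rintro ⟨v, hv⟩ j
    constructor
    · have aux : ∀ x, a' x = Sum.inr ⟨v, hv⟩ → ∃ y, M.a y = v ∧ M.b y = M.b x ∧
          (C v hv).pos y ≠ L := by
        intro x h1
        have hσ : σ x = true := by
          by_contra hc
          rw [Bool.not_eq_true] at hc
          rw [a'_false x hc] at h1
          cases h1
        have hJ := J_of x hσ
        rw [a'_true x hJ hσ] at h1
        have h1 : M.a x = v := congrArg Subtype.val (Sum.inr_injective h1)
        refine ⟨x, h1, rfl, fun h' => ?_⟩
        rw [← pos_eq _ hv x h1] at h'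
        simp only [σ, hJ, decide_true, Bool.true_and, h'] at hσ
        rw [flagSide_single hL h3 hD (Or.inr rfl), decide_eq_true_eq] at hσ
        omega
      rintro ⟨x | x, h1, h2⟩
      · obtain ⟨y, e1, e2, e3⟩ := aux x h1
        exact ⟨y, e1, e2.trans h2, e3⟩
      · obtain ⟨y, e1, e2, e3⟩ := aux x.1 h1
        exact ⟨y, e1, e2.trans h2, e3⟩
    · rintro ⟨x, h1, h2, h4⟩
      have hJ : J (M.a x) := by rw [h1]; exact hv
      have a'_eq : ∀ y, M.a y = v → σ y = true → a' y = Sum.inr ⟨v, hv⟩ := by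
        rintro y rfl h6
        exact a'_true y hv h6
      cases hσ : σ x
      · rw [← pos_eq v hv x h1] at h4
        have hd : dbl x := by
          refine ⟨hJ, fun h6 => ?_, h4⟩
          simp only [σ, hJ, decide_true, Bool.true_and, h6] at hσ
          rw [flagSide_single hL h3 hD (Or.inl rfl), decide_eq_true rfl] at hσ
          cases hσ
        refine ⟨Sum.inl (M.t x), ?_, ?_⟩
        · exact a'_eq _ (by rw [M.a_t, h1]) (by rw [σ_t x hd, hσ]; rfl)
        · rw [b_inl, M.b_t, h2]
      · exact ⟨Sum.inl x, a'_eq x h1 hσ, h2⟩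
  · intro v h
    have hd : dbl ((C v h).ψ 0 true) := (dbl_ψ v h 0 true (by omega)).2 ⟨by omega, by omega⟩
    have hf0 : firstDir 0 = true := rfl
    refine ⟨Sum.inr ⟨_, hd⟩, ?_, ?_⟩
    · rw [cB_inr]
      change a' (M.t ((C v h).ψ 0 true)) = _
      rw [t_ψ, a'_false _ (by
        rw [σ_ψ _ _ _ _ (by omega), flagSide_eq hL h3 hD (by omega) (by omega) (by omega)]; rfl),
        a_ψ]
    · rw [t_inr, cA_inl, b_inl]
      simp only
      rw [cA_ψ v h 0 (by omega), if_neg (by omega), ← M.b_t, t_ψ]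
      rfl

end BipartiteMap

/-! ### Adding and deleting edges -/

theorem eqvGen_map {X Y : Type} {r : X → X → Prop} {r' : Y → Y → Prop} (φ : X → Y)
    (h : ∀ u v, r u v → Relation.EqvGen r' (φ u) (φ v)) {x y : X} (hxy : Relation.EqvGen r x y) :
    Relation.EqvGen r' (φ x) (φ y) := by
  induction hxy with
  | rel u v huv => exact h u v huv
  | refl => exact .refl _
  | symm _ _ _ ih => exact ih.symm
  | trans _ _ _ _ _ ih1 ih2 => exact ih1.trans _ _ _ ih2

namespace BipartiteMap

variable {X α β : Type}

open Classical in
/-- The map in which the edge of the flag `u` is twisted: its two flags are exchanged at the end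
in `β`. -/
noncomputable def twist (M : BipartiteMap X α β) (u : X) : BipartiteMap X α β where
  t := M.t
  cA := M.cA
  cB := fun x => Equiv.swap u (M.t u) (M.cB (Equiv.swap u (M.t u) x))
  a := M.a
  b := M.b
  t_t := M.t_t
  cA_cA := M.cA_cA
  cB_cB := fun x => by simp [M.cB_cB]
  t_ne := M.t_ne
  cA_ne := M.cA_ne
  cB_ne := fun x h => M.cB_ne (Equiv.swap u (M.t u) x) (by
    rw [← Equiv.swap_apply_self u (M.t u) (M.cB _), h])
  a_t := M.a_t
  a_cA := M.a_cA
  b_t := M.b_t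
  b_cB := fun x => by
    have h : ∀ y, M.b (Equiv.swap u (M.t u) y) = M.b y := fun y => by
      rw [Equiv.swap_apply_def]; split_ifs with h h
      · rw [h, M.b_t]
      · rw [h, M.b_t]
      · rfl
    rw [h, M.b_cB, h]
  edge := M.edge
  connA := M.connA
  connB := fun x y h => by
    refine eqvGen_map id ?_ (M.connB x y h)
    have hs : ∀ y, Relation.EqvGen (fun w v => v = M.t w ∨
        v = Equiv.swap u (M.t u) (M.cB (Equiv.swap u (M.t u) w))) (Equiv.swap u (M.t u) y) y := by
      intro y
      rw [Equiv.swap_apply_def]; split_ifs with h h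
      · subst h; exact .symm _ _ (.rel _ _ (Or.inl rfl))
      · subst h; exact .rel _ _ (Or.inl rfl)
      · exact .refl _
    rintro w v (rfl | rfl)
    · exact .rel _ _ (Or.inl rfl)
    · refine .trans _ _ _ (hs w).symm ?_
      refine .trans _ _ _ (.rel _ _ (Or.inr rfl)) ?_
      rw [Equiv.swap_apply_self]
      exact hs _

open Classical in
theorem twist_cB {M : BipartiteMap X α β} {u x : X} (h1 : x ≠ u) (h2 : x ≠ M.t u)
    (h3 : M.cB x ≠ u) (h4 : M.cB x ≠ M.t u) : (M.twist u).cB x = M.cB x := by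
  simp only [twist]
  rw [Equiv.swap_apply_of_ne_of_ne h1 h2, Equiv.swap_apply_of_ne_of_ne h3 h4]

open Classical in
/-- The involution `c` with the two new flags inserted in the pair of `p`. -/
noncomputable def insertFlags (c : X → X) (p : X) : X ⊕ Bool → X ⊕ Bool
  | Sum.inl x => if x = p then Sum.inr true else if x = c p then Sum.inr false else Sum.inl (c x)
  | Sum.inr true => Sum.inl p
  | Sum.inr false => Sum.inl (c p)

section insertFlags

variable {c : X → X} {p : X}

theorem insertFlags_left : insertFlags c p (Sum.inl p) = Sum.inr true := by simp [insertFlags]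

theorem insertFlags_right (hn : ∀ x, c x ≠ x) :
    insertFlags c p (Sum.inl (c p)) = Sum.inr false := by simp [insertFlags, hn p]

theorem insertFlags_of_ne {x : X} (h : x ≠ p) (h' : x ≠ c p) :
    insertFlags c p (Sum.inl x) = Sum.inl (c x) := by simp [insertFlags, h, h']

theorem insertFlags_insertFlags (hc : ∀ x, c (c x) = x) (hn : ∀ x, c x ≠ x) (z : X ⊕ Bool) :
    insertFlags c p (insertFlags c p z) = z := by
  rcases z with x | (_ | _)
  · by_cases h : x = p
    · subst h; rw [insertFlags_left]; rfl
    by_cases h' : x = c p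
    · subst h'; rw [insertFlags_right hn]; rfl
    · rw [insertFlags_of_ne h h', insertFlags_of_ne, hc]
      · intro h2; exact h' (by rw [← h2, hc])
      · intro h2; exact h (by rw [← hc x, h2, hc])
  · exact insertFlags_right hn
  · exact insertFlags_left

theorem insertFlags_ne (hn : ∀ x, c x ≠ x) (z : X ⊕ Bool) : insertFlags c p z ≠ z := by
  rcases z with x | (_ | _)
  · by_cases h : x = p
    · subst h; rw [insertFlags_left]; simp
    by_cases h' : x = c p
    · subst h'; rw [insertFlags_right hn]; simp
    · rw [insertFlags_of_ne h h']; simpa using hn x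
  · simp [insertFlags]
  · simp [insertFlags]

theorem elim_insertFlags {γ : Type} {f : X → γ} (hf : ∀ x, f (c x) = f x) (z : X ⊕ Bool) :
    Sum.elim f (fun _ => f p) (insertFlags c p z) = Sum.elim f (fun _ => f p) z := by
  rcases z with x | (_ | _)
  · by_cases h : x = p
    · subst h; rw [insertFlags_left]; rfl
    by_cases h' : x = c p
    · subst h'; simp [insertFlags, h, hf]
    · rw [insertFlags_of_ne h h']; exact hf x
  · exact hf p
  · rfl

theorem eqvGen_insertFlags {γ : Type} {f : X → γ} {t : X → X}
    (hc : ∀ x, c (c x) = x)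
    (conn : ∀ x y, f x = f y → Relation.EqvGen (fun u v => v = t u ∨ v = c u) x y)
    (x y : X ⊕ Bool) (h : Sum.elim f (fun _ => f p) x = Sum.elim f (fun _ => f p) y) :
    Relation.EqvGen (fun u v => v = Sum.map t (fun s => !s) u ∨ v = insertFlags c p u) x y := by
  set r := (fun u v : X ⊕ Bool => v = Sum.map t (fun s => !s) u ∨ v = insertFlags c p u) with hr
  have e1 : Relation.EqvGen r (Sum.inr true) (Sum.inl p) := .rel _ _ (Or.inr rfl)
  have e2 : Relation.EqvGen r (Sum.inr false) (Sum.inr true) := .rel _ _ (Or.inl rfl)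
  have e3 : Relation.EqvGen r (Sum.inr false) (Sum.inl (c p)) := .rel _ _ (Or.inr rfl)
  have main : ∀ x y, f x = f y → Relation.EqvGen r (Sum.inl x) (Sum.inl y) := by
    intro x y h
    refine eqvGen_map Sum.inl ?_ (conn x y h)
    rintro u v (rfl | rfl)
    · exact .rel _ _ (Or.inl rfl)
    · by_cases h1 : u = p
      · subst h1; exact (e1.symm.trans _ _ _ e2.symm).trans _ _ _ e3
      by_cases h2 : u = c p
      · subst h2; rw [hc]; exact (e3.symm.trans _ _ _ e2).trans _ _ _ e1
      · exact .rel _ _ (Or.inr (insertFlags_of_ne h1 h2).symm)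
  have red : ∀ s, Relation.EqvGen r (Sum.inr s) (Sum.inl p) := by
    rintro (_ | _)
    · exact e2.trans _ _ _ e1
    · exact e1
  rcases x with x | s <;> rcases y with y | s'
  · exact main x y h
  · exact (main x p h).trans _ _ _ (red s').symm
  · exact (red s).trans _ _ _ (main p y h)
  · exact (red s).trans _ _ _ (red s').symm

end insertFlags

/-- A new edge is added that leads from the corner of `p` at its end in `α` to the corner of `q` at
its end in `β`. -/
noncomputable def insertEdge (M : BipartiteMap X α β) (p q : X)
    (h : ∀ x, ¬ (M.a x = M.a p ∧ M.b x = M.b q)) : BipartiteMap (X ⊕ Bool) α β where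
  t := Sum.map M.t (fun s => !s)
  cA := insertFlags M.cA p
  cB := insertFlags M.cB q
  a := Sum.elim M.a (fun _ => M.a p)
  b := Sum.elim M.b (fun _ => M.b q)
  t_t := by rintro (x | s) <;> simp [M.t_t]
  cA_cA := insertFlags_insertFlags M.cA_cA M.cA_ne
  cB_cB := insertFlags_insertFlags M.cB_cB M.cB_ne
  t_ne := by rintro (x | s) <;> simp [M.t_ne]
  cA_ne := insertFlags_ne M.cA_ne
  cB_ne := insertFlags_ne M.cB_ne
  a_t := by rintro (x | s) <;> simp [M.a_t]
  a_cA := elim_insertFlags M.a_cA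
  b_t := by rintro (x | s) <;> simp [M.b_t]
  b_cB := elim_insertFlags M.b_cB
  edge := by
    rintro (x | s) (y | s') h1 h2
    · rcases M.edge x y h1 h2 with e | e
      · exact Or.inl (congrArg _ e)
      · exact Or.inr (congrArg _ e)
    · exact absurd ⟨h1, h2⟩ (h x)
    · exact absurd ⟨h1.symm, h2.symm⟩ (h y)
    · cases s <;> cases s' <;> simp
  connA := eqvGen_insertFlags M.cA_cA M.connA
  connB := eqvGen_insertFlags M.cB_cB M.connB

/-- In a quadrangulation the edge of `u` lies between two faces, and the vertex opposite to its end
in `β` in one of them can be joined with the vertex opposite to its end in `α` in the other one by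
an edge that runs through a crosscap on the edge of `u`.  Thereby the two faces become a hexagon and
a quadrilateral. -/
theorem exists_addCrossing (M : BipartiteMap X α β) (hq : M.IsQuad) (u : X)
    (h : ∀ x, ¬ (M.a x = M.a (M.cB u) ∧ M.b x = M.b (M.cA (M.t u)))) :
    ∃ M' : BipartiteMap (X ⊕ Bool) α β, ¬ M'.Orientable ∧
      (∃ H : Finset (X ⊕ Bool), H.card ≤ 6 ∧ ∀ x ∉ H, M'.cA (M'.cB x) = M'.cB (M'.cA x)) ∧
      ∀ i j, (∃ x, M'.a x = i ∧ M'.b x = j) ↔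
        (∃ x, M.a x = i ∧ M.b x = j) ∨ (i = M.a (M.cB u) ∧ j = M.b (M.cA (M.t u))) := by
  classical
  set p := M.cB u with hp
  set q := M.cA (M.t u) with hq'
  have hbp : M.b p = M.b u := M.b_cB u
  have haq : M.a q = M.a u := by rw [hq', M.a_cA, M.a_t]
  have ha : M.a p ≠ M.a u := fun e => h q ⟨by rw [e, haq], rfl⟩
  have hb : M.b q ≠ M.b u := fun e => h p ⟨rfl, by rw [e, hbp]⟩
  have neA : ∀ x, M.a x = M.a p → x ≠ u ∧ x ≠ M.t u := fun x hx =>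
    ⟨fun e => ha (by rw [← hx, e]), fun e => ha (by rw [← hx, e, M.a_t])⟩
  have neB : ∀ x, M.b x = M.b q → x ≠ u ∧ x ≠ M.t u := fun x hx =>
    ⟨fun e => hb (by rw [← hx, e]), fun e => hb (by rw [← hx, e, M.b_t])⟩
  have hM : ∀ x, ¬ ((M.twist u).a x = (M.twist u).a p ∧ (M.twist u).b x = (M.twist u).b q) := h
  have hcut : M.cA u ≠ M.t u := fun e => hb (by rw [hq', ← e, M.cA_cA])
  have hcBt : (M.twist u).cB (M.t u) = p := by
    simp only [twist]
    rw [Equiv.swap_apply_right, Equiv.swap_apply_of_ne_of_ne (neA _ rfl).1 (neA _ rfl).2]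
  have htu_ne : M.cB (M.t u) ≠ u ∧ M.cB (M.t u) ≠ M.t u := by
    refine ⟨fun e => ?_, M.cB_ne _⟩
    have := congrArg M.cB e
    rw [M.cB_cB] at this
    exact (neA p rfl).2 this.symm
  have hcBu : (M.twist u).cB u = M.cB (M.t u) := by
    simp only [twist]
    rw [Equiv.swap_apply_left, Equiv.swap_apply_of_ne_of_ne htu_ne.1 htu_ne.2]
  have hcBq : (M.twist u).cB q = M.cB q :=
    twist_cB (neB _ rfl).1 (neB _ rfl).2 (neB _ (M.b_cB q)).1 (neB _ (M.b_cB q)).2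
  have hpA : M.cA p = M.cB (M.cA u) := hq u
  have hcut' : (M.twist u).cB (M.cA u) = M.cA p := by
    rw [twist_cB (M.cA_ne u) hcut, hpA]
    · rw [← hpA]; exact (neA _ (M.a_cA p)).1
    · rw [← hpA]; exact (neA _ (M.a_cA p)).2
  refine ⟨(M.twist u).insertEdge p q hM, ?_, ?_, ?_⟩
  · rintro ⟨o, ho⟩
    -- the twisted edge of `u` and the former quadrilateral on one of its sides form a Möbius strip
    have f1 : o (Sum.inl q) = o (Sum.inl p) := by
      have e1 := (ho (Sum.inr true)).2.1
      have e2 := (ho (Sum.inr true)).2.2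
      exact e2.trans e1.symm
    have f2 : ∀ x, o (Sum.inl (M.t x)) = -o (Sum.inl x) := fun x => (ho (Sum.inl x)).1
    have gen : ∀ (c : X → X) (p : X), (∀ x, c x ≠ x) →
        (∀ z, o (insertFlags c p z) = -o z) → (∀ s, o (Sum.inr (!s)) = -o (Sum.inr s)) →
        ∀ x, o (Sum.inl (c x)) = -o (Sum.inl x) ∨ x = c p := by
      intro c p hn hc hs x
      by_cases h1 : x = p
      · left
        subst h1
        have e1 := hc (Sum.inr true)
        have e2 := hc (Sum.inr false)
        have e3 := hs true
        simp only [insertFlags, Bool.not_true] at e1 e2 e3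
        rw [e1, e2, e3]
      by_cases h2 : x = c p
      · exact Or.inr h2
      · left
        have := hc (Sum.inl x)
        rwa [insertFlags_of_ne h1 h2] at this
    have gA := gen M.cA p M.cA_ne (fun z => (ho z).2.1) (fun s => (ho (Sum.inr s)).1)
    have gB := gen (M.twist u).cB q (M.twist u).cB_ne (fun z => (ho z).2.2)
      (fun s => (ho (Sum.inr s)).1)
    have g1 : o (Sum.inl (M.cA u)) = -o (Sum.inl u) := by
      refine (gA u).resolve_right fun e => ?_
      exact (neA (M.cA p) (M.a_cA p)).1 e.symm
    have g2 : o (Sum.inl (M.cA p)) = -o (Sum.inl (M.cA u)) := by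
      have := (gB (M.cA u)).resolve_right fun e => ?_
      · rwa [hcut'] at this
      · rw [hcBq] at e
        have e1 : M.a (M.cA p) = M.a u := by
          rw [hpA, e, M.cB_cB, haq]
        rw [M.a_cA] at e1
        exact ha e1
    have g3 : o (Sum.inl (M.cA p)) = -o (Sum.inl p) := by
      refine (gA p).resolve_right fun e => M.cA_ne p e.symm
    have g4 : o (Sum.inl p) = -o (Sum.inl (M.t u)) := by
      have := (gB (M.t u)).resolve_right fun e => ?_
      · rwa [hcBt] at this
      · rw [hcBq] at e
        exact (neB (M.cB q) (M.b_cB q)).2 e.symm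
    rw [g2, g1, g4, f2, neg_neg] at g3
    exact neg_units_ne_self _ g3.symm
  · refine ⟨{Sum.inl u, Sum.inl (M.cA u), Sum.inl (M.cA p), Sum.inr false, Sum.inl (M.cB q),
      Sum.inl (M.cB (M.t u))}, Finset.card_le_six, ?_⟩
    intro z hz
    simp only [Finset.mem_insert, Finset.mem_singleton, not_or] at hz
    obtain ⟨z1, z2, z3, z4, z5, z6⟩ := hz
    change insertFlags M.cA p (insertFlags (M.twist u).cB q z) =
      insertFlags (M.twist u).cB q (insertFlags M.cA p z)
    have hAtu : insertFlags M.cA p (Sum.inl (M.t u)) = Sum.inl q := by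
      rw [insertFlags_of_ne (neA p rfl).2.symm (neA _ (M.a_cA p)).2.symm]
    have hAq : insertFlags M.cA p (Sum.inl q) = Sum.inl (M.t u) := by
      rw [← hAtu, insertFlags_insertFlags M.cA_cA M.cA_ne]
    have hBtu : insertFlags (M.twist u).cB q (Sum.inl (M.t u)) = Sum.inl p := by
      rw [insertFlags_of_ne (neB q rfl).2.symm, hcBt]
      rw [hcBq]; exact (neB _ (M.b_cB q)).2.symm
    have hBp : insertFlags (M.twist u).cB q (Sum.inl p) = Sum.inl (M.t u) := by
      rw [← hBtu, insertFlags_insertFlags (M.twist u).cB_cB (M.twist u).cB_ne]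
    rcases z with x | (_ | _)
    · have y1 : x ≠ u := fun e => z1 (by rw [e])
      have y2 : x ≠ M.cA u := fun e => z2 (by rw [e])
      have y3 : x ≠ M.cA p := fun e => z3 (by rw [e])
      have y5 : x ≠ M.cB q := fun e => z5 (by rw [e])
      have y6 : x ≠ M.cB (M.t u) := fun e => z6 (by rw [e])
      by_cases w1 : x = M.t u
      · rw [w1, hBtu, hAtu, insertFlags_left, insertFlags_left]
      by_cases w2 : x = p
      · rw [w2, hBp, hAtu, insertFlags_left]; rfl
      by_cases w3 : x = q
      · rw [w3, insertFlags_left, hAq, hBtu]; rfl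
      have k1 : (M.twist u).cB x = M.cB x := by
        refine twist_cB y1 w1 (fun e => w2 ?_) (fun e => y6 ?_)
        · rw [hp, ← e, M.cB_cB]
        · rw [← e, M.cB_cB]
      have k2 : (M.twist u).cB (M.cA x) = M.cB (M.cA x) := by
        refine twist_cB (fun e => y2 ?_) (fun e => w3 ?_) (fun e => y3 ?_) (fun e => y5 ?_)
        · rw [← e, M.cA_cA]
        · rw [hq', ← e, M.cA_cA]
        · rw [hp, ← e, M.cB_cB, M.cA_cA]
        · rw [hq', ← e, ← hq x, M.cA_cA, M.cB_cB]
      rw [insertFlags_of_ne w3 (by rw [hcBq]; exact y5), k1, insertFlags_of_ne w2 y3,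
        insertFlags_of_ne, insertFlags_of_ne, k2, hq x]
      · intro e; exact w1 (by rw [← M.cA_cA x, e, hq', M.cA_cA])
      · rw [hcBq]; intro e; apply y6
        rw [← M.cA_cA x, e, ← M.cB_cB (M.cA (M.cB q)), ← hq, M.cB_cB, hq', M.cA_cA]
      · intro e; exact y1 (by rw [← M.cB_cB x, e, hp, M.cB_cB])
      · intro e; apply y2
        rw [← M.cB_cB x, e, hpA, M.cB_cB]
    · exact absurd rfl z4
    · change insertFlags M.cA p (Sum.inl q) = insertFlags (M.twist u).cB q (Sum.inl p)
      rw [hAq, hBp]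
  · intro i j
    constructor
    · rintro ⟨x | s, h1, h2⟩
      · exact Or.inl ⟨x, h1, h2⟩
      · exact Or.inr ⟨h1.symm, h2.symm⟩
    · rintro (⟨x, h1, h2⟩ | ⟨h1, h2⟩)
      · exact ⟨Sum.inl x, h1, h2⟩
      · exact ⟨Sum.inr true, h1.symm, h2.symm⟩

end BipartiteMap

namespace BipartiteMap

variable {X α β : Type}

section removeFlags

variable {c t : X → X} {u : X}

open Classical in
/-- The involution `c` conjugated such that it exchanges `u` and `t u`. -/
noncomputable def bypass (c t : X → X) (u : X) (x : X) : X :=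
  Equiv.swap (c u) (t u) (c (Equiv.swap (c u) (t u) x))

theorem bypass_bypass (hc : ∀ x, c (c x) = x) (x : X) :
    bypass c t u (bypass c t u x) = x := by
  simp [bypass, hc]

theorem bypass_ne (hn : ∀ x, c x ≠ x) (x : X) : bypass c t u x ≠ x := by
  classical
  intro h
  apply hn (Equiv.swap (c u) (t u) x)
  apply (Equiv.swap (c u) (t u)).injective
  rw [Equiv.swap_apply_self]
  exact h

theorem bypass_self (hn : ∀ x, c x ≠ x) (ht : t u ≠ u) : bypass c t u u = t u := by
  classical
  simp only [bypass]
  rw [Equiv.swap_apply_of_ne_of_ne (hn u).symm ht.symm, Equiv.swap_apply_left]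

theorem bypass_right (hc : ∀ x, c (c x) = x) (hn : ∀ x, c x ≠ x) (ht : t u ≠ u) :
    bypass c t u (t u) = u := by
  rw [← bypass_self hn ht, bypass_bypass hc]

theorem bypass_left (hn : ∀ x, c x ≠ x) (h : c (t u) ≠ c u) :
    bypass c t u (c u) = c (t u) := by
  classical
  simp only [bypass]
  rw [Equiv.swap_apply_left, Equiv.swap_apply_of_ne_of_ne h (hn _)]

theorem bypass_of_ne (hc : ∀ x, c (c x) = x) {x : X} (h1 : x ≠ u) (h2 : x ≠ t u) (h3 : x ≠ c u)
    (h4 : x ≠ c (t u)) : bypass c t u x = c x := by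
  classical
  simp only [bypass]
  rw [Equiv.swap_apply_of_ne_of_ne h3 h2, Equiv.swap_apply_of_ne_of_ne]
  · intro h; apply h1; rw [← hc x, h, hc]
  · intro h; apply h4; rw [← h, hc]

theorem apply_bypass {γ : Type} {f : X → γ} (hf : ∀ x, f (c x) = f x) (hf' : f (t u) = f u)
    (x : X) : f (bypass c t u x) = f x := by
  classical
  have h : ∀ y, f (Equiv.swap (c u) (t u) y) = f y := fun y => by
    rw [Equiv.swap_apply_def]; split_ifs with h h
    · rw [h, hf, hf']
    · rw [h, hf, hf']
    · rfl
  simp only [bypass]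
  rw [h, hf, h]

/-- The flags that are left when the edge of `u` is deleted. -/
abbrev Rest (t : X → X) (u : X) : Type := {x : X // x ≠ u ∧ x ≠ t u}

theorem bypass_rest (hc : ∀ x, c (c x) = x) (hn : ∀ x, c x ≠ x) (ht : t u ≠ u)
    (x : Rest t u) : bypass c t u x.1 ≠ u ∧ bypass c t u x.1 ≠ t u := by
  constructor
  · intro h
    apply x.2.2
    rw [← bypass_bypass (c := c) (t := t) (u := u) hc x.1, h, bypass_self hn ht]
  · intro h
    apply x.2.1
    rw [← bypass_bypass (c := c) (t := t) (u := u) hc x.1, h, bypass_right hc hn ht]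

theorem eqvGen_rest {γ : Type} {f : X → γ} (hc : ∀ x, c (c x) = x) (hn : ∀ x, c x ≠ x)
    (ht : ∀ x, t (t x) = x) (tn : ∀ x, t x ≠ x) (hu : c u ≠ t u)
    (conn : ∀ x y, f x = f y → Relation.EqvGen (fun u v => v = t u ∨ v = c u) x y)
    {t' c' : Rest t u → Rest t u} (ht' : ∀ x, (t' x).1 = t x.1)
    (hc' : ∀ x, (c' x).1 = bypass c t u x.1) (x y : Rest t u) (h : f x.1 = f y.1) :
    Relation.EqvGen (fun u v => v = t' u ∨ v = c' u) x y := by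
  classical
  have hcu : c u ≠ u ∧ c u ≠ t u := ⟨hn u, hu⟩
  have hctu : c (t u) ≠ u ∧ c (t u) ≠ t u := ⟨fun e => hu ((congrArg c e).symm.trans (hc _)), hn _⟩
  let φ : X → Rest t u := fun x =>
    if h1 : x = u then ⟨c u, hcu⟩ else if h2 : x = t u then ⟨c (t u), hctu⟩ else ⟨x, h1, h2⟩
  have φu : φ u = ⟨c u, hcu⟩ := by simp [φ]
  have φt : φ (t u) = ⟨c (t u), hctu⟩ := by simp [φ, tn u]
  have φr : ∀ x : Rest t u, φ x.1 = x := fun x => by simp [φ, x.2.1, x.2.2]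
  have hne : c (t u) ≠ c u := fun e => tn u (by rw [← hc (t u), e, hc])
  have e1 : Relation.EqvGen (fun u v => v = t' u ∨ v = c' u) (φ u) (φ (t u)) := by
    refine .rel _ _ (Or.inr (Subtype.ext ?_))
    rw [hc', φu, φt]
    exact (bypass_left hn hne).symm
  have := eqvGen_map (r' := fun u v => v = t' u ∨ v = c' u) φ ?_ (conn x.1 y.1 h)
  · rwa [φr, φr] at this
  · rintro z w (rfl | rfl)
    · by_cases h1 : z = u
      · rw [h1]; exact e1
      by_cases h2 : z = t u
      · rw [h2, ht]; exact e1.symm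
      · refine .rel _ _ (Or.inl (Subtype.ext ?_))
        rw [ht', φr ⟨z, h1, h2⟩]
        exact congrArg Subtype.val (φr ⟨t z, fun e => h2 (by rw [← e, ht]),
          fun e => h1 (by rw [← ht z, e, ht])⟩)
    · by_cases h1 : z = u
      · rw [h1, φu, φr ⟨c u, hcu⟩]; exact .refl _
      by_cases h2 : z = t u
      · rw [h2, φt, φr ⟨c (t u), hctu⟩]; exact .refl _
      by_cases h3 : z = c u
      · rw [h3, hc, φu, φr ⟨c u, hcu⟩]; exact .refl _
      by_cases h4 : z = c (t u)
      · rw [h4, hc, φt, φr ⟨c (t u), hctu⟩]; exact .refl _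
      · refine .rel _ _ (Or.inr (Subtype.ext ?_))
        rw [hc', φr ⟨z, h1, h2⟩, bypass_of_ne hc h1 h2 h3 h4]
        exact congrArg Subtype.val (φr ⟨c z, fun e => h3 (by rw [← e, hc]),
          fun e => h4 (by rw [← e, hc])⟩)

end removeFlags

/-- The edge of the flag `u` is deleted.  Its ends have other neighbours, too. -/
noncomputable def deleteEdge (M : BipartiteMap X α β) (u : X) (hA : M.cA u ≠ M.t u)
    (hB : M.cB u ≠ M.t u) : BipartiteMap (Rest M.t u) α β where
  t := fun x => ⟨M.t x.1, fun e => x.2.2 ((M.t_t _).symm.trans (congrArg M.t e)),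
    fun e => x.2.1 ((M.t_t _).symm.trans ((congrArg M.t e).trans (M.t_t u)))⟩
  cA := fun x => ⟨bypass M.cA M.t u x.1, bypass_rest M.cA_cA M.cA_ne (M.t_ne u) x⟩
  cB := fun x => ⟨bypass M.cB M.t u x.1, bypass_rest M.cB_cB M.cB_ne (M.t_ne u) x⟩
  a := fun x => M.a x.1
  b := fun x => M.b x.1
  t_t := fun x => Subtype.ext (M.t_t x.1)
  cA_cA := fun x => Subtype.ext (bypass_bypass M.cA_cA x.1)
  cB_cB := fun x => Subtype.ext (bypass_bypass M.cB_cB x.1)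
  t_ne := fun x h => M.t_ne x.1 (congrArg Subtype.val h)
  cA_ne := fun x h => bypass_ne M.cA_ne x.1 (congrArg Subtype.val h)
  cB_ne := fun x h => bypass_ne M.cB_ne x.1 (congrArg Subtype.val h)
  a_t := fun x => M.a_t x.1
  a_cA := fun x => apply_bypass M.a_cA (M.a_t u) x.1
  b_t := fun x => M.b_t x.1
  b_cB := fun x => apply_bypass M.b_cB (M.b_t u) x.1
  edge := fun x y h h' => (M.edge x.1 y.1 h h').imp Subtype.ext Subtype.ext
  connA := eqvGen_rest M.cA_cA M.cA_ne M.t_t M.t_ne hA M.connA (fun _ => rfl) fun _ => rfl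
  connB := eqvGen_rest M.cB_cB M.cB_ne M.t_t M.t_ne hB M.connB (fun _ => rfl) fun _ => rfl

/-- Deletion of an edge of a quadrangulation merges two faces into a hexagon. -/
theorem exists_deleteEdge (M : BipartiteMap X α β) (hq : M.IsQuad) (u : X)
    (hA : M.cA u ≠ M.t u) (hB : M.cB u ≠ M.t u) :
    ∃ M' : BipartiteMap (Rest M.t u) α β, (M'.Orientable → M.Orientable) ∧
      (∃ H : Finset (Rest M.t u), H.card ≤ 6 ∧ ∀ x ∉ H, M'.cA (M'.cB x) = M'.cB (M'.cA x)) ∧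
      ∀ i j, (∃ x, M'.a x = i ∧ M'.b x = j) ↔
        (∃ x, M.a x = i ∧ M.b x = j) ∧ ¬ (M.a u = i ∧ M.b u = j) := by
  classical
  -- the corners at the edge of `u` lead to other edges
  have key : ∀ w, (w = u ∨ w = M.t u) →
      (M.cA w ≠ u ∧ M.cA w ≠ M.t u) ∧ (M.cB w ≠ u ∧ M.cB w ≠ M.t u) := by
    rintro w (rfl | rfl)
    · exact ⟨⟨M.cA_ne _, hA⟩, M.cB_ne _, hB⟩
    · exact ⟨⟨fun e => hA (by rw [← e, M.cA_cA, e]), M.cA_ne _⟩,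
        fun e => hB (by rw [← e, M.cB_cB, e]), M.cB_ne _⟩
  have au : ∀ w, (w = u ∨ w = M.t u) → M.a w = M.a u ∧ M.b w = M.b u := by
    rintro w (rfl | rfl)
    · exact ⟨rfl, rfl⟩
    · exact ⟨M.a_t _, M.b_t _⟩
  have nA : ∀ w, (w = u ∨ w = M.t u) → M.a (M.cB w) ≠ M.a u := fun w hw e => by
    rcases M.edge u (M.cB w) e.symm (by rw [M.b_cB, (au w hw).2]) with h | h
    · exact (key w hw).2.1 h
    · exact (key w hw).2.2 h
  have nB : ∀ w, (w = u ∨ w = M.t u) → M.b (M.cA w) ≠ M.b u := fun w hw e => by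
    rcases M.edge u (M.cA w) (by rw [M.a_cA, (au w hw).1]) e.symm with h | h
    · exact (key w hw).1.1 h
    · exact (key w hw).1.2 h
  have bA : ∀ x, M.a x ≠ M.a u → bypass M.cA M.t u x = M.cA x := fun x hx =>
    bypass_of_ne M.cA_cA (fun e => hx (by rw [e])) (fun e => hx (by rw [e, M.a_t]))
      (fun e => hx (by rw [e, M.a_cA])) (fun e => hx (by rw [e, M.a_cA, M.a_t]))
  have bB : ∀ x, M.b x ≠ M.b u → bypass M.cB M.t u x = M.cB x := fun x hx =>
    bypass_of_ne M.cB_cB (fun e => hx (by rw [e])) (fun e => hx (by rw [e, M.b_t]))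
      (fun e => hx (by rw [e, M.b_cB])) (fun e => hx (by rw [e, M.b_cB, M.b_t]))
  refine ⟨M.deleteEdge u hA hB, ?_, ?_, ?_⟩
  · rintro ⟨o, ho⟩
    have ho1 : ∀ x y : Rest M.t u, y.1 = M.t x.1 → o y = -o x := fun x y h => by
      rw [← (ho x).1]; exact congrArg o (Subtype.ext h)
    have ho2 : ∀ x y : Rest M.t u, y.1 = bypass M.cA M.t u x.1 → o y = -o x := fun x y h => by
      rw [← (ho x).2.1]; exact congrArg o (Subtype.ext h)
    have ho3 : ∀ x y : Rest M.t u, y.1 = bypass M.cB M.t u x.1 → o y = -o x := fun x y h => by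
      rw [← (ho x).2.2]; exact congrArg o (Subtype.ext h)
    let e : ∀ w, (w = u ∨ w = M.t u) → ℤˣ := fun w hw => -o ⟨M.cA w, (key w hw).1⟩
    let O : X → ℤˣ := fun x => if h : x = u ∨ x = M.t u then e x h else o ⟨x, not_or.1 h⟩
    have Oe : ∀ w, (hw : w = u ∨ w = M.t u) → O w = -o ⟨M.cA w, (key w hw).1⟩ := fun w hw => by
      simp only [O, e, hw, dite_true]
    have O_rest : ∀ x (h : x ≠ u ∧ x ≠ M.t u), O x = o ⟨x, h⟩ := fun x h => by
      simp [O, h.1, h.2]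
    have he : o ⟨M.cA (M.t u), (key _ (Or.inr rfl)).1⟩ = -o ⟨M.cA u, (key _ (Or.inl rfl)).1⟩ := by
      refine ho2 _ _ (bypass_left M.cA_ne fun h => M.t_ne u ?_).symm
      rw [← M.cA_cA (M.t u), h, M.cA_cA]
    have OcA : ∀ w, (w = u ∨ w = M.t u) → O (M.cA w) = -O w := fun w hw => by
      rw [Oe w hw, O_rest _ (key w hw).1, neg_neg]
    -- the quadrilateral of `w` determines the value at its corner in `β`
    have OcB : ∀ w, (w = u ∨ w = M.t u) → O (M.cB w) = -O w := fun w hw => by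
      have h1 : M.cA (M.cB w) ≠ u ∧ M.cA (M.cB w) ≠ M.t u := by
        constructor <;> intro h <;> apply nA w hw <;> rw [← M.a_cA, h]
        exact M.a_t u
      rw [Oe w hw, O_rest _ (key w hw).2, neg_neg]
      have e1 := ho2 ⟨M.cB w, (key w hw).2⟩ ⟨M.cA (M.cB w), h1⟩ (bA _ (nA w hw)).symm
      have e2 := ho3 ⟨M.cA w, (key w hw).1⟩ ⟨M.cA (M.cB w), h1⟩
        ((hq w).trans (bB _ (nB w hw)).symm)
      rw [e1] at e2
      exact neg_injective e2
    have mem : ∀ x, ¬ (x = u ∨ x = M.t u) → x ≠ u ∧ x ≠ M.t u := fun x h => not_or.1 h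
    refine ⟨O, fun x => ⟨?_, ?_, ?_⟩⟩
    · by_cases h : x = u
      · rw [h, Oe _ (Or.inl rfl), Oe _ (Or.inr rfl), he]
      by_cases h' : x = M.t u
      · rw [h', M.t_t, Oe _ (Or.inl rfl), Oe _ (Or.inr rfl), he, neg_neg]
      · rw [O_rest x ⟨h, h'⟩, O_rest (M.t x) ⟨fun e => h' (by rw [← e, M.t_t]),
          fun e => h (by rw [← M.t_t x, e, M.t_t])⟩]
        exact ho1 _ _ rfl
    · by_cases h : x = u ∨ x = M.t u
      · exact OcA x h
      by_cases h' : M.cA x = u ∨ M.cA x = M.t u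
      · have := OcA _ h'
        rw [M.cA_cA] at this
        rw [this, neg_neg]
      · rw [O_rest x (mem x h), O_rest (M.cA x) (mem _ h')]
        refine ho2 _ _ (bypass_of_ne M.cA_cA (mem x h).1 (mem x h).2 (fun e => ?_) fun e => ?_).symm
        · exact h' (Or.inl (by rw [e, M.cA_cA]))
        · exact h' (Or.inr (by rw [e, M.cA_cA]))
    · by_cases h : x = u ∨ x = M.t u
      · exact OcB x h
      by_cases h' : M.cB x = u ∨ M.cB x = M.t u
      · have := OcB _ h'
        rw [M.cB_cB] at this
        rw [this, neg_neg]
      · rw [O_rest x (mem x h), O_rest (M.cB x) (mem _ h')]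
        refine ho3 _ _ (bypass_of_ne M.cB_cB (mem x h).1 (mem x h).2 (fun e => ?_) fun e => ?_).symm
        · exact h' (Or.inl (by rw [e, M.cB_cB]))
        · exact h' (Or.inr (by rw [e, M.cB_cB]))
  · let S : Finset X := {M.cA u, M.cB u, M.cA (M.cB u), M.cA (M.t u), M.cB (M.t u),
      M.cA (M.cB (M.t u))}
    refine ⟨S.preimage Subtype.val Subtype.val_injective.injOn, ?_, ?_⟩
    · refine le_trans ?_ (Finset.card_le_six : S.card ≤ 6)
      exact Finset.card_le_card_of_injOn Subtype.val (fun x hx => (Finset.mem_preimage.1 hx))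
        Subtype.val_injective.injOn
    · rintro ⟨x, hx⟩ hxS
      simp only [S, Finset.mem_preimage, Finset.mem_insert, Finset.mem_singleton, not_or] at hxS
      obtain ⟨z1, z2, z3, z4, z5, z6⟩ := hxS
      refine Subtype.ext ?_
      change bypass M.cA M.t u (bypass M.cB M.t u x) = bypass M.cB M.t u (bypass M.cA M.t u x)
      rw [bypass_of_ne M.cB_cB hx.1 hx.2 z2 z5, bypass_of_ne M.cA_cA hx.1 hx.2 z1 z4,
        bypass_of_ne M.cA_cA, bypass_of_ne M.cB_cB, hq x]
      · intro e; exact z1 (by rw [← e, M.cA_cA])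
      · intro e; exact z4 (by rw [← e, M.cA_cA])
      · intro e; exact z3 (by rw [← e, M.cA_cA])
      · intro e; exact z6 (by rw [← e, M.cA_cA])
      · intro e; exact z2 (by rw [← e, M.cB_cB])
      · intro e; exact z5 (by rw [← e, M.cB_cB])
      · intro e; exact z3 (by rw [hq, ← e, M.cB_cB])
      · intro e; exact z6 (by rw [hq, ← e, M.cB_cB])
  · intro i j
    constructor
    · rintro ⟨x, h1, h2⟩
      refine ⟨⟨x.1, h1, h2⟩, fun ⟨h3, h4⟩ => ?_⟩
      rcases M.edge u x.1 (h3.trans h1.symm) (h4.trans h2.symm) with e | e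
      · exact x.2.1 e
      · exact x.2.2 e
    · rintro ⟨⟨x, h1, h2⟩, h3⟩
      refine ⟨⟨x, fun e => ?_, fun e => ?_⟩, h1, h2⟩
      · subst e; exact h3 ⟨h1, h2⟩
      · subst e; exact h3 ⟨by rw [← h1, M.a_t], by rw [← h2, M.b_t]⟩

end BipartiteMap

/-! ### Quadrangulations with given parameters -/

/-- There is a quadrangulation by a complete bipartite graph with parts of `m` and `n` vertices,
without a matching of `k` edges; it is nonorientable if `N` holds. -/
def HasQuad (m n k : ℕ) (N : Prop) : Prop :=
  ∃ (X α β K : Type) (_ : Finite X) (_ : Finite α) (_ : Finite β) (_ : Finite K)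
    (M : BipartiteMap X α β) (f : K → α) (g : K → β), M.IsQuad ∧ M.OmitsMatching f g ∧
      (N → ¬ M.Orientable) ∧ Nat.card α = m ∧ Nat.card β = n ∧ Nat.card K = k

/-- There is a map of a complete bipartite graph with parts of `m` and `n` vertices, without a
matching of `k` edges, in which all faces are quadrilaterals with the possible exception of one
hexagon; it is nonorientable if `N` holds. -/
def HasNearQuad (m n k : ℕ) (N : Prop) : Prop :=
  ∃ (X α β K : Type) (_ : Finite X) (_ : Finite α) (_ : Finite β) (_ : Finite K)
    (M : BipartiteMap X α β) (f : K → α) (g : K → β),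
      (∃ H : Finset X, H.card ≤ 6 ∧ ∀ x ∉ H, M.cA (M.cB x) = M.cB (M.cA x)) ∧
      M.OmitsMatching f g ∧
      (N → ¬ M.Orientable) ∧ Nat.card α = m ∧ Nat.card β = n ∧ Nat.card K = k

variable {m n k : ℕ} {N N' : Prop}

theorem HasQuad.mono (h : HasQuad m n k N) (hN : N' → N) : HasQuad m n k N' := by
  obtain ⟨X, α, β, K, h1, h2, h3, h4, M, f, g, h5, h6, h7, h8⟩ := h
  exact ⟨X, α, β, K, h1, h2, h3, h4, M, f, g, h5, h6, fun h => h7 (hN h), h8⟩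

theorem HasQuad.swap (h : HasQuad m n k N) : HasQuad n m k N := by
  obtain ⟨X, α, β, K, h1, h2, h3, h4, M, f, g, h5, h6, h7, h8, h9, h10⟩ := h
  exact ⟨X, β, α, K, h1, h3, h2, h4, M.swap, g, f, BipartiteMap.swap_isQuad h5, h6.swap,
    fun h h' => h7 h (BipartiteMap.swap_orientable h'), h9, h8, h10⟩

theorem HasQuad.hasNearQuad (h : HasQuad m n k N) : HasNearQuad m n k N := by
  obtain ⟨X, α, β, K, h1, h2, h3, h4, M, f, g, h5, h6, h7, h8⟩ := h
  exact ⟨X, α, β, K, h1, h2, h3, h4, M, f, g, ⟨∅, by simp, fun x _ => h5 x⟩, h6, h7, h8⟩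

theorem exists_not_mem_range {K α : Type} [Finite K] [Finite α] (f : K → α)
    (h : Nat.card K < Nat.card α) : ∃ v, ∀ l, f l ≠ v := by
  by_contra! hf
  exact absurd (Nat.card_le_card_of_surjective f hf) (by omega)

namespace BipartiteMap

variable {X α β K : Type}

theorem Coords.pos_eq_iff {M : BipartiteMap X α β} {v : α} {D p : ℕ} (C : M.Coords v D) {x : X}
    (hx : M.a x = v) (hp : p < D) : C.pos x = p ↔ M.b x = M.b (C.ψ p true) := by
  constructor
  · intro h
    have h1 := C.ψ_pos x hx
    rw [h] at h1
    rw [← h1]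
    cases C.dir x
    · rw [← M.b_t, C.t_ψ]; rfl
    · rfl
  · intro h
    rcases M.edge _ _ (hx.trans (C.a_ψ p true).symm) h with h1 | h1
    · rw [← h1, C.pos_ψ _ _ hp]
    · rw [← M.t_t x, ← h1, C.t_ψ, C.pos_ψ _ _ hp]

/-- A vertex `v` that is adjacent to all of the odd number of vertices in `β` can be split such that
the missing edges still form a matching. -/
theorem exists_split_full [Finite X] [Finite β] (M : BipartiteMap X α β)
    (hq : M.IsQuad) {f : K → α} {g : K → β} (h : M.OmitsMatching f g) (hn : Odd (Nat.card β))
    (h3 : 3 ≤ Nat.card β) (v : α) (hv : ∀ l, f l ≠ v) (j : β) (hj : ∀ l, g l ≠ j) :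
    ∃ (Y : Type) (_ : Finite Y) (M' : BipartiteMap Y (α ⊕ {w // w = v}) β),
      M'.IsQuad ∧ (M'.Orientable → M.Orientable) ∧ (5 ≤ Nat.card β → ¬ M'.Orientable) ∧
      M'.OmitsMatching (fun l : Option K => l.elim (Sum.inl v) fun l => Sum.inl (f l))
        (fun l => l.elim j g) ∧
      ∃ u, M'.a (M'.cB u) = Sum.inl v ∧ M'.b (M'.cA (M'.t u)) = j := by
  have full : ∀ i, ∃ x, M.a x = v ∧ M.b x = i := fun i => (h.adj v i).2 fun l hl => hv l hl.1
  obtain ⟨x₁, e1, e2⟩ := full j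
  -- the coordinates start one edge before the one that leads to `j`
  obtain ⟨x₀, hx₀⟩ : ∃ x₀, x₀ = M.cA (M.t x₁) := ⟨_, rfl⟩
  obtain ⟨D, hD, C, hC⟩ := M.exists_coords x₀
  obtain rfl : M.a x₀ = v := by rw [hx₀, M.a_cA, M.a_t, e1]
  obtain rfl : D = Nat.card β := C.eq_card full
  have hψ : M.b (C.ψ 1 true) = j := by
    have h1 := C.cA_ψ 0 hD
    have h2 : M.cA x₀ = M.t x₁ := by rw [hx₀, M.cA_cA]
    rw [hC, h2, if_neg (by omega), zero_add] at h1
    rw [← M.b_t, C.t_ψ, Bool.not_true, ← h1, M.b_t, e2]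
  obtain ⟨Y, hY, M', q1, q2, q3, q4, q5, q6⟩ := M.exists_split hn h3 (Or.inl rfl)
    (fun w => w = M.a x₀) (fun w hw => hw ▸ C)
  refine ⟨Y, hY, M', q1 hq, q2, fun h5 => q3 h5 ⟨_, rfl⟩, ⟨?_, ?_, ?_⟩, ?_⟩
  · rintro (_ | l) (_ | l') e
    · rfl
    · exact absurd (Sum.inl_injective e).symm (hv l')
    · exact absurd (Sum.inl_injective e) (hv l)
    · exact congrArg some (h.injA (Sum.inl_injective e))
  · rintro (_ | l) (_ | l') e
    · rfl
    · exact absurd e.symm (hj l')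
    · exact absurd e (hj l)
    · exact congrArg some (h.injB e)
  · rintro (w | ⟨w, rfl⟩) i
    · rw [q4]
      constructor
      · rintro ⟨x, h1, h2, h4⟩ (_ | l) ⟨h5, h6⟩
        · have h5 : M.a x₀ = w := Sum.inl_injective h5
          have h6 : j = i := h6
          subst h5
          exact h4 rfl ((C.pos_eq_iff h1 (by omega)).2 (by rw [h2, hψ, h6]))
        · exact (h.adj w i).1 ⟨x, h1, h2⟩ l ⟨Sum.inl_injective h5, h6⟩
      · intro h4
        obtain ⟨x, h1, h2⟩ := (h.adj w i).2 fun l hl => h4 (some l) ⟨congrArg _ hl.1, hl.2⟩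
        refine ⟨x, h1, h2, ?_⟩
        rintro rfl h5
        refine h4 none ⟨rfl, ?_⟩
        have := (C.pos_eq_iff h1 (by omega)).1 h5
        rw [hψ, h2] at this
        exact this.symm
    · rw [q5]
      refine iff_of_true ?_ ?_
      · obtain ⟨x, h1, h2⟩ := full i
        exact ⟨x, h1, h2, (C.pos_lt x h1).ne⟩
      · rintro (_ | l) ⟨h5, -⟩ <;> cases h5
  · obtain ⟨u, h1, h2⟩ := q6 _ rfl
    exact ⟨u, h1, h2.trans hψ⟩

/-- The corner at a vertex with at least two neighbours leads to another edge. -/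
theorem cA_ne_t {M : BipartiteMap X α β} {u x : X} (ha : M.a x = M.a u) (hb : M.b x ≠ M.b u) :
    M.cA u ≠ M.t u := by
  intro e
  have h := eqvGen_map (r' := fun y z : Prop => y ↔ z) (fun y => y = u ∨ y = M.t u) ?_
    (M.connA x u ha)
  · have : ∀ y z : Prop, Relation.EqvGen (fun y z : Prop => y ↔ z) y z → (y ↔ z) := by
      intro y z h
      induction h with
      | rel _ _ h => exact h
      | refl => exact Iff.rfl
      | symm _ _ _ ih => exact ih.symm
      | trans _ _ _ _ _ ih1 ih2 => exact ih1.trans ih2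
    rcases (this _ _ h).2 (Or.inl rfl) with h1 | h1
    · exact hb (by rw [h1])
    · exact hb (by rw [h1, M.b_t])
  · have e' : M.cA (M.t u) = u := by rw [← e, M.cA_cA]
    have aux : ∀ y, (y = u ∨ y = M.t u) → (M.t y = u ∨ M.t y = M.t u) ∧
        (M.cA y = u ∨ M.cA y = M.t u) := by
      rintro y (h | h) <;> rw [h]
      · exact ⟨Or.inr rfl, Or.inr e⟩
      · exact ⟨Or.inl (M.t_t u), Or.inl e'⟩
    rintro y z (rfl | rfl)
    · refine .rel _ _ ⟨fun h => (aux y h).1, fun h => ?_⟩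
      simpa only [M.t_t] using (aux _ h).1
    · refine .rel _ _ ⟨fun h => (aux y h).2, fun h => ?_⟩
      simpa only [M.cA_cA] using (aux _ h).2

end BipartiteMap

/-- A vertex of a quadrangulation that is adjacent to all of an odd number of vertices is split, at
the cost of one more missing edge. -/
theorem HasQuad.addVertex (h : HasQuad m n k N) (hn : Odd n) (h3 : 3 ≤ n) (hm : k < m)
    (hk : k < n) : HasQuad (m + 1) n (k + 1) (N ∨ 5 ≤ n) := by
  obtain ⟨X, α, β, K, h1, h2, _, h4, M, f, g, h5, h6, h7, h8, h9, h10⟩ := h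
  obtain ⟨v, hv⟩ := exists_not_mem_range f (by omega)
  obtain ⟨j, hj⟩ := exists_not_mem_range g (by omega)
  obtain ⟨Y, hY, M', q1, q2, q3, q4, -⟩ := M.exists_split_full h5 h6 (h9 ▸ hn) (by omega) v hv j hj
  refine ⟨Y, _, β, Option K, hY, inferInstance, inferInstance, inferInstance, M', _, _, q1, q4, ?_,
    ?_, h9, ?_⟩
  · rintro (h | h) h'
    · exact h7 h (q2 h')
    · exact q3 (by omega) h'
  · rw [Nat.card_sum, h8, Nat.card_unique]
  · rw [Finite.card_option, h10]

/-- A complete bipartite graph with two odd parts has a nonorientable near-quadrangulation if the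
one with a vertex less has a quadrangulation: a vertex is split and the missing edge is added. -/
theorem HasQuad.addVertexCrossing (h : HasQuad m n 0 N) (hn : Odd n) (h3 : 3 ≤ n) (hm : 0 < m) :
    HasNearQuad (m + 1) n 0 True := by
  obtain ⟨X, α, β, K, h1, h2, _, h4, M, f, g, h5, h6, h7, h8, h9, h10⟩ := h
  obtain ⟨v, hv⟩ := exists_not_mem_range f (by omega)
  obtain ⟨j, hj⟩ := exists_not_mem_range g (by omega)
  obtain ⟨Y, hY, M', q1, q2, q3, q4, u, h11, h12⟩ :=
    M.exists_split_full h5 h6 (h9 ▸ hn) (by omega) v hv j hj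
  obtain ⟨M'', r1, r2, r3⟩ := M'.exists_addCrossing q1 u (by
    rintro x ⟨e1, e2⟩
    exact (q4.adj _ _).1 ⟨x, rfl, rfl⟩ none ⟨(e1.trans h11).symm, (e2.trans h12).symm⟩)
  have hK : IsEmpty K := Finite.card_eq_zero_iff.1 h10
  refine ⟨_, _, β, Empty, inferInstance, inferInstance, inferInstance, inferInstance, M'',
    Empty.elim, Empty.elim, r2, ⟨fun e => e.elim, fun e => e.elim, ?_⟩, fun _ => r1, ?_, h9, ?_⟩
  · intro i i'
    refine iff_of_true ?_ fun e => e.elim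
    rw [r3, q4.adj, h11, h12]
    by_cases hi : i = Sum.inl v ∧ i' = j
    · exact Or.inr hi
    · left
      rintro (_ | l) ⟨e1, e2⟩
      · exact hi ⟨e1.symm, e2.symm⟩
      · exact hK.elim l
  · rw [Nat.card_sum, h8, Nat.card_unique]
  · simp

theorem HasQuad.deleteEdge (h : HasQuad m n k N) (hm : 3 ≤ m) (hn : 3 ≤ n) (hkm : k < m)
    (hkn : k < n) : HasNearQuad m n (k + 1) N := by
  obtain ⟨X, α, β, K, h1, h2, h3, h4, M, f, g, h5, h6, h7, h8, h9, h10⟩ := h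
  obtain ⟨v, hv⟩ := exists_not_mem_range f (by omega)
  obtain ⟨j, hj⟩ := exists_not_mem_range g (by omega)
  obtain ⟨u, rfl, rfl⟩ := (h6.adj v j).2 fun l hl => hv l hl.1
  have hβ : ∃ j', j' ≠ M.b u := by
    have : Nontrivial β := Finite.one_lt_card_iff_nontrivial.1 (by omega)
    exact exists_ne _
  have hα : ∃ v', v' ≠ M.a u := by
    have : Nontrivial α := Finite.one_lt_card_iff_nontrivial.1 (by omega)
    exact exists_ne _
  obtain ⟨j', hj'⟩ := hβ
  obtain ⟨v', hv'⟩ := hα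
  obtain ⟨x, e1, e2⟩ := (h6.adj (M.a u) j').2 fun l hl => hv l hl.1
  obtain ⟨y, e3, e4⟩ := (h6.adj v' (M.b u)).2 fun l hl => hj l hl.2
  obtain ⟨M', r1, r2, r3⟩ := M.exists_deleteEdge h5 u
    (BipartiteMap.cA_ne_t e1 (by rwa [e2]))
    (BipartiteMap.cA_ne_t (M := M.swap) e4 (by change M.a y ≠ M.a u; rwa [e3]))
  refine ⟨_, α, β, Option K, inferInstance, inferInstance, inferInstance, inferInstance, M',
    fun l => l.elim (M.a u) f, fun l => l.elim (M.b u) g, r2, ⟨?_, ?_, ?_⟩,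
    fun h h' => h7 h (r1 h'), h8, h9, by rw [Finite.card_option, h10]⟩
  · rintro (_ | l) (_ | l') e
    · rfl
    · exact absurd e.symm (hv l')
    · exact absurd e (hv l)
    · exact congrArg some (h6.injA e)
  · rintro (_ | l) (_ | l') e
    · rfl
    · exact absurd e.symm (hj l')
    · exact absurd e (hj l)
    · exact congrArg some (h6.injB e)
  · intro i i'
    rw [r3, h6.adj]
    constructor
    · rintro ⟨h, h'⟩ (_ | l)
      · exact h'
      · exact h l
    · intro h
      exact ⟨fun l => h (some l), h none⟩

/-! ### Quadrangulations from sequences of matchings -/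

section cyclicOrder

variable {m : ℕ}

/-- The next number in the cyclic order of the numbers less than `m`. -/
def cyclicNext (i : Fin m) : Fin m := ⟨if i.1 + 1 = m then 0 else i.1 + 1, by split_ifs <;> omega⟩

/-- The previous number in the cyclic order of the numbers less than `m`. -/
def cyclicPrev (i : Fin m) : Fin m := ⟨if i.1 = 0 then m - 1 else i.1 - 1, by split_ifs <;> omega⟩

theorem cyclicPrev_cyclicNext (i : Fin m) : cyclicPrev (cyclicNext i) = i := Fin.ext (by
  by_cases h : i.1 + 1 = m
  · have e : (cyclicNext i).1 = 0 := if_pos h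
    exact (if_pos e).trans (by omega)
  · have e : (cyclicNext i).1 = i.1 + 1 := if_neg h
    exact (if_neg (by omega)).trans (by omega))

theorem cyclicNext_cyclicPrev (i : Fin m) : cyclicNext (cyclicPrev i) = i := Fin.ext (by
  by_cases h : i.1 = 0
  · have e : (cyclicPrev i).1 = m - 1 := if_pos h
    exact (if_pos (by omega)).trans h.symm
  · have e : (cyclicPrev i).1 = i.1 - 1 := if_neg h
    exact (if_neg (by omega)).trans (by omega))

theorem eqvGen_cyclicNext (i j : Fin m) : Relation.EqvGen (fun u v => v = cyclicNext u) i j := by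
  have h0 : ∀ k (hk : k < m), Relation.EqvGen (fun u v => v = cyclicNext u)
      (⟨0, by omega⟩ : Fin m) ⟨k, hk⟩ := by
    intro k
    induction k with
    | zero => intro _; exact .refl _
    | succ k ih =>
      intro hk
      have e : (cyclicNext (⟨k, by omega⟩ : Fin m)).1 = k + 1 := if_neg (show ¬ k + 1 = m by omega)
      exact (ih (by omega)).trans _ _ _ (.rel _ _ (Fin.ext e.symm))
  exact (h0 i i.2).symm.trans _ _ _ (h0 j j.2)

end cyclicOrder

namespace BipartiteMap

variable {I β : Type}

/-- The quadrangulation by a complete bipartite graph in which the vertices `i` and `nxt i` of `I`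
share the quadrilaterals that are given by the pairs of the matching `μ i` on `β`.  The rotation at
`i` is the union of the matchings `μ i` and `μ (prv i)`, and the rotation at every vertex of `β` is
the cycle `nxt`. -/
def rows (nxt prv : I → I) (μ : I → β → β) (prv_nxt : ∀ i, prv (nxt i) = i)
    (nxt_prv : ∀ i, nxt (prv i) = i)
    (conn_nxt : ∀ i j, Relation.EqvGen (fun u v => v = nxt u) i j)
    (μ_μ : ∀ i x, μ i (μ i x) = x) (μ_ne : ∀ i x, μ i x ≠ x)
    (conn_μ : ∀ i x y, Relation.EqvGen (fun u v => v = μ i u ∨ v = μ (prv i) u) x y) :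
    BipartiteMap (I × β × Bool) I β where
  t := fun z => (z.1, z.2.1, !z.2.2)
  cA := fun z => (z.1, if z.2.2 then μ z.1 z.2.1 else μ (prv z.1) z.2.1, z.2.2)
  cB := fun z => (if z.2.2 then nxt z.1 else prv z.1, z.2.1, !z.2.2)
  a := fun z => z.1
  b := fun z => z.2.1
  t_t := by rintro ⟨i, x, s⟩; simp
  cA_cA := by rintro ⟨i, x, _ | _⟩ <;> simp [μ_μ]
  cB_cB := by rintro ⟨i, x, _ | _⟩ <;> simp [nxt_prv, prv_nxt]
  t_ne := by rintro ⟨i, x, s⟩; simp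
  cA_ne := by rintro ⟨i, x, _ | _⟩ <;> simp [μ_ne]
  cB_ne := by rintro ⟨i, x, s⟩; simp
  a_t := fun _ => rfl
  a_cA := fun _ => rfl
  b_t := fun _ => rfl
  b_cB := fun _ => rfl
  edge := by
    rintro ⟨i, x, s⟩ ⟨j, y, s'⟩ h h'
    obtain rfl : i = j := h
    obtain rfl : x = y := h'
    cases s <;> cases s' <;> simp
  connA := by
    rintro ⟨i, x, s⟩ ⟨j, y, s'⟩ h
    obtain rfl : i = j := h
    have flip : ∀ z s s', Relation.EqvGen (fun u v : I × β × Bool => v = (u.1, u.2.1, !u.2.2) ∨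
        v = (u.1, if u.2.2 then μ u.1 u.2.1 else μ (prv u.1) u.2.1, u.2.2))
        (i, z, s) (i, z, s') := by
      intro z s s'
      by_cases h : s = s'
      · subst h; exact .refl _
      · obtain rfl : s' = !s := by revert h; cases s <;> cases s' <;> simp
        exact .rel _ _ (Or.inl rfl)
    refine .trans _ _ _ (flip x s true) (.trans _ _ _ ?_ (flip y true s'))
    refine eqvGen_map (fun z => (i, z, true)) ?_ (conn_μ i x y)
    rintro u v (rfl | rfl)
    · exact .rel _ _ (Or.inr rfl)
    · refine .trans _ _ _ (flip u true false) (.trans _ _ _ ?_ (flip _ false true))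
      exact .rel _ _ (Or.inr rfl)
  connB := by
    rintro ⟨i, x, s⟩ ⟨j, y, s'⟩ h
    obtain rfl : x = y := h
    have flip : ∀ i s s', Relation.EqvGen (fun u v : I × β × Bool => v = (u.1, u.2.1, !u.2.2) ∨
        v = (if u.2.2 then nxt u.1 else prv u.1, u.2.1, !u.2.2)) (i, x, s) (i, x, s') := by
      intro z s s'
      by_cases h : s = s'
      · subst h; exact .refl _
      · obtain rfl : s' = !s := by revert h; cases s <;> cases s' <;> simp
        exact .rel _ _ (Or.inl rfl)
    refine .trans _ _ _ (flip i s true) (.trans _ _ _ ?_ (flip j true s'))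
    refine eqvGen_map (fun z => (z, x, true)) ?_ (conn_nxt i j)
    rintro u v rfl
    exact .trans _ _ _ (.rel _ _ (Or.inr rfl)) (flip _ false true)

end BipartiteMap

/-- The vertices `v` in `J` of the quadrangulation `rows` are split at the edge to the centre `c v`.
The two copies of `v` miss the neighbours of `c v` in the rotation at `v`; if these are distinct for
all `v`, then the missing edges form a matching.  The quadrangulation is nonorientable if the union
of the matchings is not bipartite. -/
theorem hasQuad_of_rows {I β : Type} [Finite I] [Finite β] {N : Prop} {nxt prv : I → I}
    {μ : I → β → β} (prv_nxt : ∀ i, prv (nxt i) = i) (nxt_prv : ∀ i, nxt (prv i) = i)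
    (conn_nxt : ∀ i j, Relation.EqvGen (fun u v => v = nxt u) i j)
    (μ_μ : ∀ i x, μ i (μ i x) = x) (μ_ne : ∀ i x, μ i x ≠ x)
    (conn_μ : ∀ i x y, Relation.EqvGen (fun u v => v = μ i u ∨ v = μ (prv i) u) x y)
    (J : I → Prop) (c : I → β) (hn : Even (Nat.card β)) (h4 : 4 ≤ Nat.card β)
    (inj : ∀ v w, J v → J w → ∀ s s' : Bool,
      μ (if s then prv v else v) (c v) = μ (if s' then prv w else w) (c w) → v = w ∧ s = s')
    (hN : N → ¬ ∃ φ : β → ℤˣ, ∀ i x, φ (μ i x) = -φ x) :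
    HasQuad (Nat.card I + Nat.card {v // J v}) (Nat.card β) (2 * Nat.card {v // J v}) N := by
  set M := BipartiteMap.rows nxt prv μ prv_nxt nxt_prv conn_nxt μ_μ μ_ne conn_μ with hM
  have hq : M.IsQuad := by
    rintro ⟨i, x, _ | _⟩ <;> simp [M, BipartiteMap.rows, prv_nxt]
  have hor : N → ¬ M.Orientable := by
    rintro h ⟨o, ho⟩
    refine hN h ?_
    rcases isEmpty_or_nonempty I with hI | ⟨⟨i₀⟩⟩
    · exact ⟨fun _ => 1, fun i => hI.elim i⟩
    have step : ∀ i x, o (nxt i, x, true) = o (i, x, true) := by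
      intro i x
      have e1 : o (nxt i, x, false) = -o (i, x, true) := (ho (i, x, true)).2.2
      have e2 : o (nxt i, x, true) = -o (nxt i, x, false) := (ho (nxt i, x, false)).1
      rw [e2, e1, neg_neg]
    have const : ∀ i x, o (i, x, true) = o (i₀, x, true) := by
      intro i x
      have h := conn_nxt i i₀
      induction h with
      | rel u v h => rw [h, step]
      | refl => rfl
      | symm _ _ _ ih => exact ih.symm
      | trans _ _ _ _ _ ih1 ih2 => exact ih1.trans ih2
    refine ⟨fun x => o (i₀, x, true), fun i x => ?_⟩
    simp only
    rw [← const i, ← const i]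
    exact (ho (i, x, true)).2.1
  have full : ∀ v j, ∃ x, M.a x = v ∧ M.b x = j := fun v j => ⟨(v, j, true), rfl, rfl⟩
  have hC : ∀ v, ∃ C : M.Coords v (Nat.card β), C.ψ 0 true = (v, c v, true) := by
    intro v
    obtain ⟨D, hD, C, hC⟩ := M.exists_coords (v, c v, true)
    obtain rfl : D = Nat.card β := C.eq_card (full v)
    exact ⟨C, hC⟩
  choose C hC using hC
  have b_first : ∀ v, M.b ((C v).ψ 1 true) = μ v (c v) := by
    intro v
    have h1 := (C v).cA_ψ 0 (by omega)
    rw [hC, if_neg (by omega), zero_add] at h1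
    rw [← M.b_t, (C v).t_ψ, Bool.not_true, ← h1]
    rfl
  have b_last : ∀ v, M.b ((C v).ψ (Nat.card β - 1) true) = μ (prv v) (c v) := by
    intro v
    have h1 := (C v).cA_ψ (Nat.card β - 1) (by omega)
    rw [if_pos (by omega)] at h1
    have h2 := (C v).t_ψ 0 true
    rw [hC, Bool.not_true] at h2
    rw [← M.cA_cA ((C v).ψ (Nat.card β - 1) true), h1, ← h2]
    rfl
  have hL : Odd (Nat.card β - 1) := Nat.Even.sub_odd (by omega) hn odd_one
  obtain ⟨Y, hY, M', q1, q2, -, q4, q5, -⟩ := M.exists_split hL (by omega) (D := Nat.card β)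
    (Or.inr (by omega)) J (fun v _ => C v)
  refine ⟨Y, I ⊕ {v // J v}, β, {v // J v} × Bool, hY, inferInstance, inferInstance, inferInstance,
    M', fun l => if l.2 then Sum.inr l.1 else Sum.inl l.1.1,
    fun l => μ (if l.2 then prv l.1.1 else l.1.1) (c l.1.1), q1 hq, ⟨?_, ?_, ?_⟩,
    fun h h' => hor h (q2 h'), ?_, rfl, ?_⟩
  · rintro ⟨v, _ | _⟩ ⟨w, _ | _⟩ h
    · simp only [Bool.false_eq_true, ↓reduceIte, Sum.inl.injEq] at h
      rw [Subtype.ext h]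
    · simp at h
    · simp at h
    · simp only [↓reduceIte, Sum.inr.injEq] at h
      rw [h]
  · rintro ⟨⟨v, hv⟩, s⟩ ⟨⟨w, hw⟩, s'⟩ h
    obtain ⟨rfl, rfl⟩ := inj v w hv hw s s' h
    rfl
  · rintro (v | ⟨v, hv⟩) j
    · rw [q4]
      constructor
      · rintro ⟨x, h1, h2, h3⟩ ⟨⟨w, hw⟩, _ | _⟩ ⟨h5, h6⟩
        · obtain rfl : w = v := Sum.inl_injective h5
          refine h3 hw (((C w).pos_eq_iff h1 (by omega)).2 ?_)
          rw [b_first, h2]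
          exact h6.symm
        · cases h5
      · intro h
        refine ⟨(v, j, true), rfl, rfl, fun hv hp => h ⟨⟨v, hv⟩, false⟩ ⟨rfl, ?_⟩⟩
        have := ((C v).pos_eq_iff rfl (by omega)).1 hp
        rw [b_first] at this
        exact this.symm
    · rw [q5]
      constructor
      · rintro ⟨x, h1, h2, h3⟩ ⟨⟨w, hw⟩, _ | _⟩ ⟨h5, h6⟩
        · cases h5
        · obtain rfl : w = v := congrArg Subtype.val (Sum.inr_injective h5)
          refine h3 (((C w).pos_eq_iff h1 (by omega)).2 ?_)
          rw [b_last, h2]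
          exact h6.symm
      · intro h
        refine ⟨(v, j, true), rfl, rfl, fun hp => h ⟨⟨v, hv⟩, true⟩ ⟨rfl, ?_⟩⟩
        have := ((C v).pos_eq_iff rfl (by omega)).1 hp
        rw [b_last] at this
        exact this.symm
  · rw [Nat.card_sum]
  · rw [Nat.card_prod, Nat.card_eq_fintype_card (α := Bool), Fintype.card_bool, mul_comm]

/-- Three matchings on the numbers less than the even number `n ≥ 4`.  The union of any two is a
Hamiltonian cycle, but the union of all of them contains the triangle `0`, `1`, `2`. -/
def matching (n : ℕ) : ℕ → ℕ → ℕ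
  | 0, x => if x % 2 = 0 then x + 1 else x - 1
  | 1, x => if x % 2 = 0 then (if x = 0 then n - 1 else x - 1) else (if x + 1 = n then 0 else x + 1)
  | _, x => if x = 0 then 2 else if x = 2 then 0 else if x + 1 = n then x - 2 else
      if x + 3 = n then x + 2 else if x % 2 = 0 then x - 3 else x + 3

section matching

variable {n : ℕ}

theorem matching_two (n x : ℕ) : matching n 2 x = if x = 0 then 2 else if x = 2 then 0 else
    if x + 1 = n then x - 2 else
      if x + 3 = n then x + 2 else if x % 2 = 0 then x - 3 else x + 3 := rfl

theorem matching_spec (hn : Even n) (h4 : 4 ≤ n) {c x : ℕ} (hc : c < 3) (hx : x < n) :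
    matching n c x < n ∧ matching n c (matching n c x) = x ∧ matching n c x ≠ x := by
  obtain ⟨r, rfl⟩ := hn
  interval_cases c
  · have key : ∀ y z, z = matching (r + r) 0 y ↔ ((y % 2 = 0 → z = y + 1) ∧
        (y % 2 = 1 → z = y - 1)) := by
      intro y z
      simp only [matching]
      split_ifs <;> omega
    generalize hy : matching (r + r) 0 x = y
    have h1 := (key _ _).1 hy.symm
    refine ⟨by omega, ?_, by omega⟩
    exact ((key y x).2 (by omega)).symm
  · have key : ∀ y z, z = matching (r + r) 1 y ↔ ((y = 0 → z = r + r - 1) ∧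
        (y ≠ 0 → y % 2 = 0 → z = y - 1) ∧ (y % 2 = 1 → y + 1 = r + r → z = 0) ∧
        (y % 2 = 1 → y + 1 ≠ r + r → z = y + 1)) := by
      intro y z
      simp only [matching]
      split_ifs <;> omega
    generalize hy : matching (r + r) 1 x = y
    have h1 := (key _ _).1 hy.symm
    refine ⟨by omega, ?_, by omega⟩
    exact ((key y x).2 (by omega)).symm
  · have key : ∀ y z, z = matching (r + r) 2 y ↔ ((y = 0 → z = 2) ∧ (y = 2 → z = 0) ∧
        (y + 1 = r + r → z = y - 2) ∧ (y + 3 = r + r → z = y + 2) ∧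
        (y ≠ 0 ∧ y ≠ 2 ∧ y + 1 ≠ r + r ∧ y + 3 ≠ r + r → y % 2 = 0 → z = y - 3) ∧
        (y ≠ 0 ∧ y ≠ 2 ∧ y + 1 ≠ r + r ∧ y + 3 ≠ r + r → y % 2 = 1 → z = y + 3)) := by
      intro y z
      rw [matching_two]
      split_ifs <;> omega
    generalize hy : matching (r + r) 2 x = y
    have h1 := (key _ _).1 hy.symm
    refine ⟨by omega, ?_, by omega⟩
    exact ((key y x).2 (by omega)).symm

/-- An equivalence relation that contains two of the three matchings has a single class. -/
theorem linked_matching (hn : Even n) (h4 : 4 ≤ n) {c d : ℕ} (hc : c < 3) (hd : d < 3)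
    (hcd : c ≠ d) (R : ℕ → ℕ → Prop) (hR : Equivalence R)
    (hRc : ∀ x < n, R x (matching n c x)) (hRd : ∀ x < n, R x (matching n d x)) :
    ∀ x < n, R x 0 := by
  wlog h : c < d generalizing c d
  · exact this hd hc hcd.symm hRd hRc (by omega)
  have get : ∀ c x y, (∀ x < n, R x (matching n c x)) → x < n → matching n c x = y → R x y := by
    rintro c x y h hx rfl; exact h x hx
  obtain ⟨r, rfl⟩ := hn
  intro x
  induction x using Nat.strong_induction_on with
  | _ x ih =>
    intro hx
    by_cases h0 : x = 0
    · subst h0; exact hR.refl 0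
    have h012 : (c = 0 ∧ d = 1) ∨ (c = 0 ∧ d = 2) ∨ (c = 1 ∧ d = 2) := by omega
    rcases h012 with ⟨rfl, rfl⟩ | ⟨rfl, rfl⟩ | ⟨rfl, rfl⟩
    · rcases Nat.mod_two_eq_zero_or_one x with h2 | h2
      · exact hR.trans (get 1 x (x - 1) hRd hx (by simp only [matching]; split_ifs; omega))
          (ih (x - 1) (by omega) (by omega))
      · exact hR.trans (get 0 x (x - 1) hRc hx (by simp only [matching]; split_ifs <;> omega))
          (ih (x - 1) (by omega) (by omega))
    · rcases Nat.mod_two_eq_zero_or_one x with h2 | h2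
      · by_cases h3 : x = 2
        · exact get 2 x 0 hRd hx (by rw [matching_two, h3]; rfl)
        · exact hR.trans (get 2 x (x - 3) hRd hx (by rw [matching_two]; split_ifs <;> omega))
            (ih (x - 3) (by omega) (by omega))
      · exact hR.trans (get 0 x (x - 1) hRc hx (by simp only [matching]; split_ifs <;> omega))
          (ih (x - 1) (by omega) (by omega))
    · have even : ∀ y < r + r, y % 2 = 0 → y ≤ x + 1 → R y 0 := by
        intro y hy h2 hyx
        by_cases h0 : y = 0
        · subst h0; exact hR.refl 0
        by_cases h3 : y = 2
        · exact get 2 y 0 hRd hy (by rw [matching_two, h3]; rfl)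
        · exact hR.trans (get 2 y (y - 3) hRd hy (by rw [matching_two]; split_ifs <;> omega))
            (ih (y - 3) (by omega) (by omega))
      rcases Nat.mod_two_eq_zero_or_one x with h2 | h2
      · exact even x hx h2 (by omega)
      · by_cases h3 : x + 1 = r + r
        · exact get 1 x 0 hRc hx (by simp only [matching]; rw [if_neg (by omega), if_pos h3])
        · exact hR.trans (get 1 x (x + 1) hRc hx
            (by simp only [matching]; rw [if_neg (by omega), if_neg h3]))
            (even (x + 1) (by omega) (by omega) (by omega))

end matching

/-- Consider the quadrangulation with `m` and `n` vertices that is given by a cyclic sequence `seq`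
of the three matchings.  If the neighbours `y v false`, `y v true` of the edge from `v` to `c v` in
the rotation at `v` are all distinct for `s ≤ v < e`, then these vertices can be split.  If all
three matchings occur, the triangle in their union makes the quadrangulation nonorientable. -/
theorem hasQuad_of_centres {m n s e : ℕ} {N : Prop} (hn : Even n) (h4 : 4 ≤ n)
    (he : e ≤ m) (seq : ℕ → ℕ) (hs : ∀ i < m, seq i < 3)
    (hs' : ∀ i < m, seq i ≠ seq (if i = 0 then m - 1 else i - 1)) (c : ℕ → ℕ) (y : ℕ → Bool → ℕ)
    (hc : ∀ v, s ≤ v → v < e → c v < n)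
    (hy : ∀ v, s ≤ v → v < e → matching n (seq v) (c v) = y v false)
    (hy' : ∀ v, s ≤ v → v < e → matching n (seq (if v = 0 then m - 1 else v - 1)) (c v) = y v true)
    (inj : ∀ v w, s ≤ v → v < e → s ≤ w → w < e → ∀ d d', y v d = y w d' → v = w ∧ d = d')
    (hN : N → ∀ d < 3, ∃ i < m, seq i = d) :
    HasQuad (m + (e - s)) n (2 * (e - s)) N := by
  classical
  let μ : Fin m → Fin n → Fin n := fun i x =>
    ⟨matching n (seq i) x, (matching_spec hn h4 (hs i i.2) x.2).1⟩
  let C : Fin m → Fin n := fun i => if h : c i < n then ⟨c i, h⟩ else ⟨0, by omega⟩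
  have hC : ∀ v : Fin m, s ≤ v.1 → v.1 < e → (C v).1 = c v := fun v h h' => by
    simp only [C, hc v h h', dite_true]
  have hcard : Nat.card {v : Fin m // s ≤ v.1 ∧ v.1 < e} = e - s := by
    rw [← Nat.card_fin (e - s)]
    exact Nat.card_congr ⟨fun v => ⟨v.1.1 - s, by omega⟩,
      fun k => ⟨⟨s + k, by omega⟩, by simp; omega⟩, fun v => Subtype.ext (Fin.ext (by simp; omega)),
      fun k => Fin.ext (by simp)⟩
  have := hasQuad_of_rows (I := Fin m) (β := Fin n) (N := N) (μ := μ)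
    cyclicPrev_cyclicNext cyclicNext_cyclicPrev eqvGen_cyclicNext
    (fun i x => Fin.ext (matching_spec hn h4 (hs i i.2) x.2).2.1)
    (fun i x h => (matching_spec hn h4 (hs i i.2) x.2).2.2 (congrArg Fin.val h)) ?_
    (fun v => s ≤ v.1 ∧ v.1 < e) C (by rwa [Nat.card_fin]) (by rwa [Nat.card_fin]) ?_ ?_
  · rwa [Nat.card_fin, Nat.card_fin, hcard] at this
  · intro i
    have h0 : ∀ x (hx : x < n), Relation.EqvGen (fun u v => v = μ i u ∨ v = μ (cyclicPrev i) u)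
        (⟨x, hx⟩ : Fin n) ⟨0, by omega⟩ := by
      intro x hx
      have := linked_matching hn h4 (hs i i.2) (hs (cyclicPrev i) (cyclicPrev i).2) (hs' i i.2)
        (fun x y => (x < n ↔ y < n) ∧ ∀ hx hy,
          Relation.EqvGen (fun u v => v = μ i u ∨ v = μ (cyclicPrev i) u)
          (⟨x, hx⟩ : Fin n) ⟨y, hy⟩) ⟨?_, ?_, ?_⟩ ?_ ?_ x hx
      · exact this.2 hx _
      · intro x; exact ⟨Iff.rfl, fun _ _ => .refl _⟩
      · intro x y h; exact ⟨h.1.symm, fun h1 h2 => (h.2 h2 h1).symm⟩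
      · intro x y z h h'
        exact ⟨h.1.trans h'.1, fun h1 h2 => (h.2 h1 (h.1.1 h1)).trans _ _ _ (h'.2 _ h2)⟩
      · intro x hx
        exact ⟨iff_of_true hx (μ i ⟨x, hx⟩).2, fun _ _ => .rel _ _ (Or.inl rfl)⟩
      · intro x hx
        exact ⟨iff_of_true hx (μ (cyclicPrev i) ⟨x, hx⟩).2, fun _ _ => .rel _ _ (Or.inr rfl)⟩
    exact fun x y => (h0 x x.2).trans _ _ _ (h0 y y.2).symm
  · rintro v w ⟨hv, hv'⟩ ⟨hw, hw'⟩ d d' h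
    have key : ∀ v : Fin m, s ≤ v.1 → v.1 < e → ∀ d : Bool,
        (μ (if d then cyclicPrev v else v) (C v)).1 = y v d := by
      intro v h h' d
      cases d
      · simp only [Bool.false_eq_true, ↓reduceIte, μ, hC v h h', hy v h h']
      · simp only [↓reduceIte, μ, hC v h h', cyclicPrev, hy' v h h']
    have h := congrArg Fin.val h
    rw [key v hv hv', key w hw hw'] at h
    obtain ⟨h1, h2⟩ := inj v w hv hv' hw hw' d d' h
    exact ⟨Fin.ext h1, h2⟩
  · rintro h ⟨φ, hφ⟩
    have f : ∀ d < 3, ∀ x y : Fin n, matching n d x = y → φ y = -φ x := by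
      intro d hd x y hxy
      obtain ⟨i, hi, rfl⟩ := hN h d hd
      rw [← hφ ⟨i, hi⟩ x]
      exact congrArg φ (Fin.ext hxy.symm)
    have e1 := f 0 (by omega) ⟨0, by omega⟩ ⟨1, by omega⟩ rfl
    have e2 := f 1 (by omega) ⟨1, by omega⟩ ⟨2, by omega⟩ (by
      simp only [matching]; rw [if_neg (by omega), if_neg (by omega)])
    have e3 := f 2 (by omega) ⟨0, by omega⟩ ⟨2, by omega⟩ rfl
    rw [e2, e1, neg_neg] at e3
    exact neg_units_ne_self _ e3.symm

/-! ### Quadrangulations with an even part -/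

section matching

variable {n x : ℕ}

theorem matching_zero_even (h : x % 2 = 0) : matching n 0 x = x + 1 := if_pos h

theorem matching_zero_odd (h : x % 2 = 1) : matching n 0 x = x - 1 := if_neg (by omega)

theorem matching_one_even (h : x % 2 = 0) (h0 : x ≠ 0) : matching n 1 x = x - 1 :=
  (if_pos h).trans (if_neg h0)

theorem matching_one_odd (h : x % 2 = 1) (hn : x + 1 ≠ n) : matching n 1 x = x + 1 :=
  (if_neg (by omega)).trans (if_neg hn)

theorem matching_one_last (h : x % 2 = 1) (hn : x + 1 = n) : matching n 1 x = 0 :=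
  (if_neg (by omega)).trans (if_pos hn)

theorem matching_two_four (hn : n % 2 = 0) : matching n 2 4 = 1 := by
  rw [matching_two, if_neg (by omega), if_neg (by omega), if_neg (by omega), if_neg (by omega),
    if_pos (by omega)]

theorem matching_two_last (hn : n % 2 = 0) (h : x + 3 = n) : matching n 2 x = x + 2 := by
  rw [matching_two]; split_ifs <;> omega

theorem matching_two_odd (hn : n % 2 = 0) (h : x + 5 = n) : matching n 2 x = x + 3 := by
  rw [matching_two]; split_ifs <;> omega

end matching

/-- The sequence of matchings in which the first two alternate and the third one comes last. -/
def lastTwo (m i : ℕ) : ℕ := if i + 1 = m then 2 else (i + 1) % 2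

theorem hasQuad_of_lastTwo {m n s e : ℕ} (hn : Even n) (h4 : 4 ≤ n) (hm : 3 ≤ m) (he : e ≤ m)
    (c : ℕ → ℕ) (y : ℕ → Bool → ℕ) (hc : ∀ v, s ≤ v → v < e → c v < n)
    (hy : ∀ v, s ≤ v → v < e → matching n (lastTwo m v) (c v) = y v false)
    (hy' : ∀ v, s ≤ v → v < e →
      matching n (lastTwo m (if v = 0 then m - 1 else v - 1)) (c v) = y v true)
    (inj : ∀ v w, s ≤ v → v < e → s ≤ w → w < e → ∀ d d', y v d = y w d' → v = w ∧ d = d') :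
    HasQuad (m + (e - s)) n (2 * (e - s)) True := by
  refine hasQuad_of_centres hn h4 he (lastTwo m) ?_ ?_ c y hc hy hy' inj ?_
  · intro i hi; unfold lastTwo; split_ifs <;> omega
  · intro i hi
    by_cases h : i = 0
    · rw [if_pos h]; unfold lastTwo; split_ifs <;> omega
    · rw [if_neg h]; unfold lastTwo; split_ifs <;> omega
  · intro _ d hd
    interval_cases d
    · exact ⟨1, by omega, by unfold lastTwo; rw [if_neg (by omega)]⟩
    · exact ⟨0, by omega, by unfold lastTwo; rw [if_neg (by omega)]⟩
    · exact ⟨m - 1, by omega, by unfold lastTwo; rw [if_pos (by omega)]⟩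

section lastTwo

variable {m v : ℕ}

theorem lastTwo_of_lt (h : v + 1 < m) : lastTwo m v = (v + 1) % 2 := if_neg (by omega)

theorem lastTwo_pred (h : v < m) (h0 : v ≠ 0) :
    lastTwo m (if v = 0 then m - 1 else v - 1) = v % 2 := by
  rw [if_neg h0, lastTwo, if_neg (by omega), Nat.sub_add_cancel (by omega)]

theorem lastTwo_pred_zero (h : 0 < m) :
    lastTwo m (if 0 = 0 then m - 1 else 0 - 1) = 2 := by
  rw [if_pos rfl, lastTwo, if_pos (by omega)]

end lastTwo

/-- The standard choice of centres: `2 * v` for odd `v` and `2 * v - 3` for even `v`, such that the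
missing edges lead to consecutive pairs of odd and of even numbers.  If vertex `0` is split, too
(`s = 0`), then its centre `c₀` and the ends `f₀`, `t₀` of its missing edges are chosen separately,
since one of the matchings at vertex `0` is the third one. -/
theorem hasQuad_standard {m n s e c₀ f₀ t₀ : ℕ} (hn : Even n) (h4 : 4 ≤ n) (hm : 3 ≤ m)
    (he : e < m) (hen : 2 * e ≤ n + 2 * (e % 2)) (h0 : s = 0 → c₀ < n ∧ matching n 1 c₀ = f₀ ∧
      matching n 2 c₀ = t₀ ∧ f₀ ≠ t₀ ∧ ∀ v, 1 ≤ v → v < e →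
        (v % 2 = 1 → 2 * v - 1 ≠ f₀ ∧ 2 * v - 1 ≠ t₀ ∧ 2 * v + 1 ≠ f₀ ∧ 2 * v + 1 ≠ t₀) ∧
        (v % 2 = 0 → 2 * v - 4 ≠ f₀ ∧ 2 * v - 4 ≠ t₀ ∧ 2 * v - 2 ≠ f₀ ∧ 2 * v - 2 ≠ t₀)) :
    HasQuad (m + (e - s)) n (2 * (e - s)) True := by
  obtain ⟨r, rfl⟩ := hn
  refine hasQuad_of_lastTwo (Even.add_self r) h4 hm he.le
    (fun v => if v = 0 then c₀ else if v % 2 = 1 then 2 * v else 2 * v - 3)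
    (fun v d => if v = 0 then (if d then t₀ else f₀) else
      if v % 2 = 1 then (if d then 2 * v - 1 else 2 * v + 1) else
        (if d then 2 * v - 4 else 2 * v - 2)) ?_ ?_ ?_ ?_
  · intro v h1 h2
    by_cases hv : v = 0
    · simp only [hv, ↓reduceIte]; exact (h0 (by omega)).1
    rcases Nat.mod_two_eq_zero_or_one v with h | h <;>
      simp only [hv, h, zero_ne_one, ↓reduceIte] <;> omega
  · intro v h1 h2
    rw [lastTwo_of_lt (by omega)]
    by_cases hv : v = 0
    · simp only [hv, ↓reduceIte]; exact (h0 (by omega)).2.1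
    rcases Nat.mod_two_eq_zero_or_one v with h | h <;>
      simp only [hv, h, zero_ne_one, Bool.false_eq_true, ↓reduceIte]
    · rw [show (v + 1) % 2 = 1 by omega, matching_one_odd (by omega) (by omega)]; omega
    · rw [show (v + 1) % 2 = 0 by omega, matching_zero_even (by omega)]
  · intro v h1 h2
    by_cases hv : v = 0
    · subst hv
      rw [lastTwo_pred_zero (by omega)]; exact (h0 (by omega)).2.2.1
    rw [lastTwo_pred (by omega) hv]
    rcases Nat.mod_two_eq_zero_or_one v with h | h <;>
      simp only [hv, h, zero_ne_one, ↓reduceIte]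
    · rw [matching_zero_odd (by omega)]; omega
    · rw [matching_one_even (by omega) (by omega)]
  · intro v w h1 h2 h3 h5 d d' h
    have key : ∀ v w (d d' : Bool), s ≤ v → v < e → s ≤ w → w < e → v ≤ w →
        ((if v = 0 then (if d then t₀ else f₀) else
          if v % 2 = 1 then (if d then 2 * v - 1 else 2 * v + 1) else
            (if d then 2 * v - 4 else 2 * v - 2)) = if w = 0 then (if d' then t₀ else f₀) else
          if w % 2 = 1 then (if d' then 2 * w - 1 else 2 * w + 1) else
            (if d' then 2 * w - 4 else 2 * w - 2)) → v = w ∧ d = d' := by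
      clear! v w d d'
      intro v w d d' h1 h2 h3 h5 hvw h
      by_cases hv : v = 0
      · obtain ⟨-, -, -, hne, hd⟩ := h0 (by omega)
        by_cases hw : w = 0
        · refine ⟨by omega, ?_⟩
          simp only [hv, hw, ↓reduceIte] at h
          cases d <;> cases d' <;> simp_all
        · have := hd w (by omega) h5
          exfalso
          rcases Nat.mod_two_eq_zero_or_one w with hw' | hw' <;>
            cases d <;> cases d' <;>
            simp only [hv, hw, hw', zero_ne_one, Bool.false_eq_true, ↓reduceIte] at h <;>
            omega
      · have hw : w ≠ 0 := by omega
        clear h0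
        simp only [hv, hw, ↓reduceIte] at h
        rcases Nat.mod_two_eq_zero_or_one v with hv' | hv' <;>
          rcases Nat.mod_two_eq_zero_or_one w with hw' | hw' <;> cases d <;> cases d' <;>
          simp only [hv', hw', zero_ne_one, Bool.false_eq_true, ↓reduceIte, and_true, and_false,
            reduceCtorEq] at h ⊢ <;> omega
    rcases le_total v w with hvw | hvw
    · exact key v w d d' h1 h2 h3 h5 hvw h
    · have := key w v d' d h3 h5 h1 h2 hvw h.symm
      exact ⟨this.1.symm, this.2.symm⟩

/-- All vertices of one part of the quadrangulation by a complete bipartite graph with parts of `r`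
and `2 * r` vertices are split.  The neighbours `y v false` and `y v true` of the centre `c v` are
required to be distinct for all `v`, so that every vertex of the other part misses one edge. -/
theorem hasQuad_all {r : ℕ} (h3 : 3 ≤ r) (c : ℕ → ℕ) (y : ℕ → Bool → ℕ)
    (hc : ∀ v < r, c v < r + r)
    (h0 : matching (r + r) 1 (c 0) = y 0 false ∧ matching (r + r) 2 (c 0) = y 0 true)
    (hr : ∀ v, v + 1 = r → matching (r + r) 2 (c v) = y v false ∧
      matching (r + r) (v % 2) (c v) = y v true)
    (hv : ∀ v, 0 < v → v + 1 < r → matching (r + r) ((v + 1) % 2) (c v) = y v false ∧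
      matching (r + r) (v % 2) (c v) = y v true)
    (inj : ∀ v w, v < r → w < r → v ≤ w → ∀ d d', y v d = y w d' → v = w ∧ d = d') :
    HasQuad (r + r) (r + r) (r + r) True := by
  have := hasQuad_of_lastTwo (m := r) (n := r + r) (s := 0) (e := r) (Even.add_self r) (by omega)
    (by omega) le_rfl c y (fun v _ => hc v) ?_ ?_ ?_
  · simpa [two_mul] using this
  · intro v _ h
    by_cases h1 : v + 1 = r
    · rw [lastTwo, if_pos h1]; exact (hr v h1).1
    rw [lastTwo_of_lt (by omega)]
    by_cases h2 : v = 0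
    · subst h2; exact h0.1
    · exact (hv v (by omega) (by omega)).1
  · intro v _ h
    by_cases h2 : v = 0
    · subst h2; rw [lastTwo_pred_zero (by omega)]; exact h0.2
    rw [lastTwo_pred h h2]
    by_cases h1 : v + 1 = r
    · exact (hr v h1).2
    · exact (hv v (by omega) (by omega)).2
  · intro v w _ h1 _ h2 d d' h
    rcases le_total v w with hvw | hvw
    · exact inj v w h1 h2 hvw d d' h
    · have := inj w v h2 h1 hvw d' d h.symm
      exact ⟨this.1.symm, this.2.symm⟩

/-- The centres for even `r`: the vertices `0` and `r - 1`, at which the third matching occurs, miss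
`2 * r - 4`, `2 * r - 2` and `1`, `3`, and the other vertices the remaining numbers. -/
theorem hasQuad_all_of_even {r : ℕ} (hr : r % 2 = 0) (h4 : 4 ≤ r) :
    HasQuad (r + r) (r + r) (r + r) True := by
  refine hasQuad_all (by omega)
    (fun v => if v = 0 then 2 * r - 5 else if v + 1 = r then 4 else
      if v % 2 = 0 then 2 * v + 2 else 2 * v - 1)
    (fun v d => if v = 0 then (if d then 2 * r - 2 else 2 * r - 4) else
      if v + 1 = r then (if d then 3 else 1) else
      if v % 2 = 0 then (if d then 2 * v + 3 else 2 * v + 1) else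
        (if d then 2 * v else 2 * v - 2)) ?_ ⟨?_, ?_⟩ ?_ ?_ ?_
  · intro v h1
    split_ifs <;> omega
  · simp only [↓reduceIte, Bool.false_eq_true]
    rw [matching_one_odd (by omega) (by omega)]; omega
  · simp only [↓reduceIte]
    rw [matching_two_odd (by omega) (by omega)]; omega
  · intro v h
    have h' : v ≠ 0 := by omega
    simp only [h, h', ↓reduceIte, Bool.false_eq_true]
    rw [show v % 2 = 1 by omega, matching_one_even (by omega) (by omega)]
    exact ⟨matching_two_four (by omega), rfl⟩
  · intro v h h'
    have h1 : v ≠ 0 := by omega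
    have h2 : v + 1 ≠ r := by omega
    rcases Nat.mod_two_eq_zero_or_one v with h3 | h3 <;>
      simp only [h1, h2, h3, ↓reduceIte, Bool.false_eq_true, one_ne_zero]
    · rw [show (v + 1) % 2 = 1 by omega, matching_one_even (by omega) (by omega),
        matching_zero_even (by omega)]
      omega
    · rw [show (v + 1) % 2 = 0 by omega, matching_one_odd (by omega) (by omega),
        matching_zero_odd (by omega)]
      omega
  · intro v w h1 h2 h3 d d' h
    have hv : v = 0 ∨ v + 1 = r ∨ (v ≠ 0 ∧ v + 1 ≠ r ∧ v % 2 = 0) ∨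
        (v ≠ 0 ∧ v + 1 ≠ r ∧ v % 2 = 1) := by omega
    have hw : w = 0 ∨ w + 1 = r ∨ (w ≠ 0 ∧ w + 1 ≠ r ∧ w % 2 = 0) ∨
        (w ≠ 0 ∧ w + 1 ≠ r ∧ w % 2 = 1) := by omega
    have hr0 : ∀ v, v + 1 = r → v ≠ 0 := by omega
    rcases hv with hv | hv | ⟨hv, hv', hv''⟩ | ⟨hv, hv', hv''⟩ <;>
      rcases hw with hw | hw | ⟨hw, hw', hw''⟩ | ⟨hw, hw', hw''⟩ <;> cases d <;> cases d' <;>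
      simp only [*, one_ne_zero, Bool.false_eq_true, ↓reduceIte, and_true, and_false,
        reduceCtorEq] at h ⊢ <;> omega

/-- The centres for odd `r`: the vertices `0` and `r - 1`, at which the third matching occurs, miss
`3`, `1` and `2 * r - 1`, `2 * r - 4`, and the other vertices the remaining numbers. -/
theorem hasQuad_all_of_odd {r : ℕ} (hr : r % 2 = 1) (h3 : 3 ≤ r) :
    HasQuad (r + r) (r + r) (r + r) True := by
  refine hasQuad_all (by omega)
    (fun v => if v = 0 then 4 else if v + 1 = r then 2 * r - 3 else
      if v % 2 = 0 then 2 * v + 2 else if v = 1 then 2 * r - 1 else 2 * v - 3)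
    (fun v d => if v = 0 then (if d then 1 else 3) else
      if v + 1 = r then (if d then 2 * r - 4 else 2 * r - 1) else
      if v % 2 = 0 then (if d then 2 * v + 3 else 2 * v + 1) else
        (if d then 2 * v - 2 else if v = 1 then 2 * r - 2 else 2 * v - 4)) ?_ ⟨?_, ?_⟩ ?_ ?_ ?_
  · intro v h1
    split_ifs <;> omega
  · simp only [↓reduceIte, Bool.false_eq_true]
    rw [matching_one_even (by omega) (by omega)]
  · simp only [↓reduceIte]
    exact matching_two_four (by omega)
  · intro v h
    have h' : v ≠ 0 := by omega
    simp only [h, h', ↓reduceIte, Bool.false_eq_true]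
    rw [show v % 2 = 0 by omega, matching_zero_odd (by omega),
      matching_two_last (by omega) (by omega)]
    omega
  · intro v h h'
    have h1 : v ≠ 0 := by omega
    have h2 : v + 1 ≠ r := by omega
    rcases Nat.mod_two_eq_zero_or_one v with h3 | h3 <;>
      simp only [h1, h2, h3, ↓reduceIte, Bool.false_eq_true, one_ne_zero]
    · rw [show (v + 1) % 2 = 1 by omega, matching_one_even (by omega) (by omega),
        matching_zero_even (by omega)]
      omega
    · rw [show (v + 1) % 2 = 0 by omega]
      by_cases h4 : v = 1
      · simp only [h4, ↓reduceIte]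
        rw [matching_one_last (by omega) (by omega), matching_zero_odd (by omega)]
        omega
      · simp only [h4, ↓reduceIte]
        rw [matching_one_odd (by omega) (by omega), matching_zero_odd (by omega)]
        omega
  · intro v w h1 h2 h3 d d' h
    have hv : v = 0 ∨ v + 1 = r ∨ (v ≠ 0 ∧ v + 1 ≠ r ∧ v % 2 = 0) ∨
        (v ≠ 0 ∧ v + 1 ≠ r ∧ v % 2 = 1 ∧ v ≠ 1) ∨ v = 1 := by omega
    have hw : w = 0 ∨ w + 1 = r ∨ (w ≠ 0 ∧ w + 1 ≠ r ∧ w % 2 = 0) ∨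
        (w ≠ 0 ∧ w + 1 ≠ r ∧ w % 2 = 1 ∧ w ≠ 1) ∨ w = 1 := by omega
    have hr0 : ∀ v, v + 1 = r → v ≠ 0 := by omega
    have hr1 : 1 + 1 ≠ r := by omega
    rcases hv with hv | hv | ⟨hv, hv', hv''⟩ | ⟨hv, hv', hv'', hv1⟩ | hv <;>
      rcases hw with hw | hw | ⟨hw, hw', hw''⟩ | ⟨hw, hw', hw'', hw1⟩ | hw <;>
      cases d <;> cases d' <;>
      simp only [*, one_ne_zero, Bool.false_eq_true, ↓reduceIte, and_true, and_false,
        reduceCtorEq] at h ⊢ <;> omega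

/-- The cube is a quadrangulation of the sphere by the complete bipartite graph with two parts of
four vertices without a perfect matching. -/
theorem hasQuad_cube : HasQuad 4 4 4 False := by
  have := hasQuad_of_centres (m := 2) (n := 4) (s := 0) (e := 2) (N := False) (by decide) (by omega)
    le_rfl (fun i => (i + 1) % 2) (by intro i _; omega)
    (by intro i hi; interval_cases i <;> decide) (fun v => if v = 0 then 2 else 1)
    (fun v d => if v = 0 then (if d then 3 else 1) else (if d then 2 else 0))
    (by intro v _ hv; interval_cases v <;> decide) (by intro v _ hv; interval_cases v <;> decide)
    (by intro v _ hv; interval_cases v <;> decide)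
    (by intro v w _ hv _ hw; interval_cases v <;> interval_cases w <;> decide) False.elim
  exact this

theorem hasQuad_complete {m n : ℕ} (hn : Even n) (h4 : 4 ≤ n) (hm : 3 ≤ m) :
    HasQuad m n 0 True := by
  have := hasQuad_standard (m := m) (s := 1) (e := 1) (c₀ := 0) (f₀ := 0) (t₀ := 0) hn h4 hm
    (by omega) (by omega) (by omega)
  simpa using this

/-- Half as many vertices as there are missing edges are split in a quadrangulation by a complete
bipartite graph.  Vertex `0` is needed only if all of the `n` vertices in the smaller part miss an
edge and, for `n` divisible by `4`, `m` is at most `n + 1`. -/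
theorem hasQuad_of_even {m n k : ℕ} (hn : Even n) (hk : Even k) (h4 : 4 ≤ n) (hkn : k ≤ n)
    (hnm : n ≤ m) (h44 : ¬ (m = 4 ∧ k = 4)) (h54 : ¬ (m = 5 ∧ n = 4 ∧ k = 4)) :
    HasQuad m n k True := by
  have hn' := hn
  obtain ⟨r, hr⟩ := hn'
  obtain ⟨j, rfl⟩ := hk
  by_cases h1 : j + j < n
  · have := hasQuad_standard (m := m - j) (s := 1) (e := j + 1) (c₀ := 0) (f₀ := 0) (t₀ := 0) hn h4
      (by omega) (by omega) (by omega) (by omega)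
    convert this using 1 <;> omega
  obtain rfl : j = r := by omega
  by_cases h2 : m = n
  · rcases Nat.mod_two_eq_zero_or_one j with h | h
    · convert hasQuad_all_of_even h (by omega) using 1; omega
    · convert hasQuad_all_of_odd h (by omega) using 1; omega
  rcases Nat.mod_two_eq_zero_or_one j with h | h
  · by_cases h3 : m = n + 1
    · have := hasQuad_standard (m := m - j) (s := 0) (e := j) (c₀ := n - 5) (f₀ := n - 4)
        (t₀ := n - 2) hn h4 (by omega) (by omega) (by omega) fun _ => ⟨by omega,
          by rw [matching_one_odd (by omega) (by omega)]; omega,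
          by rw [matching_two_odd (by omega) (by omega)]; omega, by omega, by omega⟩
      convert this using 1 <;> omega
    · have := hasQuad_standard (m := m - j) (s := 1) (e := j + 1) (c₀ := 0) (f₀ := 0) (t₀ := 0) hn
        h4 (by omega) (by omega) (by omega) (by omega)
      convert this using 1 <;> omega
  · have := hasQuad_standard (m := m - j) (s := 0) (e := j) (c₀ := n - 3) (f₀ := n - 2)
      (t₀ := n - 1) hn h4 (by omega) (by omega) (by omega) fun _ => ⟨by omega,
        by rw [matching_one_odd (by omega) (by omega)]; omega,
        by rw [matching_two_last (by omega) (by omega)]; omega, by omega, by omega⟩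
    convert this using 1 <;> omega

/-! ### Maps from cyclic orders of the nonzero residues -/

namespace BipartiteMap

variable {P G : Type} [AddCommGroup G]

section cyclic

variable (nxt prv : P → P)

/-- The next position on the given side. -/
def side (s : Bool) (k : P) : P := if s then nxt k else prv k

/-- The next position on the side that is given relative to the parity of the position. -/
def sideB (par : P → Bool) (s : Bool) (k : P) : P := side nxt prv (s != par k) k

/-- The map of a bipartite graph whose two parts are copies of the group `G`, with edges from `i` to
`i + x k`, where the `x k` are cyclically ordered.  The local rotations at the vertices of one part
are `i + x k`, those of the other part are `j - x k`, reversed according to the parity of `k`: the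
signature of the edge depends on this parity. -/
def cyclic (par : P → Bool) (x : P → G) (prv_nxt : ∀ k, prv (nxt k) = k)
    (nxt_prv : ∀ k, nxt (prv k) = k)
    (conn_nxt : ∀ k l, Relation.EqvGen (fun u v => v = nxt u) k l)
    (par_nxt : ∀ k, par (nxt k) = !par k) (inj : Function.Injective x) :
    BipartiteMap (G × P × Bool) G G where
  t := fun z => (z.1, z.2.1, !z.2.2)
  cA := fun z => (z.1, side nxt prv z.2.2 z.2.1, !z.2.2)
  cB := fun z => (z.1 + x z.2.1 - x (sideB nxt prv par z.2.2 z.2.1),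
    sideB nxt prv par z.2.2 z.2.1, z.2.2)
  a := fun z => z.1
  b := fun z => z.1 + x z.2.1
  t_t := by rintro ⟨i, k, s⟩; simp
  cA_cA := by rintro ⟨i, k, _ | _⟩ <;> simp [side, prv_nxt, nxt_prv]
  cB_cB := by
    have par_prv : ∀ k, par (prv k) = !par k := fun k => by
      rw [← nxt_prv k, par_nxt, prv_nxt, Bool.not_not]
    rintro ⟨i, k, s⟩
    cases s <;> cases h : par k <;> simp [sideB, side, prv_nxt, nxt_prv, h, par_nxt, par_prv]
  t_ne := by rintro ⟨i, k, s⟩; simp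
  cA_ne := by rintro ⟨i, k, s⟩; simp
  cB_ne := by
    have par_prv : ∀ k, par (prv k) = !par k := fun k => by
      rw [← nxt_prv k, par_nxt, prv_nxt, Bool.not_not]
    rintro ⟨i, k, s⟩ h
    have h1 : sideB nxt prv par s k = k := congrArg (fun z => z.2.1) h
    have h2 := congrArg par h1
    revert h2
    unfold sideB side
    split_ifs
    · rw [par_nxt]; simp
    · rw [par_prv]; simp
  a_t := fun _ => rfl
  a_cA := fun _ => rfl
  b_t := fun _ => rfl
  b_cB := fun z => by simp
  edge := by
    rintro ⟨i, k, s⟩ ⟨j, l, s'⟩ h h'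
    obtain rfl : i = j := h
    obtain rfl : k = l := inj (add_left_cancel h')
    cases s <;> cases s' <;> simp
  connA := by
    rintro ⟨i, k, s⟩ ⟨j, l, s'⟩ h
    obtain rfl : i = j := h
    have flip : ∀ k s s', Relation.EqvGen (fun u v : G × P × Bool => v = (u.1, u.2.1, !u.2.2) ∨
        v = (u.1, side nxt prv u.2.2 u.2.1, !u.2.2)) (i, k, s) (i, k, s') := by
      intro z s s'
      by_cases h : s = s'
      · subst h; exact .refl _
      · obtain rfl : s' = !s := by revert h; cases s <;> cases s' <;> simp
        exact .rel _ _ (Or.inl rfl)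
    refine .trans _ _ _ (flip k s true) (.trans _ _ _ ?_ (flip l true s'))
    refine eqvGen_map (fun z => (i, z, true)) ?_ (conn_nxt k l)
    rintro u v rfl
    exact .trans _ _ _ (.rel _ _ (Or.inr rfl)) (flip _ false true)
  connB := by
    rintro ⟨i, k, s⟩ ⟨j, l, s'⟩ h
    change i + x k = j + x l at h
    set r := (fun u v : G × P × Bool => v = (u.1, u.2.1, !u.2.2) ∨
        v = (u.1 + x u.2.1 - x (sideB nxt prv par u.2.2 u.2.1), sideB nxt prv par u.2.2 u.2.1,
          u.2.2)) with hr
    have flip : ∀ i k s s', Relation.EqvGen r (i, k, s) (i, k, s') := by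
      intro i z s s'
      by_cases h : s = s'
      · subst h; exact .refl _
      · obtain rfl : s' = !s := by revert h; cases s <;> cases s' <;> simp
        exact .rel _ _ (Or.inl rfl)
    have main := eqvGen_map (r' := r) (fun z => (i + x k - x z, z, true)) ?_ (conn_nxt k l)
    · simp only [add_sub_cancel_right] at main
      rw [h, add_sub_cancel_right] at main
      exact .trans _ _ _ (flip i k s true) (main.trans _ _ _ (flip j l true s'))
    · rintro u v rfl
      refine .trans _ _ _ (flip _ u true (!par u)) (.trans _ _ _ (.rel _ _ (Or.inr ?_))
        (flip _ (nxt u) (!par u) true))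
      simp [sideB, side]

variable {nxt prv} {par : P → Bool} {x : P → G} (prv_nxt : ∀ k, prv (nxt k) = k)
    (nxt_prv : ∀ k, nxt (prv k) = k)
    (conn_nxt : ∀ k l, Relation.EqvGen (fun u v => v = nxt u) k l)
    (par_nxt : ∀ k, par (nxt k) = !par k) (inj : Function.Injective x)

theorem cyclic_isQuad (h : ∀ k, par k = true → x (nxt k) + x (prv k) = x k + x k) :
    (cyclic nxt prv par x prv_nxt nxt_prv conn_nxt par_nxt inj).IsQuad := by
  have par_prv : ∀ k, par (prv k) = !par k := fun k => by
    rw [← nxt_prv k, par_nxt, prv_nxt, Bool.not_not]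
  have h' : ∀ k, par k = true → x k - x (prv k) = x (nxt k) - x k := fun k hk => by
    rw [sub_eq_sub_iff_add_eq_add, ← h k hk]
  have b1 : (false == true) = false := rfl
  have b2 : (true == false) = false := rfl
  rintro ⟨i, k, s⟩
  cases s <;> cases hk : par k <;>
    simp only [cyclic, sideB, side, hk, par_nxt, par_prv, prv_nxt, nxt_prv, Bool.not_true,
      Bool.not_false, beq_self_eq_true, ↓reduceIte, Bool.false_eq_true, bne,
      Prod.mk.injEq, and_true, add_sub_assoc, add_right_inj, b1, b2]
  · have := h' (prv k) (by rw [par_prv, hk]; rfl)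
    rw [nxt_prv] at this
    exact this.symm
  · rw [← neg_sub, ← h' k hk, neg_sub]
  · have := h' (nxt k) (by rw [par_nxt, hk]; rfl)
    rw [prv_nxt] at this
    rw [← neg_sub, this, neg_sub]
  · exact h' k hk

/-- A colouring that every reflection changes would be changed by the translation of the first part
by `x k - x (nxt k)`; but this element has odd order. -/
theorem cyclic_not_orientable [Nonempty P] [Finite G] (hG : Odd (Nat.card G)) :
    ¬ (cyclic nxt prv par x prv_nxt nxt_prv conn_nxt par_nxt inj).Orientable := by
  rintro ⟨o, ho⟩
  obtain ⟨k⟩ := ‹Nonempty P›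
  have step : ∀ i, o (i, nxt k, true) = o (i, k, true) := by
    intro i
    have e1 : o (i, nxt k, false) = -o (i, k, true) := (ho (i, k, true)).2.1
    have e2 : o (i, nxt k, true) = -o (i, nxt k, false) := (ho (i, nxt k, false)).1
    rw [e2, e1, neg_neg]
  have shift : ∀ i, o (i + (x k - x (nxt k)), k, true) = -o (i, k, true) := by
    intro i
    have e1 : ∀ s, o (i, k, !s) = -o (i, k, s) := fun s => (ho (i, k, s)).1
    have e2 : ∀ s, o (i + (x k - x (nxt k)), nxt k, !s) = -o (i + (x k - x (nxt k)), nxt k, s) :=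
      fun s => (ho (_, nxt k, s)).1
    have e3 := (ho (i, k, !par k)).2.2
    have e4 : (cyclic nxt prv par x prv_nxt nxt_prv conn_nxt par_nxt inj).cB (i, k, !par k) =
        (i + (x k - x (nxt k)), nxt k, !par k) := by
      simp [cyclic, sideB, side, add_sub_assoc]
    rw [e4] at e3
    rw [← step]
    cases hk : par k
    · rw [hk] at e3
      exact e3
    · rw [hk] at e3
      have e5 := e2 true
      rw [e3, e1 true, neg_neg] at e5
      rw [e5, neg_neg]
  have many : ∀ (c : ℕ) i, o (i + c • (x k - x (nxt k)), k, true) = (-1) ^ c * o (i, k, true) := by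
    intro c
    induction c with
    | zero => intro i; simp
    | succ c ih =>
      intro i
      rw [succ_nsmul, ← add_assoc, shift, ih, pow_succ]
      simp
  have := many (Nat.card G) 0
  rw [card_nsmul_eq_zero', hG.neg_one_pow, add_zero] at this
  rw [neg_one_mul] at this
  exact neg_units_ne_self _ this.symm

theorem cyclic_omitsMatching (h0 : ∀ k, x k ≠ 0) [Finite G] [Finite P]
    (hcard : Nat.card P + 1 = Nat.card G) :
    (cyclic nxt prv par x prv_nxt nxt_prv conn_nxt par_nxt inj).OmitsMatching
      (fun i : G => i) fun i => i where
  injA := fun _ _ h => h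
  injB := fun _ _ h => h
  adj := by
    have surj : ∀ g : G, g ≠ 0 → ∃ k, x k = g := by
      intro g hg
      have hb : Function.Bijective (fun o : Option P => o.elim 0 x) := by
        rw [Nat.bijective_iff_injective_and_card]
        refine ⟨?_, by rw [Finite.card_option, hcard]⟩
        rintro (_ | k) (_ | l) h
        · rfl
        · exact absurd h.symm (h0 l)
        · exact absurd h (h0 k)
        · exact congrArg some (inj h)
      obtain ⟨_ | k, hk⟩ := hb.2 g
      · exact absurd hk.symm hg
      · exact ⟨k, hk⟩
    intro i j
    constructor
    · rintro ⟨⟨i', k, s⟩, h1, h2⟩ l ⟨h3, h4⟩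
      subst h3 h4
      obtain rfl : i' = l := h1
      exact h0 k (left_eq_add.1 h2.symm)
    · intro h
      obtain ⟨k, hk⟩ := surj (j - i) (fun e => h i ⟨rfl, (sub_eq_zero.1 e).symm⟩)
      exact ⟨(i, k, true), rfl, by change i + x k = j; rw [hk]; abel⟩

end cyclic

end BipartiteMap

/-- The cyclic map that is given by a list `x 0, …, x (n - 2)` of the nonzero residues modulo an odd
number `n`.  The condition for quadrilaterals says that the terms before and after an odd position
`k` add up to `2 * x k` modulo `n`. -/
theorem exists_cyclic {n : ℕ} (hn : n % 2 = 1) (h3 : 3 ≤ n) (x : ℕ → ℕ)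
    (hx : ∀ k, k + 1 < n → 0 < x k ∧ x k < n)
    (inj : ∀ k l, k + 1 < n → l + 1 < n → x k = x l → k = l) :
    ∃ (P : Type) (_ : Finite P) (M : BipartiteMap (ZMod n × P × Bool) (ZMod n) (ZMod n)),
      M.OmitsMatching (fun i : ZMod n => i) (fun i => i) ∧ ¬ M.Orientable ∧
      ((∀ k, k + 1 < n → k % 2 = 1 → x (if k + 2 = n then 0 else k + 1) + x (k - 1) = x k + x k ∨
        x (if k + 2 = n then 0 else k + 1) + x (k - 1) = x k + x k + n ∨
        x (if k + 2 = n then 0 else k + 1) + x (k - 1) + n = x k + x k) → M.IsQuad) := by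
  have : NeZero n := ⟨by omega⟩
  let par : Fin (n - 1) → Bool := fun k => decide (k.1 % 2 = 1)
  let X : Fin (n - 1) → ZMod n := fun k => (x k : ℕ)
  have cast_inj : ∀ a b : ℕ, a < n → b < n → (a : ZMod n) = b → a = b := by
    intro a b ha hb h
    have := (ZMod.natCast_eq_natCast_iff' a b n).1 h
    rwa [Nat.mod_eq_of_lt ha, Nat.mod_eq_of_lt hb] at this
  have par_nxt : ∀ k, par (cyclicNext k) = !par k := by
    intro k
    simp only [par, cyclicNext]
    rw [← decide_not, decide_eq_decide]
    split_ifs with h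
    · exact iff_of_false (by simp) (by omega)
    · omega
  have hinj : Function.Injective X := fun k l h =>
    Fin.ext (inj k l (by omega) (by omega) (cast_inj _ _ (hx k (by omega)).2 (hx l (by omega)).2 h))
  have : Nonempty (Fin (n - 1)) := ⟨⟨0, by omega⟩⟩
  refine ⟨Fin (n - 1), inferInstance,
    BipartiteMap.cyclic cyclicNext cyclicPrev par X cyclicPrev_cyclicNext
      cyclicNext_cyclicPrev eqvGen_cyclicNext par_nxt hinj, ?_, ?_, ?_⟩
  · refine BipartiteMap.cyclic_omitsMatching cyclicPrev_cyclicNext cyclicNext_cyclicPrev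
      eqvGen_cyclicNext par_nxt hinj ?_ ?_
    · intro k h
      have := cast_inj (x k) 0 (hx k (by omega)).2 (by omega) (by rw [Nat.cast_zero]; exact h)
      exact (hx k (by omega)).1.ne' this
    · rw [Nat.card_fin, Nat.card_zmod]; omega
  · refine BipartiteMap.cyclic_not_orientable cyclicPrev_cyclicNext cyclicNext_cyclicPrev
      eqvGen_cyclicNext par_nxt hinj ?_
    rw [Nat.card_zmod, Nat.odd_iff]; exact hn
  · intro h
    refine BipartiteMap.cyclic_isQuad cyclicPrev_cyclicNext cyclicNext_cyclicPrev
      eqvGen_cyclicNext par_nxt hinj ?_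
    intro k hk
    have hk' : k.1 % 2 = 1 := of_decide_eq_true hk
    have e1 : X (cyclicNext k) = ((x (if k.1 + 2 = n then 0 else k.1 + 1) : ℕ) : ZMod n) := by
      have : (cyclicNext k).1 = if k.1 + 2 = n then 0 else k.1 + 1 := by
        by_cases h : k.1 + 2 = n
        · rw [if_pos h]; exact if_pos (by omega)
        · rw [if_neg h]; exact if_neg (by omega)
      simp only [X, this]
    have e2 : X (cyclicPrev k) = ((x (k.1 - 1) : ℕ) : ZMod n) := by
      have : (cyclicPrev k).1 = k.1 - 1 := if_neg (by omega)
      simp only [X, this]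
    rw [e1, e2]
    change _ = ((x k.1 : ℕ) : ZMod n) + ((x k.1 : ℕ) : ZMod n)
    have hn0 : ((n : ℕ) : ZMod n) = 0 := ZMod.natCast_self n
    rcases h k.1 (by omega) hk' with h | h | h
    · exact_mod_cast congrArg (Nat.cast (R := ZMod n)) h
    · have := congrArg (Nat.cast (R := ZMod n)) h
      push_cast at this
      rwa [hn0, add_zero] at this
    · have := congrArg (Nat.cast (R := ZMod n)) h
      push_cast at this
      rwa [hn0, add_zero] at this

theorem hasQuad_of_cyclic {n : ℕ} (hn : n % 2 = 1) (h3 : 3 ≤ n) (x : ℕ → ℕ)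
    (hx : ∀ k, k + 1 < n → 0 < x k ∧ x k < n)
    (inj : ∀ k l, k + 1 < n → l + 1 < n → x k = x l → k = l)
    (h : ∀ k, k + 1 < n → k % 2 = 1 → x (if k + 2 = n then 0 else k + 1) + x (k - 1) = x k + x k ∨
        x (if k + 2 = n then 0 else k + 1) + x (k - 1) = x k + x k + n ∨
        x (if k + 2 = n then 0 else k + 1) + x (k - 1) + n = x k + x k) :
    HasQuad n n n True := by
  have : NeZero n := ⟨by omega⟩
  obtain ⟨P, _, M, h1, h2, h4⟩ := exists_cyclic hn h3 x hx inj
  exact ⟨_, _, _, ZMod n, inferInstance, inferInstance, inferInstance, inferInstance, M, _, _, h4 h,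
    h1, fun _ => h2, Nat.card_zmod n, Nat.card_zmod n, Nat.card_zmod n⟩

/-- The cyclic orders of the residues consist, with few exceptions, of runs of consecutive
numbers, which satisfy the condition for quadrilaterals. -/
theorem hasQuad_all_odd {n : ℕ} (hn : n % 2 = 1) (h7 : 7 ≤ n) : HasQuad n n n True := by
  have h4 : n % 4 = 3 ∨ n % 4 = 1 := by omega
  rcases h4 with h4 | h4
  · obtain ⟨q, rfl⟩ : ∃ q, n = 4 * q + 3 := ⟨n / 4, by omega⟩
    let x : ℕ → ℕ := fun k => if k = 4 * q + 1 then 1 else if k = 2 * q + 1 then 2 else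
      if k ≤ 2 * q then k + 3 else k + 2
    have x1 : x (4 * q + 1) = 1 := if_pos rfl
    have x2 : x (2 * q + 1) = 2 := (if_neg (by omega)).trans (if_pos rfl)
    have x3 : ∀ k ≤ 2 * q, x k = k + 3 := fun k hk =>
      (if_neg (by omega)).trans ((if_neg (by omega)).trans (if_pos hk))
    have x4 : ∀ k, 2 * q + 2 ≤ k → k ≤ 4 * q → x k = k + 2 := fun k hk hk' =>
      (if_neg (by omega)).trans ((if_neg (by omega)).trans (if_neg (by omega)))
    have cases' : ∀ k, k + 1 < 4 * q + 3 → k = 4 * q + 1 ∨ k = 2 * q + 1 ∨ k ≤ 2 * q ∨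
        (2 * q + 2 ≤ k ∧ k ≤ 4 * q) := by omega
    refine hasQuad_of_cyclic hn (by omega) x ?_ ?_ ?_
    · intro k hk
      rcases cases' k hk with rfl | rfl | h | ⟨h, h'⟩
      · rw [x1]; omega
      · rw [x2]; omega
      · rw [x3 k h]; omega
      · rw [x4 k h h']; omega
    · intro k l hk hl
      have val : ∀ k, k + 1 < 4 * q + 3 → (k = 4 * q + 1 ∧ x k = 1) ∨
          (k = 2 * q + 1 ∧ x k = 2) ∨ (k ≤ 2 * q ∧ x k = k + 3) ∨
          (2 * q + 2 ≤ k ∧ k ≤ 4 * q ∧ x k = k + 2) := by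
        intro k hk
        rcases cases' k hk with rfl | rfl | h | ⟨h, h'⟩
        · exact Or.inl ⟨rfl, x1⟩
        · exact Or.inr (Or.inl ⟨rfl, x2⟩)
        · exact Or.inr (Or.inr (Or.inl ⟨h, x3 k h⟩))
        · exact Or.inr (Or.inr (Or.inr ⟨h, h', x4 k h h'⟩))
      intro e
      have vk := val k hk
      have vl := val l hl
      clear_value x
      omega
    · intro k hk hk'
      rcases cases' k hk with rfl | rfl | h | ⟨h, h'⟩
      · rw [if_pos (by omega), x1, x3 0 (by omega), x4 _ (by omega) (by omega)]; omega
      · rw [if_neg (by omega), x2, x4 _ (by omega) (by omega), x3 _ (by omega)]; omega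
      · rw [if_neg (by omega), x3 k h, x3 _ (by omega), x3 _ (by omega)]; omega
      · rw [if_neg (by omega), x4 k h h', x4 _ (by omega) (by omega),
          x4 _ (by omega) (by omega)]; omega
  · obtain ⟨q, rfl⟩ : ∃ q, n = 4 * (q + 2) + 1 := ⟨n / 4 - 2, by omega⟩
    let x : ℕ → ℕ := fun k => if k = 2 * q + 1 then 4 * q + 7 else if k = 4 * q + 3 then 4 * q + 6
      else if k = 4 * q + 4 then 4 * q + 8 else if k = 4 * q + 5 then 2 * q + 2 else
      if k = 4 * q + 6 then 4 * q + 5 else if k = 4 * q + 7 then 2 * q + 3 else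
      if k ≤ 2 * q then k + 1 else k + 2
    have x1 : x (2 * q + 1) = 4 * q + 7 := if_pos rfl
    have x2 : x (4 * q + 3) = 4 * q + 6 := (if_neg (by omega)).trans (if_pos rfl)
    have x3 : x (4 * q + 4) = 4 * q + 8 :=
      (if_neg (by omega)).trans ((if_neg (by omega)).trans (if_pos rfl))
    have x4 : x (4 * q + 5) = 2 * q + 2 :=
      (if_neg (by omega)).trans ((if_neg (by omega)).trans ((if_neg (by omega)).trans (if_pos rfl)))
    have x5 : x (4 * q + 6) = 4 * q + 5 :=
      (if_neg (by omega)).trans ((if_neg (by omega)).trans ((if_neg (by omega)).trans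
        ((if_neg (by omega)).trans (if_pos rfl))))
    have x6 : x (4 * q + 7) = 2 * q + 3 :=
      (if_neg (by omega)).trans ((if_neg (by omega)).trans ((if_neg (by omega)).trans
        ((if_neg (by omega)).trans ((if_neg (by omega)).trans (if_pos rfl)))))
    have x7 : ∀ k ≤ 2 * q, x k = k + 1 := fun k hk =>
      (if_neg (by omega)).trans ((if_neg (by omega)).trans ((if_neg (by omega)).trans
        ((if_neg (by omega)).trans ((if_neg (by omega)).trans ((if_neg (by omega)).trans
        (if_pos hk))))))
    have x8 : ∀ k, 2 * q + 2 ≤ k → k ≤ 4 * q + 2 → x k = k + 2 := fun k hk hk' =>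
      (if_neg (by omega)).trans ((if_neg (by omega)).trans ((if_neg (by omega)).trans
        ((if_neg (by omega)).trans ((if_neg (by omega)).trans ((if_neg (by omega)).trans
        (if_neg (by omega)))))))
    have cases' : ∀ k, k + 1 < 4 * (q + 2) + 1 → k = 2 * q + 1 ∨ k = 4 * q + 3 ∨ k = 4 * q + 4 ∨
        k = 4 * q + 5 ∨ k = 4 * q + 6 ∨ k = 4 * q + 7 ∨ k ≤ 2 * q ∨
        (2 * q + 2 ≤ k ∧ k ≤ 4 * q + 2) := by omega
    refine hasQuad_of_cyclic hn (by omega) x ?_ ?_ ?_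
    · intro k hk
      rcases cases' k hk with rfl | rfl | rfl | rfl | rfl | rfl | h | ⟨h, h'⟩
      · rw [x1]; omega
      · rw [x2]; omega
      · rw [x3]; omega
      · rw [x4]; omega
      · rw [x5]; omega
      · rw [x6]; omega
      · rw [x7 k h]; omega
      · rw [x8 k h h']; omega
    · intro k l hk hl
      have val : ∀ k, k + 1 < 4 * (q + 2) + 1 → (k = 2 * q + 1 ∧ x k = 4 * q + 7) ∨
          (k = 4 * q + 3 ∧ x k = 4 * q + 6) ∨ (k = 4 * q + 4 ∧ x k = 4 * q + 8) ∨
          (k = 4 * q + 5 ∧ x k = 2 * q + 2) ∨ (k = 4 * q + 6 ∧ x k = 4 * q + 5) ∨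
          (k = 4 * q + 7 ∧ x k = 2 * q + 3) ∨ (k ≤ 2 * q ∧ x k = k + 1) ∨
          (2 * q + 2 ≤ k ∧ k ≤ 4 * q + 2 ∧ x k = k + 2) := by
        intro k hk
        rcases cases' k hk with rfl | rfl | rfl | rfl | rfl | rfl | h | ⟨h, h'⟩
        · exact .inl ⟨rfl, x1⟩
        · exact .inr (.inl ⟨rfl, x2⟩)
        · exact .inr (.inr (.inl ⟨rfl, x3⟩))
        · exact .inr (.inr (.inr (.inl ⟨rfl, x4⟩)))
        · exact .inr (.inr (.inr (.inr (.inl ⟨rfl, x5⟩))))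
        · exact .inr (.inr (.inr (.inr (.inr (.inl ⟨rfl, x6⟩)))))
        · exact .inr (.inr (.inr (.inr (.inr (.inr (.inl ⟨h, x7 k h⟩))))))
        · exact .inr (.inr (.inr (.inr (.inr (.inr (.inr ⟨h, h', x8 k h h'⟩))))))
      intro e
      have vk := val k hk
      have vl := val l hl
      clear_value x
      omega
    · intro k hk hk'
      rcases cases' k hk with rfl | rfl | rfl | rfl | rfl | rfl | h | ⟨h, h'⟩
      · rw [if_neg (by omega), x1, x8 _ (by omega) (by omega), x7 _ (by omega)]
        omega
      · rw [if_neg (by omega), x2, show 4 * q + 3 + 1 = 4 * q + 4 by omega, x3,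
          x8 _ (by omega) (by omega)]
        omega
      · omega
      · rw [if_neg (by omega), x4, show 4 * q + 5 + 1 = 4 * q + 6 by omega, x5,
          show 4 * q + 5 - 1 = 4 * q + 4 by omega, x3]
        omega
      · omega
      · rw [if_pos (by omega), x6, show 4 * q + 7 - 1 = 4 * q + 6 by omega, x5, x7 0 (by omega)]
        omega
      · rw [if_neg (by omega), x7 k h, x7 _ (by omega), x7 _ (by omega)]; omega
      · rw [if_neg (by omega), x8 k h h', x8 _ (by omega) (by omega),
          x8 _ (by omega) (by omega)]; omega

/-! ### The length of faces in bipartite graphs -/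

section lowerBound

variable {V : Type} {G : SimpleGraph V}

namespace EmbeddingScheme

/-- The other flag at the same corner. -/
def cornerFlag (P : EmbeddingScheme G) (f : G.Dart × ℤˣ) : G.Dart × ℤˣ :=
  if f.2 = 1 then (P.rot f.1, -1) else (P.rot⁻¹ f.1, 1)

/-- The flag at the other end of the same side of an edge. -/
def sideFlag (P : EmbeddingScheme G) (f : G.Dart × ℤˣ) : G.Dart × ℤˣ :=
  (f.1.symm, -(P.sign f.1 * f.2))

theorem mk_cornerFlag (P : EmbeddingScheme G) (f : G.Dart × ℤˣ) :
    Quot.mk P.FlagStep (P.cornerFlag f) = Quot.mk P.FlagStep f := by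
  obtain ⟨d, s⟩ := f
  rcases Int.units_eq_one_or s with rfl | rfl
  · exact (Quot.sound (FlagStep.corner d)).symm
  · have h := FlagStep.corner (P := P) (P.rot⁻¹ d)
    rw [show P.rot (P.rot⁻¹ d) = d from P.rot.apply_symm_apply d] at h
    exact Quot.sound h

theorem mk_sideFlag (P : EmbeddingScheme G) (f : G.Dart × ℤˣ) :
    Quot.mk P.FlagStep (P.sideFlag f) = Quot.mk P.FlagStep f :=
  (Quot.sound (FlagStep.side f.1 f.2)).symm

theorem cornerFlag_fst (P : EmbeddingScheme G) (f : G.Dart × ℤˣ) :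
    (P.cornerFlag f).1.fst = f.1.fst := by
  unfold cornerFlag
  split_ifs
  · exact P.rot_fst f.1
  · have := P.rot_fst (P.rot⁻¹ f.1)
    rw [show P.rot (P.rot⁻¹ f.1) = f.1 from P.rot.apply_symm_apply f.1] at this
    exact this.symm

theorem cornerFlag_ne (P : EmbeddingScheme G) (f : G.Dart × ℤˣ)
    (h : ∃ d : G.Dart, d.fst = f.1.fst ∧ d ≠ f.1) : (P.cornerFlag f).1 ≠ f.1 := by
  obtain ⟨d, hd, hne⟩ := h
  have hrot : P.rot f.1 ≠ f.1 := fun e => hne ((P.rot_cycle f.1 d hd.symm).eq_of_left e).symm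
  unfold cornerFlag
  split_ifs
  · exact hrot
  · exact fun e => hrot (Equiv.Perm.inv_eq_iff_eq.1 e).symm

/-- In an embedding of a bipartite graph without vertices of degree one, every face has length at
least four. -/
theorem four_mul_card_face_le [Finite G.Dart] (P : EmbeddingScheme G) (c : V → Bool)
    (hc : ∀ u v, G.Adj u v → c v = !c u)
    (hd : ∀ d : G.Dart, ∃ d' : G.Dart, d'.fst = d.fst ∧ d' ≠ d) :
    4 * Nat.card P.Face ≤ Nat.card G.Dart := by
  -- the walk along a face from the flag `f`; its first eight flags have distinct darts
  let w : G.Dart × ℤˣ → ℕ → G.Dart × ℤˣ := fun f i =>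
    Nat.rec f (fun i x => if i % 2 = 0 then P.sideFlag x else P.cornerFlag x) i
  have w_succ : ∀ f i, w f (i + 1) = if i % 2 = 0 then P.sideFlag (w f i) else
      P.cornerFlag (w f i) := fun f i => rfl
  have w_mk : ∀ f i, Quot.mk P.FlagStep (w f i) = Quot.mk P.FlagStep f := by
    intro f i
    induction i with
    | zero => rfl
    | succ i ih =>
      rw [w_succ]
      split_ifs
      · rw [mk_sideFlag, ih]
      · rw [mk_cornerFlag, ih]
  have w_side : ∀ f i, i % 2 = 0 → (w f (i + 1)).1 = (w f i).1.symm := by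
    intro f i hi
    rw [w_succ, if_pos hi]; rfl
  have w_corner : ∀ f i, i % 2 = 1 → (w f (i + 1)).1.fst = (w f i).1.fst ∧
      (w f (i + 1)).1.snd ≠ (w f i).1.snd := by
    intro f i hi
    rw [w_succ, if_neg (by omega)]
    refine ⟨P.cornerFlag_fst _, fun e => P.cornerFlag_ne (w f i) (hd _) ?_⟩
    exact SimpleGraph.Dart.ext _ _ (Prod.ext (P.cornerFlag_fst _) e)
  have w_inj : ∀ f, ∀ i < 8, ∀ j < 8, (w f i).1 = (w f j).1 → i = j := by
    intro f
    have e1 := w_side f 0 rfl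
    have e2 := w_corner f 1 rfl
    have e3 := w_side f 2 rfl
    have e4 := w_corner f 3 rfl
    have e5 := w_side f 4 rfl
    have e6 := w_corner f 5 rfl
    have e7 := w_side f 6 rfl
    have c0 := hc _ _ (w f 0).1.adj
    have c2 := hc _ _ (w f 2).1.adj
    have c4 := hc _ _ (w f 4).1.adj
    have c6 := hc _ _ (w f 6).1.adj
    have pair : ∀ i, i % 2 = 0 → (w f (i + 1)).1.fst = (w f i).1.snd ∧
        (w f (i + 1)).1.snd = (w f i).1.fst := by
      intro i hi
      rw [w_side f i hi]; exact ⟨rfl, rfl⟩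
    have p1 := pair 0 rfl
    have p3 := pair 2 rfl
    have p5 := pair 4 rfl
    have p7 := pair 6 rfl
    simp only [zero_add, Nat.reduceAdd] at e2 e4 e6 p1 p3 p5 p7
    -- the vertices along the face, numbered by the darts that leave them
    have q1 : (w f 2).1.snd ≠ (w f 0).1.fst := by rw [← p1.2]; exact e2.2
    have q2 : (w f 4).1.snd ≠ (w f 0).1.snd := by rw [← p1.1, ← e2.1, ← p3.2]; exact e4.2
    have q3 : (w f 6).1.snd ≠ (w f 2).1.snd := by rw [← p3.1, ← e4.1, ← p5.2]; exact e6.2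
    have r2 : (w f 2).1.fst = (w f 0).1.snd := e2.1.trans p1.1
    have r4 : (w f 4).1.fst = (w f 2).1.snd := e4.1.trans p3.1
    have r6 : (w f 6).1.fst = (w f 4).1.snd := e6.1.trans p5.1
    rw [r2] at c2
    rw [r4] at c4
    rw [r6] at c6
    rw [c0, Bool.not_not] at c2
    rw [c2] at c4
    rw [c4, Bool.not_not] at c6
    have key : ∀ i < 8, ∀ j < 8, (w f i).1 = (w f j).1 → i ≤ j → i = j := by
      intro i hi j hj h hij
      have h1 := congrArg (fun d : G.Dart => d.fst) h
      have h2 := congrArg (fun d : G.Dart => d.snd) h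
      have h3 := congrArg c h1
      clear e1 e2 e3 e4 e5 e6 e7 pair h
      interval_cases i <;> interval_cases j <;> first | rfl | omega | exfalso
      all_goals
        simp only [p1.1, p1.2, p3.1, p3.2, p5.1, p5.2, p7.1, p7.2, r2, r4, r6] at h1 h2 h3
        first
          | exact q1 h1
          | exact q1 h1.symm
          | exact q1 h2
          | exact q1 h2.symm
          | exact q2 h1
          | exact q2 h1.symm
          | exact q2 h2
          | exact q2 h2.symm
          | exact q3 h1
          | exact q3 h1.symm
          | exact q3 h2
          | exact q3 h2.symm
          | (simp [c0, c2, c4, c6] at h3)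
    intro i hi j hj h
    rcases le_total i j with hij | hij
    · exact key i hi j hj h hij
    · exact (key j hj i hi h.symm hij).symm
  have hle : Nat.card (P.Face × Fin 8) ≤ Nat.card (G.Dart × ℤˣ) := by
    refine Nat.card_le_card_of_injective (fun z => w z.1.out z.2) ?_
    rintro ⟨q, i⟩ ⟨q', j⟩ h
    have h1 := congrArg (Quot.mk P.FlagStep) h
    simp only [w_mk] at h1
    have h2 : q = q' := by
      rw [← Quot.out_eq q, ← Quot.out_eq q']; exact h1
    subst h2
    have := w_inj _ i i.2 j j.2 (congrArg Prod.fst h)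
    rw [Fin.ext this]
  rw [Nat.card_prod, Nat.card_prod, Nat.card_fin,
    Nat.card_eq_fintype_card (α := ℤˣ), Fintype.card_units_int] at hle
  omega

end EmbeddingScheme

end lowerBound

/-! ### Complete bipartite graphs minus a matching and their embeddings -/

section graph

variable {m n k : ℕ}

theorem bipartiteMinusMatching_adj (i : Fin m) (j : Fin n) :
    (bipartiteMinusMatching m n k).Adj (Sum.inl i) (Sum.inr j) ↔
      ¬ ((i : ℕ) = j ∧ (i : ℕ) < k) := by
  simp only [bipartiteMinusMatching, SimpleGraph.deleteEdges_adj, Set.mem_ofPred_eq, not_exists,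
    not_and]
  constructor
  · rintro ⟨-, h⟩ h1 h2
    exact h i j h1 h2 rfl
  · intro h
    refine ⟨by simp, fun i' j' h1 h2 h3 => ?_⟩
    have h4 : i = i' ∧ j = j' := by simpa using h3
    obtain ⟨rfl, rfl⟩ := h4
    exact h h1 h2

theorem bipartiteMinusMatching_isLeft (u v : Fin m ⊕ Fin n)
    (h : (bipartiteMinusMatching m n k).Adj u v) : v.isLeft = !u.isLeft := by
  have h := ((SimpleGraph.deleteEdges_adj).1 h).1
  rcases u with i | j <;> rcases v with i' | j' <;> simp_all

theorem exists_fin_ne_ne {n : ℕ} (hn : 3 ≤ n) (a b : ℕ) :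
    ∃ j : Fin n, (j : ℕ) ≠ a ∧ (j : ℕ) ≠ b := by
  by_cases h0 : 0 ≠ a ∧ 0 ≠ b
  · exact ⟨⟨0, by omega⟩, h0⟩
  by_cases h1 : 1 ≠ a ∧ 1 ≠ b
  · exact ⟨⟨1, by omega⟩, h1⟩
  · exact ⟨⟨2, by omega⟩, by simp only; omega, by simp only; omega⟩

theorem bipartiteMinusMatching_connected (hm : 3 ≤ m) (hn : 3 ≤ n) :
    (bipartiteMinusMatching m n k).Connected := by
  have hll : ∀ i i' : Fin m, (bipartiteMinusMatching m n k).Reachable (Sum.inl i) (Sum.inl i') := by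
    intro i i'
    obtain ⟨j, h1, h2⟩ := exists_fin_ne_ne hn i i'
    have e1 := (bipartiteMinusMatching_adj (k := k) i j).2 (fun h => h1 h.1.symm)
    have e2 := (bipartiteMinusMatching_adj (k := k) i' j).2 (fun h => h2 h.1.symm)
    exact e1.reachable.trans e2.reachable.symm
  have hr : ∀ j : Fin n, ∃ i : Fin m,
      (bipartiteMinusMatching m n k).Reachable (Sum.inl i) (Sum.inr j) := by
    intro j
    obtain ⟨i, h1, -⟩ := exists_fin_ne_ne hm j j
    exact ⟨i, ((bipartiteMinusMatching_adj (k := k) i j).2 (fun h => h1 h.1)).reachable⟩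
  have : Nonempty (Fin m ⊕ Fin n) := ⟨Sum.inl ⟨0, by omega⟩⟩
  refine ⟨?_⟩
  rintro (i | j) (i' | j')
  · exact hll i i'
  · obtain ⟨l, hl⟩ := hr j'
    exact (hll i l).trans hl
  · obtain ⟨l, hl⟩ := hr j
    exact ((hll i' l).trans hl).symm
  · obtain ⟨l, hl⟩ := hr j
    obtain ⟨l', hl'⟩ := hr j'
    exact hl.symm.trans ((hll l l').trans hl')

theorem exists_other_dart (hm : 3 ≤ m) (hn : 3 ≤ n) (d : (bipartiteMinusMatching m n k).Dart) :
    ∃ d' : (bipartiteMinusMatching m n k).Dart, d'.fst = d.fst ∧ d' ≠ d := by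
  obtain ⟨⟨u, v⟩, h⟩ := d
  have hc := bipartiteMinusMatching_isLeft u v h
  rcases u with i | j <;> rcases v with i' | j'
  · cases hc
  · obtain ⟨l, h1, h2⟩ := exists_fin_ne_ne hn i j'
    refine ⟨⟨(Sum.inl i, Sum.inr l), (bipartiteMinusMatching_adj i l).2 fun h => h1 h.1.symm⟩,
      rfl, fun e => ?_⟩
    have := congrArg (fun d : (bipartiteMinusMatching m n k).Dart => d.snd) e
    exact h2 (congrArg Fin.val (Sum.inr_injective this))
  · obtain ⟨l, h1, h2⟩ := exists_fin_ne_ne hm j i'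
    refine ⟨⟨(Sum.inr j, Sum.inl l), ((bipartiteMinusMatching_adj l j).2 fun h => h1 h.1).symm⟩,
      rfl, fun e => ?_⟩
    have := congrArg (fun d : (bipartiteMinusMatching m n k).Dart => d.snd) e
    exact h2 (congrArg Fin.val (Sum.inl_injective this))
  · cases hc

theorem finite_dart {V : Type} [Finite V] (G : SimpleGraph V) : Finite G.Dart :=
  Finite.of_injective (fun d => d.toProd) fun _ _ h => SimpleGraph.Dart.ext _ _ h

theorem card_dart_eq {V : Type} [Finite V] (G : SimpleGraph V) :
    Nat.card G.Dart = 2 * Nat.card G.edgeSet := by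
  classical
  have := Fintype.ofFinite V
  rw [Nat.card_eq_fintype_card, SimpleGraph.dart_card_eq_twice_card_edges,
    Nat.card_eq_fintype_card, SimpleGraph.edgeFinset_card]

/-- There are `m * n - k` edges, and twice as many darts. -/
theorem card_dart (hkm : k ≤ m) (hkn : k ≤ n) :
    Nat.card (bipartiteMinusMatching m n k).Dart + 2 * k = 2 * (m * n) := by
  classical
  let S : Type := {p : Fin m × Fin n // ¬ ((p.1 : ℕ) = p.2 ∧ (p.1 : ℕ) < k)}
  have h1 : Nat.card (Bool × S) = Nat.card (bipartiteMinusMatching m n k).Dart := by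
    refine Nat.card_eq_of_bijective (fun z => if z.1 then
      ⟨(Sum.inl z.2.1.1, Sum.inr z.2.1.2), (bipartiteMinusMatching_adj _ _).2 z.2.2⟩ else
      ⟨(Sum.inr z.2.1.2, Sum.inl z.2.1.1), ((bipartiteMinusMatching_adj _ _).2 z.2.2).symm⟩)
      ⟨?_, ?_⟩
    · rintro ⟨s, ⟨⟨i, j⟩, hp⟩⟩ ⟨s', ⟨⟨i', j'⟩, hp'⟩⟩ h
      have h1 := congrArg (fun d : (bipartiteMinusMatching m n k).Dart => d.fst) h
      have h2 := congrArg (fun d : (bipartiteMinusMatching m n k).Dart => d.snd) h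
      cases s <;> cases s' <;> simp at h1 h2 <;> subst h1 h2 <;> rfl
    · rintro ⟨⟨u, v⟩, h⟩
      have hc := bipartiteMinusMatching_isLeft u v h
      rcases u with i | j <;> rcases v with i' | j'
      · cases hc
      · exact ⟨⟨true, ⟨(i, j'), (bipartiteMinusMatching_adj _ _).1 h⟩⟩, rfl⟩
      · exact ⟨⟨false, ⟨(i', j), (bipartiteMinusMatching_adj _ _).1 h.symm⟩⟩, rfl⟩
      · cases hc
  have h2 : Nat.card (S ⊕ Fin k) = Nat.card (Fin m × Fin n) := by
    refine Nat.card_eq_of_bijective (Sum.elim (fun s => s.1)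
      fun l => (⟨l, by omega⟩, ⟨l, by omega⟩)) ⟨?_, ?_⟩
    · rintro (s | l) (s' | l') h
      · exact congrArg Sum.inl (Subtype.ext h)
      · exact absurd (by rw [show s.1 = _ from h]; exact ⟨rfl, l'.2⟩) s.2
      · exact absurd (by rw [← show _ = s'.1 from h]; exact ⟨rfl, l.2⟩) s'.2
      · have := congrArg (fun p : Fin m × Fin n => (p.1 : ℕ)) h
        exact congrArg Sum.inr (Fin.ext this)
    · rintro ⟨i, j⟩
      by_cases h : (i : ℕ) = j ∧ (i : ℕ) < k
      · exact ⟨Sum.inr ⟨i, h.2⟩, Prod.ext rfl (Fin.ext h.1)⟩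
      · exact ⟨Sum.inl ⟨(i, j), h⟩, rfl⟩
  have hS : Finite S := inferInstanceAs (Finite {p : Fin m × Fin n // _})
  rw [Nat.card_prod, Nat.card_eq_fintype_card (α := Bool), Fintype.card_bool] at h1
  rw [Nat.card_sum, Nat.card_prod, Nat.card_fin, Nat.card_fin, Nat.card_fin] at h2
  omega

/-- The Euler genus in terms of the number of faces, and the bound for this number. -/
theorem eulerGenus_eq (hm : 3 ≤ m) (hn : 3 ≤ n) (hkm : k ≤ m) (hkn : k ≤ n)
    (P : EmbeddingScheme (bipartiteMinusMatching m n k)) :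
    P.eulerGenus = 2 - (m + n : ℤ) + (m * n - k : ℤ) - Nat.card P.Face ∧
      2 * Nat.card P.Face + k ≤ m * n := by
  have := finite_dart (bipartiteMinusMatching m n k)
  have hF := P.four_mul_card_face_le Sum.isLeft bipartiteMinusMatching_isLeft
    (exists_other_dart hm hn)
  have hD := card_dart (m := m) (n := n) hkm hkn
  have hE := card_dart_eq (bipartiteMinusMatching m n k)
  have hconn := bipartiteMinusMatching_connected (k := k) hm hn
  have hC : Nat.card (bipartiteMinusMatching m n k).ConnectedComponent = 1 := by
    have := hconn.preconnected.subsingleton_connectedComponent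
    have : Nonempty (bipartiteMinusMatching m n k).ConnectedComponent :=
      ⟨SimpleGraph.connectedComponentMk _ (Sum.inl ⟨0, by omega⟩)⟩
    exact Nat.card_eq_one_iff_unique.2 ⟨inferInstance, inferInstance⟩
  have hI : Nat.card {v : Fin m ⊕ Fin n // ∀ w, ¬ (bipartiteMinusMatching m n k).Adj v w} = 0 := by
    rw [Finite.card_eq_zero_iff]
    refine ⟨?_⟩
    rintro ⟨i | j, h⟩
    · obtain ⟨l, h1, -⟩ := exists_fin_ne_ne hn i i
      exact h (Sum.inr l) ((bipartiteMinusMatching_adj i l).2 fun h => h1 h.1.symm)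
    · obtain ⟨l, h1, -⟩ := exists_fin_ne_ne hm j j
      exact h (Sum.inl l) ((bipartiteMinusMatching_adj l j).2 fun h => h1 h.1).symm
  have hV : Nat.card (Fin m ⊕ Fin n) = m + n := by rw [Nat.card_sum, Nat.card_fin, Nat.card_fin]
  have hE' : Nat.card (bipartiteMinusMatching m n k).edgeSet + k = m * n := by omega
  refine ⟨?_, by omega⟩
  unfold EmbeddingScheme.eulerGenus EmbeddingScheme.numFaces
  rw [hC, hI, hV]
  have : (Nat.card (bipartiteMinusMatching m n k).edgeSet : ℤ) + k = m * n := by exact_mod_cast hE'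
  push_cast
  linarith

/-- The nonorientable genus is `g` if `g` is the bound that follows from the number of edges (or `g
= 1`), and there is a scheme of Euler genus at most `g` that is nonorientable or leaves room for a
crosscap. -/
theorem nonorientableGenus_eq (hm : 3 ≤ m) (hn : 3 ≤ n) (hkm : k ≤ m) (hkn : k ≤ n) {g : ℕ}
    (hg : g = 1 ∨ 2 ≤ g ∧ 2 * (g : ℤ) ≤ (m - 2) * (n - 2) - k + 1)
    (P : EmbeddingScheme (bipartiteMinusMatching m n k)) (hP : P.eulerGenus ≤ g)
    (hP' : ¬ P.Orientable ∨ P.eulerGenus < g) :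
    nonorientableGenus (bipartiteMinusMatching m n k) = g := by
  refine le_antisymm (Nat.sInf_le ⟨by omega, P, (g - P.eulerGenus).toNat, by omega, ?_⟩) ?_
  · rcases hP' with h | h
    · exact Or.inl h
    · right; omega
  · refine le_csInf ⟨g, by omega, P, (g - P.eulerGenus).toNat, by omega, ?_⟩ ?_
    · rcases hP' with h | h
      · exact Or.inl h
      · right; omega
    · rintro g' ⟨h0, Q, h, hQ, -⟩
      obtain ⟨h1, h2⟩ := eulerGenus_eq hm hn hkm hkn Q
      rcases hg with rfl | ⟨-, hg⟩
      · exact h0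
      · have h3 : (2 * Nat.card Q.Face + k : ℤ) ≤ m * n := by exact_mod_cast h2
        have : 2 * (g : ℤ) ≤ 2 * g' + 1 := by nlinarith
        omega

end graph

section maps

variable {X α β K : Type}

/-- An injective numbering of a part of a finite type can be extended. -/
theorem exists_equiv_fin [Finite α] {m k : ℕ} {f : K → α} (hf : Function.Injective f)
    (hα : Nat.card α = m) (e : K ≃ Fin k) (hk : k ≤ m) :
    ∃ E : α ≃ Fin m, ∀ l, (E (f l) : ℕ) = e l := by
  classical
  let e₀ : α ≃ Fin m := Finite.equivFinOfCardEq hα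
  let f₁ : K → Fin m := fun l => e₀ (f l)
  let f₂ : K → Fin m := fun l => Fin.castLE hk (e l)
  have h₁ : Function.Injective f₁ := e₀.injective.comp hf
  have h₂ : Function.Injective f₂ := (Fin.castLE_injective hk).comp e.injective
  let σ : {x // x ∈ Set.range f₁} ≃ {x // x ∈ Set.range f₂} :=
    (Equiv.ofInjective f₁ h₁).symm.trans (Equiv.ofInjective f₂ h₂)
  refine ⟨e₀.trans σ.extendSubtype, fun l => ?_⟩
  have h := σ.extendSubtype_apply_of_mem (f₁ l) ⟨l, rfl⟩
  have h' : σ ⟨f₁ l, ⟨l, rfl⟩⟩ = Equiv.ofInjective f₂ h₂ l := by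
    simp only [σ, Equiv.trans_apply]
    congr 1
    exact (Equiv.ofInjective f₁ h₁).symm_apply_apply l
  rw [h'] at h
  exact congrArg Fin.val h

namespace BipartiteMap

/-- The same map with other names of the vertices. -/
def relabel {α' β' : Type} (M : BipartiteMap X α β) (e : α ≃ α') (e' : β ≃ β') :
    BipartiteMap X α' β' where
  __ := M
  a := fun x => e (M.a x)
  b := fun x => e' (M.b x)
  a_t := fun x => congrArg e (M.a_t x)
  a_cA := fun x => congrArg e (M.a_cA x)
  b_t := fun x => congrArg e' (M.b_t x)
  b_cB := fun x => congrArg e' (M.b_cB x)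
  edge := fun x y h h' => M.edge x y (e.injective h) (e'.injective h')
  connA := fun x y h => M.connA x y (e.injective h)
  connB := fun x y h => M.connB x y (e'.injective h)

theorem card_flags {G : SimpleGraph (α ⊕ β)} {M : BipartiteMap X α β} (hG : M.IsGraph G) :
    Nat.card X = Nat.card G.Dart := by
  classical
  obtain ⟨o, ho, -⟩ := exists_alternating M.t M.t M.t_t M.t_t M.t_ne M.t_ne
  refine Nat.card_eq_of_bijective (fun x => dart hG (decide (o x = 1)) x) ⟨?_, ?_⟩
  · intro x y h
    obtain ⟨h1, rfl | rfl⟩ := dart_inj hG h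
    · rfl
    · exfalso
      rw [ho, decide_eq_decide] at h1
      rcases Int.units_eq_one_or (o x) with h2 | h2 <;> rw [h2] at h1 <;> revert h1 <;> decide
  · intro d
    obtain ⟨e, x, rfl⟩ := exists_dart hG d
    by_cases h : decide (o x = 1) = e
    · exact ⟨x, by simp only [h]⟩
    · refine ⟨M.t x, ?_⟩
      have : decide (o (M.t x) = 1) = e := by
        rw [ho]
        rcases Int.units_eq_one_or (o x) with h2 | h2 <;> rw [h2] at h ⊢ <;> revert h <;>
          cases e <;> decide
      simp only [this, dart_t]

/-- The embedding scheme of a map of the complete bipartite graph without a matching. -/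
theorem exists_scheme_of_omitsMatching [Finite X] [Finite α] [Finite β] [Finite K] {m n k : ℕ}
    (M : BipartiteMap X α β) {f : K → α} {g : K → β} (h : M.OmitsMatching f g)
    (hα : Nat.card α = m) (hβ : Nat.card β = n) (hK : Nat.card K = k) (hkm : k ≤ m) (hkn : k ≤ n) :
    ∃ P : EmbeddingScheme (bipartiteMinusMatching m n k), M.numFaces ≤ Nat.card P.Face ∧
      (P.Orientable → M.Orientable) ∧
      Nat.card X = Nat.card (bipartiteMinusMatching m n k).Dart := by
  let e : K ≃ Fin k := Finite.equivFinOfCardEq hK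
  obtain ⟨E, hE⟩ := exists_equiv_fin h.injA hα e hkm
  obtain ⟨E', hE'⟩ := exists_equiv_fin h.injB hβ e hkn
  have hG : (M.relabel E E').IsGraph (bipartiteMinusMatching m n k) := by
    refine ⟨fun i j => ?_, fun i j hij => ?_, fun i j hij => ?_⟩
    · rw [bipartiteMinusMatching_adj]
      have h1 := h.adj (E.symm i) (E'.symm j)
      have h2 : (∃ x, (M.relabel E E').a x = i ∧ (M.relabel E E').b x = j) ↔
          ∃ x, M.a x = E.symm i ∧ M.b x = E'.symm j := by
        simp only [relabel, Equiv.eq_symm_apply]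
      rw [h2, h1]
      constructor
      · rintro hn l ⟨h3, h4⟩
        have h3 : E (f l) = i := by rw [h3, Equiv.apply_symm_apply]
        have h4 : E' (g l) = j := by rw [h4, Equiv.apply_symm_apply]
        refine hn ⟨?_, ?_⟩
        · rw [← h3, ← h4, hE, hE']
        · rw [← h3, hE]; exact (e l).2
      · rintro hn ⟨h3, h4⟩
        refine hn (e.symm ⟨i, h4⟩) ⟨?_, ?_⟩
        · rw [Equiv.eq_symm_apply]
          exact Fin.ext (by rw [hE, Equiv.apply_symm_apply])
        · rw [Equiv.eq_symm_apply]
          exact Fin.ext (by rw [hE', Equiv.apply_symm_apply]; exact h3)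
    · have := bipartiteMinusMatching_isLeft _ _ hij
      cases this
    · have := bipartiteMinusMatching_isLeft _ _ hij
      cases this
  have := finite_dart (bipartiteMinusMatching m n k)
  obtain ⟨P, h1, h2⟩ := exists_scheme (M.relabel E E') hG
  exact ⟨P, h1, h2, card_flags hG⟩

end BipartiteMap

/-- A near-quadrangulation has the least possible genus.  If it is not known to be nonorientable,
then it is assumed to be planar, and a crosscap is added. -/
theorem HasNearQuad.nonorientableGenus_eq {m n k g : ℕ} {N : Prop} (h : HasNearQuad m n k N)
    (hm : 3 ≤ m) (hn : 3 ≤ n) (hkm : k ≤ m) (hkn : k ≤ n)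
    (hN : N ∨ ((m - 2) * (n - 2) : ℤ) ≤ k) (hg' : ((m - 2) * (n - 2) - k : ℤ) ≤ 2 * g)
    (hg : g = 1 ∨ 2 ≤ g ∧ 2 * (g : ℤ) ≤ (m - 2) * (n - 2) - k + 1) :
    nonorientableGenus (bipartiteMinusMatching m n k) = g := by
  obtain ⟨X, α, β, K, _, _, _, _, M, f, f', ⟨H, h1, h2⟩, h3, h4, h5, h6, h7⟩ := h
  obtain ⟨P, h8, h9, h10⟩ := M.exists_scheme_of_omitsMatching h3 h5 h6 h7 hkm hkn
  have h11 := M.card_le_of_quad_off H h1 h2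
  have h12 := card_dart (m := m) (n := n) hkm hkn
  obtain ⟨h13, -⟩ := eulerGenus_eq hm hn hkm hkn P
  have h14 : m * n ≤ 2 * Nat.card P.Face + 1 + k := by omega
  have h15 : (m * n : ℤ) ≤ 2 * Nat.card P.Face + 1 + k := by exact_mod_cast h14
  have h16 : 2 * P.eulerGenus ≤ (m - 2) * (n - 2) - k + 1 := by rw [h13]; nlinarith
  refine GraphEmb.nonorientableGenus_eq hm hn hkm hkn hg P (by omega) ?_
  rcases hN with hN | hN
  · exact Or.inl fun h => h4 hN (h9 h)
  · right
    have : 0 < g := by omega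
    omega

/-- The graph for `m = n = k = 3` is a hexagon, which has an embedding in the projective plane. -/
theorem nonorientableGenus_three : nonorientableGenus (bipartiteMinusMatching 3 3 3) = 1 := by
  have : NeZero 3 := ⟨by omega⟩
  obtain ⟨P, _, M, h1, h2, -⟩ := exists_cyclic (n := 3) rfl le_rfl (fun k => k + 1) (by omega)
    (by omega)
  obtain ⟨Q, h8, h9, h10⟩ := M.exists_scheme_of_omitsMatching h1 (Nat.card_zmod 3) (Nat.card_zmod 3)
    (Nat.card_zmod 3) le_rfl le_rfl
  obtain ⟨h13, -⟩ := eulerGenus_eq le_rfl le_rfl le_rfl le_rfl Q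
  have h12 := card_dart (m := 3) (n := 3) (k := 3) le_rfl le_rfl
  have := finite_dart (bipartiteMinusMatching 3 3 3)
  have : Finite Q.Face := inferInstanceAs (Finite (Quot _))
  have hF : 0 < Nat.card Q.Face := by
    rw [Nat.card_pos_iff]
    have : Nonempty (bipartiteMinusMatching 3 3 3).Dart := (Nat.card_pos_iff.1 (by omega)).1
    exact ⟨⟨Quot.mk _ (Classical.arbitrary _, 1)⟩, inferInstance⟩
  refine nonorientableGenus_eq le_rfl le_rfl le_rfl le_rfl (Or.inl rfl) Q ?_ ?_
  · rw [h13]; push_cast; omega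
  · exact Or.inl fun h => h2 (h9 h)

end maps

/-! ### The nonorientable genus of complete bipartite graphs minus a matching -/

section genusFormula

variable {m n k : ℕ}

/-- The complete bipartite graph with parts of `2` and `n` vertices quadrangulates the sphere. -/
theorem hasQuad_two : HasQuad 2 n 0 False := by
  have hμ : ∀ x y : Bool, Relation.EqvGen (fun u v => v = !u ∨ v = !u) x y := by
    intro x y
    by_cases h : x = y
    · subst h; exact .refl _
    · exact .rel _ _ (Or.inl (by revert h; cases x <;> cases y <;> decide))
  let M : BipartiteMap (Fin n × Bool × Bool) (Fin n) Bool :=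
    BipartiteMap.rows cyclicNext cyclicPrev (fun _ x => !x) cyclicPrev_cyclicNext
      cyclicNext_cyclicPrev eqvGen_cyclicNext (fun _ x => Bool.not_not x) (by simp) (fun _ => hμ)
  have h : HasQuad n 2 0 False := by
    refine ⟨_, Fin n, Bool, Empty, inferInstance, inferInstance, inferInstance, inferInstance, M,
      Empty.elim, Empty.elim, ?_, ⟨fun e => e.elim, fun e => e.elim, ?_⟩, False.elim, ?_, ?_, ?_⟩
    · rintro ⟨i, x, _ | _⟩ <;> simp [M, BipartiteMap.rows]
    · exact fun i j => iff_of_true ⟨(i, j, true), rfl, rfl⟩ fun e => e.elim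
    · exact Nat.card_fin n
    · rw [Nat.card_eq_fintype_card, Fintype.card_bool]
    · simp
  exact h.swap

theorem HasQuad.addVertices {N : Prop} (h : HasQuad m n 0 N) (hn : Odd n) (h3 : 3 ≤ n) (hm : 0 < m)
    (hk : k ≤ n) : HasQuad (m + k) n k (N ∨ (5 ≤ n ∧ 1 ≤ k)) := by
  induction k with
  | zero => exact h.mono (by simp)
  | succ k ih =>
    exact ((ih (by omega)).addVertex hn h3 (by omega) (by omega)).mono (by tauto)

/-- Quadrangulations exist if the number of edges is even; they are nonorientable unless the
graph is planar. -/
theorem exists_hasQuad (hm : 3 ≤ m) (hn : 3 ≤ n) (hkm : k ≤ m) (hkn : k ≤ n)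
    (hE : (m * n + k) % 2 = 0) (h1 : ¬ (m = 5 ∧ n = 4 ∧ k = 4)) (h2 : ¬ (m = 4 ∧ n = 5 ∧ k = 4))
    (h3 : ¬ (m = 5 ∧ n = 5 ∧ k = 5)) (h4 : ¬ (m = 3 ∧ n = 3 ∧ k = 3)) :
    ∃ N, HasQuad m n k N ∧ (N ∨ ((m - 2) * (n - 2) : ℤ) ≤ k) := by
  wlog hnm : n ≤ m generalizing m n
  · obtain ⟨N, h, h'⟩ := this hn hm hkn hkm (by rwa [mul_comm]) (by omega) (by omega) (by omega)
      (by omega) (by omega)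
    exact ⟨N, h.swap, by rwa [mul_comm ((m : ℤ) - 2)]⟩
  rcases Nat.even_or_odd n with hn2 | hn2
  · have hk : Even k := by
      rw [← Nat.even_iff, Nat.even_add] at hE
      exact hE.1 (hn2.mul_left m)
    have : 4 ≤ n := by obtain ⟨r, hr⟩ := hn2; omega
    by_cases h44 : m = 4 ∧ k = 4
    · obtain ⟨rfl, rfl⟩ := h44
      obtain rfl : n = 4 := by omega
      exact ⟨False, hasQuad_cube, Or.inr (by norm_num)⟩
    · exact ⟨True, hasQuad_of_even hn2 hk this hkn hnm h44 h1, Or.inl trivial⟩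
  have hmk : Even (m + k) := by
    rw [← Nat.even_iff, Nat.even_add, Nat.even_mul] at hE
    rw [Nat.even_add]
    have : ¬ Even n := Nat.not_even_iff_odd.2 hn2
    tauto
  obtain ⟨c, hc⟩ := hmk
  by_cases hkm2 : k + 2 ≤ m
  · have hbase : HasQuad (m - k) n 0 (4 ≤ m - k) := by
      by_cases h : 4 ≤ m - k
      · exact (hasQuad_complete ⟨c - k, by omega⟩ h hn).swap.mono fun _ => trivial
      · rw [show m - k = 2 by omega]
        exact hasQuad_two.mono (by omega)
    have := hbase.addVertices hn2 hn (by omega) hkn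
    rw [Nat.sub_add_cancel hkm] at this
    refine ⟨_, this, ?_⟩
    by_cases h : 4 ≤ m - k
    · exact Or.inl (Or.inl h)
    by_cases h5 : 5 ≤ n
    · exact Or.inl (Or.inr ⟨h5, by omega⟩)
    · obtain rfl : n = 3 := by obtain ⟨r, hr⟩ := hn2; omega
      right
      push_cast
      omega
  · obtain ⟨r, hr⟩ := hn2
    obtain rfl : k = m := by omega
    obtain rfl : n = k := by omega
    exact ⟨True, hasQuad_all_odd (by omega) (by omega), Or.inl trivial⟩

/-- If the number of edges is odd, then an edge is deleted from a quadrangulation or, if no edge is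
missing, a vertex and an edge through a crosscap are added to one. -/
theorem exists_hasNearQuad (hm : 3 ≤ m) (hn : 3 ≤ n) (hkm : k ≤ m) (hkn : k ≤ n)
    (h1 : ¬ (m = 5 ∧ n = 4 ∧ k = 4)) (h2 : ¬ (m = 4 ∧ n = 5 ∧ k = 4))
    (h3 : ¬ (m = 5 ∧ n = 5 ∧ k = 5)) (h4 : ¬ (m = 3 ∧ n = 3 ∧ k = 3)) :
    ∃ N, HasNearQuad m n k N ∧ (N ∨ ((m - 2) * (n - 2) : ℤ) ≤ k) := by
  rcases Nat.mod_two_eq_zero_or_one (m * n + k) with hE | hE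
  · obtain ⟨N, h, h'⟩ := exists_hasQuad hm hn hkm hkn hE h1 h2 h3 h4
    exact ⟨N, h.hasNearQuad, h'⟩
  rcases Nat.eq_zero_or_pos k with rfl | hk
  · have hodd : Odd (m * n) := Nat.odd_iff.2 hE
    obtain ⟨⟨r, hr⟩, hn2⟩ := Nat.odd_mul.1 hodd
    have hbase : ∃ N, HasQuad (m - 1) n 0 N := by
      by_cases h : 4 ≤ m - 1
      · exact ⟨_, (hasQuad_complete ⟨r, by omega⟩ h hn).swap⟩
      · rw [show m - 1 = 2 by omega]
        exact ⟨_, hasQuad_two⟩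
    obtain ⟨N, h⟩ := hbase
    have := h.addVertexCrossing hn2 hn (by omega)
    rw [Nat.sub_add_cancel (by omega)] at this
    exact ⟨True, this, Or.inl trivial⟩
  · obtain ⟨l, rfl⟩ : ∃ l, k = l + 1 := ⟨k - 1, by omega⟩
    obtain ⟨N, h, h'⟩ := exists_hasQuad (k := l) hm hn (by omega) (by omega) (by omega) (by omega)
      (by omega) (by omega) (by omega)
    exact ⟨N, h.deleteEdge hm hn (by omega) (by omega), h'.imp_right fun h => by push_cast; omega⟩

theorem nonorientableGenus_formula (hm : 3 ≤ m) (hn : 3 ≤ n) (hkm : k ≤ m) (hkn : k ≤ n)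
    (h1 : ¬ (m = 5 ∧ n = 4 ∧ k = 4)) (h2 : ¬ (m = 4 ∧ n = 5 ∧ k = 4))
    (h3 : ¬ (m = 5 ∧ n = 5 ∧ k = 5)) :
    (nonorientableGenus (bipartiteMinusMatching m n k) : ℤ) =
      max ⌈(((m : ℚ) - 2) * ((n : ℚ) - 2) - (k : ℚ)) / 2⌉ 1 := by
  by_cases h4 : m = 3 ∧ n = 3 ∧ k = 3
  · obtain ⟨rfl, rfl, rfl⟩ := h4
    rw [nonorientableGenus_three]
    norm_num
  set D : ℤ := ((m : ℤ) - 2) * ((n : ℤ) - 2) - k with hD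
  set c : ℤ := ⌈(((m : ℚ) - 2) * ((n : ℚ) - 2) - (k : ℚ)) / 2⌉ with hc
  have hDq : ((m : ℚ) - 2) * ((n : ℚ) - 2) - (k : ℚ) = (D : ℚ) := by rw [hD]; push_cast; ring
  have c1 : D ≤ 2 * c := by
    have := Int.le_ceil ((((m : ℚ) - 2) * ((n : ℚ) - 2) - (k : ℚ)) / 2)
    rw [← hc, hDq, div_le_iff₀ (by norm_num)] at this
    have h : D ≤ c * 2 := by exact_mod_cast this
    omega
  have c2 : 2 * c ≤ D + 1 := by
    have := Int.ceil_lt_add_one ((((m : ℚ) - 2) * ((n : ℚ) - 2) - (k : ℚ)) / 2)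
    rw [← hc, hDq] at this
    have h : (2 * c : ℚ) < D + 2 := by linarith
    have h : 2 * c < D + 2 := by exact_mod_cast h
    omega
  obtain ⟨N, h, hN⟩ := exists_hasNearQuad hm hn hkm hkn h1 h2 h3 h4
  have hg : ((max c 1).toNat : ℤ) = max c 1 := Int.toNat_of_nonneg (by omega)
  rw [h.nonorientableGenus_eq hm hn hkm hkn hN (g := (max c 1).toNat) (by omega) (by omega), hg]

end genusFormula

end GraphEmb

theorem mainTheorem1 :
    (∀ m n k : ℕ, 3 ≤ m → 3 ≤ n → k ≤ m → k ≤ n →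
      (m, n, k) ≠ (5, 4, 4) → (m, n, k) ≠ (4, 5, 4) → (m, n, k) ≠ (5, 5, 5) →
      (GraphEmb.nonorientableGenus (GraphEmb.bipartiteMinusMatching m n k) : ℤ) =
        max ⌈(((m : ℚ) - 2) * ((n : ℚ) - 2) - (k : ℚ)) / 2⌉ 1) ∧
    (∀ n : ℕ, 6 ≤ n →
      (GraphEmb.nonorientableGenus (GraphEmb.bipartiteMinusMatching n n n) : ℤ) =
        ⌈(((n : ℚ) - 2) * ((n : ℚ) - 2) - (n : ℚ)) / 2⌉ ∧
      (GraphEmb.nonorientableGenus (GraphEmb.bipartiteMinusMatching n n n) : ℚ) =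
        ((n : ℚ) ^ 2 - 5 * (n : ℚ) + 4) / 2) ∧
    (∀ n : ℕ, 6 ≤ n →
      (GraphEmb.nonorientableGenus (GraphEmb.bipartiteMinusMatching (n + 1) n n) : ℤ) =
        ⌈(((n : ℚ) - 1) * ((n : ℚ) - 2) - (n : ℚ)) / 2⌉ ∧
      (Even n →
        (GraphEmb.nonorientableGenus (GraphEmb.bipartiteMinusMatching (n + 1) n n) : ℚ) =
          ((n : ℚ) ^ 2 - 4 * (n : ℚ) + 2) / 2)) := by
  -- for `n ≥ 6` the ceiling is at least `1`
  have ceil_pos : ∀ q : ℚ, 0 < q → max ⌈q⌉ 1 = ⌈q⌉ := fun q hq =>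
    max_eq_left (by have := Int.ceil_pos.2 hq; omega)
  refine ⟨fun m n k hm hn hkm hkn h1 h2 h3 => ?_, fun n hn => ?_, fun n hn => ?_⟩
  · simp only [ne_eq, Prod.mk.injEq] at h1 h2 h3
    exact GraphEmb.nonorientableGenus_formula hm hn hkm hkn h1 h2 h3
  · have hn' : (6 : ℚ) ≤ n := by exact_mod_cast hn
    have h := GraphEmb.nonorientableGenus_formula (m := n) (n := n) (k := n) (by omega) (by omega)
      le_rfl le_rfl (by omega) (by omega) (by omega)
    rw [ceil_pos _ (by nlinarith)] at h
    refine ⟨h, ?_⟩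
    obtain ⟨c, hc⟩ : Even ((n : ℤ) ^ 2 - 5 * n + 4) := by
      rcases Int.even_or_odd' (n : ℤ) with ⟨r, hr | hr⟩
      · exact ⟨2 * r ^ 2 - 5 * r + 2, by rw [hr]; ring⟩
      · exact ⟨2 * r ^ 2 - 3 * r, by rw [hr]; ring⟩
    have hq : (((n : ℚ) - 2) * ((n : ℚ) - 2) - (n : ℚ)) / 2 = (c : ℚ) := by
      have : ((n : ℚ) ^ 2 - 5 * n + 4) = c + c := by exact_mod_cast hc
      linarith
    rw [hq, Int.ceil_intCast] at h
    have h' : (GraphEmb.nonorientableGenus (GraphEmb.bipartiteMinusMatching n n n) : ℚ) = c := by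
      exact_mod_cast h
    rw [h', ← hq]
    ring
  · have hn' : (6 : ℚ) ≤ n := by exact_mod_cast hn
    have h := GraphEmb.nonorientableGenus_formula (m := n + 1) (n := n) (k := n) (by omega)
      (by omega) (by omega) le_rfl (by omega) (by omega) (by omega)
    have e : (((n + 1 : ℕ) : ℚ) - 2) * ((n : ℚ) - 2) - (n : ℚ) =
        ((n : ℚ) - 1) * ((n : ℚ) - 2) - (n : ℚ) := by push_cast; ring
    rw [e, ceil_pos _ (by nlinarith)] at h
    refine ⟨h, fun hn2 => ?_⟩
    obtain ⟨r, rfl⟩ := hn2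
    have hq : ((((r + r : ℕ) : ℚ) - 1) * (((r + r : ℕ) : ℚ) - 2) - ((r + r : ℕ) : ℚ)) / 2 =
        ((2 * (r : ℤ) ^ 2 - 4 * r + 1 : ℤ) : ℚ) := by
      push_cast; ring
    rw [hq, Int.ceil_intCast] at h
    have h' : (GraphEmb.nonorientableGenus (GraphEmb.bipartiteMinusMatching (r + r + 1) (r + r)
        (r + r)) : ℚ) = ((2 * (r : ℤ) ^ 2 - 4 * r + 1 : ℤ) : ℚ) := by
      exact_mod_cast h
    rw [h']
    push_cast
    ring
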